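/- **Setting.** Let $(\mathcal S,\mathcal A,\mathsf P,c)$ be a finite average-reward MDP with $|c(s,a)|\le\bar c$, and let $\pi$ be a randomized stationary policy with $\pi(a|s)>0$ for all $s,a$ whose state chain $P_\pi(s,s')=\sum_a\pi(a|s)\mathsf P(s'|s,a)$ is irreducible and aperiodic, with stationary distribution $\nu$. Let $C_P>0$ and $\varrho\in(0,1)$ satisfy $\max_s\|(P_\pi)^t(s,\cdot)-\nu\|_1\le C_P\varrho^t$ for all integers $t\ge0$. Put $P((s,a),(s',a'))=\mathsf P(s'|s,a)\pi(a'|s')$, $D=\mathrm{diag}(\nu(s)\pi(a|s))$, $\|x\|_D=\sqrt{x^\top Dx}$, $\rho^*=\sum_{s,a}\nu(s)\pi(a|s)c(s,a)$. Let $\Psi=[\psi_1,\dots,\psi_d]\in\mathbb R^{(\mathcal S\times\mathcal A)\times d}$, $d\ge1$, have linearly independent columns whose span $\mathbb S$ does not contain $\mathbf 1$, and rows $\psi(s,a)$ with $\|\psi(s,a)\|_2\le1$. Let $\theta^*$ be the solution of $\Psi^\top D\Psi\theta^*=\Psi^\top DP\Psi\theta^*+\Psi^\top D(c-\rho^*\mathbf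 1)$; let $\bar Q(s,a)=\sum_{t\ge0}\mathbb E_\pi[c(s_t,a_t)-\rho^*\mid s_0=s,a_0=a]$ and $\bar Q^*=\bar Q+\hat b\mathbf 1$, where $\hat b$ minimizes $b\mapsto\|\bar Q+b\mathbf 1-\Psi\theta^*\|_D$. Put $B=\Psi^\top D\Psi$, $\mu=\lambda_{\min}(B)$, $\Phi=\Psi B^{-1/2}$, $M=\Phi^\top DP\Phi$, $1-\beta=\inf\{x^\top D(I-P)x:\ x\in\mathbb S,\ \|x\|_D=1\}$, $$C_M=\frac{C_P\,\|\Psi\|_2\,\|I-P\|_2}{\sqrt{\min_{s,a}\nu(s)\pi(a|s)}},\qquad C_{\max}=\max\{C_P,\,C_M,\,C_P\|\Psi\|_2\},$$ $$W_1=22\,\mathrm{tr}\{(I-M)^{-1}\bar\Sigma(I-M)^{-\top}\}+\frac{4}{\mu(1-\beta)^2}\|\bar Q^*-\Psi\theta^*\|_D^2,$$ where $\bar\Sigma$ is the covariance matrix of $B^{-1/2}(\langle\psi(s,a)-\psi(s',a'),\theta^*\rangle-c(s,a))\psi(s,a)$ for $s\sim\nu$, $a\sim\pi(\cdot|s)$,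 $s'\sim\mathsf P(\cdot|s,a)$, $a'\sim\pi(\cdot|s')$. **Algorithm (VRTD).** Given $\hat\theta_0=\theta^0\in\mathbb R^d$, $\eta>0$ and integers $N,N',T,\tau,\tau'$, the method reads a single trajectory of state-action pairs generated by $\pi$ and $\mathsf P$ from an arbitrary initial state distribution, with $a_0\sim\pi(\cdot|s_0)$. For a tuple $\xi=((s,a),(s',a'))$ of two successive pairs let $\tilde g(\theta,\rho,\xi)=(\langle\psi(s,a)-\psi(s',a'),\theta\rangle-c(s,a)+\rho)\psi(s,a)$. Samples are collected consecutively along the trajectory; each collected sample is the last one of a block of successive samples, and each new block is formed from the pairs that follow the pairs of the preceding block (a block of $n$ successive tuples consists of $n+1$ successive pairs). Epoch $k=1,\dots,K$ sets $\theta_1=\tilde\theta=\hat\theta_{k-1}$; sets $\tilde\rho$ to the average of $c$ over $N'$ pairs, each the last of $\tau'+1$ successive pairs; sets $\hat g$ to the average of $\tilde g(\tilde\theta,\tilde\rho,\cdot)$ over $N$ tuples, each the last of $\tau'+1$ successive tuples; for $t=1,\dots,T$ takes a tuple $\xi_t$, the last of $\tau+1$ successive tuples, and sets $$\theta_{t+1}=\theta_t-\eta\big(\tilde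 g(\theta_t,\tilde\rho,\xi_t)-\tilde g(\tilde\theta,\tilde\rho,\xi_t)+\hat g\big);$$ and outputs $\hat\theta_k=\frac1T\sum_{t=1}^T\theta_t$. **Theorem.** There are universal constants $b_1,b_2>0$ such that, in every such setting, if $$0<\eta\le\frac{1-\beta}{845},\quad T\ge\frac{64}{\mu(1-\beta)\eta},\quad N\ge\frac{1160}{\mu(1-\beta)^2},\quad N'\ge\frac{1}{\mu(1-\beta)^2},$$ $$\varrho^\tau\le\frac{\sqrt\mu\,\eta}{C_M},\qquad \varrho^{\tau'}\le\min\Big\{\frac{\min_{s,a}\nu(s)\pi(a|s)}{C_P},\ \frac1{4C_{\max}+1}\Big\},$$ then for every number $K$ of epochs $$\|\Psi\mathbb E[\hat\theta_K]-\Psi\theta^*\|_D^2\le\frac1{2^K}\|\Psi\theta^0-\Psi\theta^*\|_D^2+\Big(b_1C_{\max}^2\varrho^{2\tau'}+\frac{b_2C_{\max}\varrho^\tau}{(1-\beta)\sqrt\mu}\Big)\Big(\|\Psi\theta^0-\Psi\theta^*\|_D^2+\frac{W_1}{N}+\bar c^2\Big).$$ -/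

import Mathlib

open MeasureTheory

noncomputable section

namespace AverageReward

/-- A finite average-reward Markov decision process: transition kernel and cost function. -/
structure MDP (S A : Type*) [Fintype S] where
  /-- `kernel s a s'` is the probability of moving to `s'` from `s` under the action `a`. -/
  kernel : S → A → S → ℝ
  kernel_mem : ∀ s a, kernel s a ∈ stdSimplex ℝ S
  /-- The instantaneous cost. -/
  cost : S → A → ℝ

/-- A randomized stationary policy; `prob s a` is the probability of `a` in state `s`. -/
structure Policy (S A : Type*) [Fintype A] where
  prob : S → A → ℝ
  prob_mem : ∀ s, prob s ∈ stdSimplex ℝ A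

/-- All return times of every state have greatest common divisor one. -/
def IsAperiodic {S : Type*} [Fintype S] [DecidableEq S] (Q : Matrix S S ℝ) : Prop :=
  ∀ s : S, ∀ g : ℕ, (∀ n : ℕ, 1 ≤ n → 0 < (Q ^ n) s s → g ∣ n) → g = 1

/-- `ν` is a stationary distribution of the stochastic matrix `Q`. -/
def IsStationary {S : Type*} [Fintype S] (Q : Matrix S S ℝ) (ν : S → ℝ) : Prop :=
  ν ∈ stdSimplex ℝ S ∧ Matrix.vecMul ν Q = ν

section Chain

variable {S A : Type*} [Fintype S] [Fintype A]

/-- The state transition matrix `P_π`. -/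
def stateMatrix (m : MDP S A) (π : Policy S A) : Matrix S S ℝ :=
  fun s s' => ∑ a, π.prob s a * m.kernel s a s'

/-- The state-action transition matrix `P = P^π`. -/
def pairMatrix (m : MDP S A) (π : Policy S A) : Matrix (S × A) (S × A) ℝ :=
  fun x y => m.kernel x.1 x.2 y.1 * π.prob y.1 y.2

/-- The Markov chain of the states induced by `π` is irreducible and aperiodic. -/
def IsErgodic [DecidableEq S] (m : MDP S A) (π : Policy S A) : Prop :=
  (stateMatrix m π).IsIrreducible ∧ IsAperiodic (stateMatrix m π)

/-- `C_P` and `ϱ` bound the mixing of the state chain: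
`max_s ‖(P_π)^t(s,·) - ν‖₁ ≤ C_P ϱ^t` for all `t ≥ 0`. -/
def MixingBound [DecidableEq S] (m : MDP S A) (π : Policy S A) (ν : S → ℝ) (CP ϱ : ℝ) : Prop :=
  ∀ (t : ℕ) (s : S), ∑ s', |((stateMatrix m π) ^ t) s s' - ν s'| ≤ CP * ϱ ^ t

/-- The weight `ν(s) π(a|s)` of a state-action pair. -/
def weight (π : Policy S A) (ν : S → ℝ) : S × A → ℝ := fun x => ν x.1 * π.prob x.1 x.2

/-- The diagonal weighting matrix `D`. -/
def weightMatrix [DecidableEq S] [DecidableEq A] (π : Policy S A) (ν : S → ℝ) :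
    Matrix (S × A) (S × A) ℝ :=
  Matrix.diagonal (weight π ν)

/-- The norm `‖v‖_D = (vᵀ D v)^{1/2}`. -/
def normD [DecidableEq S] [DecidableEq A] (π : Policy S A) (ν : S → ℝ) (v : S × A → ℝ) : ℝ :=
  Real.sqrt (v ⬝ᵥ (weightMatrix π ν).mulVec v)

/-- The cost as a vector indexed by the state-action pairs. -/
def costVec (m : MDP S A) : S × A → ℝ := fun x => m.cost x.1 x.2

/-- The average cost `ρ* = ∑_s ν(s) ∑_a π(a|s) c(s,a)`. -/
def avgCost (m : MDP S A) (π : Policy S A) (ν : S → ℝ) : ℝ :=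
  ∑ s, ν s * ∑ a, π.prob s a * m.cost s a

/-- The basic differential Q-function
`(s,a) ↦ ∑_{t ≥ 0} E_π[c(s_t,a_t) - ρ* | s_0 = s, a_0 = a]`. -/
def basicQ [DecidableEq S] [DecidableEq A] (m : MDP S A) (π : Policy S A) (ν : S → ℝ) :
    S × A → ℝ :=
  fun x => ∑' t : ℕ, ((pairMatrix m π) ^ t).mulVec (fun y => costVec m y - avgCost m π ν) x

/-- `X = ((s_0,a_0),(s_1,a_1),…)` is a trajectory generated by `π` and the transition kernel:
`s_0` has any law, `a_0 ∼ π(·|s_0)`, and the state-action pairs form a Markov chain with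
transition matrix `P`. -/
def IsTrajectory (m : MDP S A) (π : Policy S A) {Ω : Type*} [MeasurableSpace Ω]
    (ℙ : Measure Ω) (X : ℕ → Ω → S × A) : Prop :=
  (∀ n x, MeasurableSet {ω | X n ω = x}) ∧
  (∀ s a, ℙ.real {ω | X 0 ω = (s, a)} = ℙ.real {ω | (X 0 ω).1 = s} * π.prob s a) ∧
  (∀ (n : ℕ) (x : ℕ → S × A),
    ℙ.real {ω | ∀ i ≤ n + 1, X i ω = x i} =
      ℙ.real {ω | ∀ i ≤ n, X i ω = x i} * pairMatrix m π (x n) (x (n + 1)))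

end Chain

section Features

variable {S A : Type*} [Fintype S] [Fintype A] [DecidableEq S] [DecidableEq A] {d : ℕ}

/-- The admissible feature matrices `Ψ = [ψ_1, …, ψ_d]`: linearly independent columns, feature
vectors `ψ(s,a)` (the rows) of Euclidean norm at most one, and `𝟏` not in the column span. -/
def AdmissibleFeatures (Ψ : Matrix (S × A) (Fin d) ℝ) : Prop :=
  LinearIndependent ℝ Ψ.transpose ∧
  (∀ x, Real.sqrt (∑ j, Ψ x j ^ 2) ≤ 1) ∧
  (fun _ : S × A => (1 : ℝ)) ∉ Submodule.span ℝ (Set.range Ψ.transpose)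

/-- `θ` solves the projected Bellman equation `Ψᵀ D Ψ θ = Ψᵀ D P Ψ θ + Ψᵀ D (c - ρ* 𝟏)`. -/
def SolvesProjectedBellman (m : MDP S A) (π : Policy S A) (ν : S → ℝ)
    (Ψ : Matrix (S × A) (Fin d) ℝ) (θ : Fin d → ℝ) : Prop :=
  (Ψ.transpose * weightMatrix π ν * Ψ).mulVec θ =
    (Ψ.transpose * weightMatrix π ν * pairMatrix m π * Ψ).mulVec θ +
      (Ψ.transpose * weightMatrix π ν).mulVec (fun x => costVec m x - avgCost m π ν)

/-- The Gram matrix `B`, `B_{ij} = ⟨ψ_i, ψ_j⟩_D`. -/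
def gram (π : Policy S A) (ν : S → ℝ) (Ψ : Matrix (S × A) (Fin d) ℝ) :
    Matrix (Fin d) (Fin d) ℝ :=
  Ψ.transpose * weightMatrix π ν * Ψ

/-- `μ`, the smallest eigenvalue of `B`. -/
def minEig (π : Policy S A) (ν : S → ℝ) (Ψ : Matrix (S × A) (Fin d) ℝ) : ℝ :=
  sInf (spectrum ℝ (gram π ν Ψ))

/-- `B^{-1/2}`, through the functional calculus of symmetric matrices. -/
def gramInvSqrt (π : Policy S A) (ν : S → ℝ) (Ψ : Matrix (S × A) (Fin d) ℝ) :
    Matrix (Fin d) (Fin d) ℝ :=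
  cfc (fun t : ℝ => (Real.sqrt t)⁻¹) (gram π ν Ψ)

/-- `Φ = Ψ B^{-1/2}`. -/
def orthoFeatures (π : Policy S A) (ν : S → ℝ) (Ψ : Matrix (S × A) (Fin d) ℝ) :
    Matrix (S × A) (Fin d) ℝ :=
  Ψ * gramInvSqrt π ν Ψ

/-- `M = Φᵀ D P Φ`. -/
def projTransition (m : MDP S A) (π : Policy S A) (ν : S → ℝ) (Ψ : Matrix (S × A) (Fin d) ℝ) :
    Matrix (Fin d) (Fin d) ℝ :=
  (orthoFeatures π ν Ψ).transpose * weightMatrix π ν * pairMatrix m π * orthoFeatures π ν Ψ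

/-- `1 - β = inf {xᵀ D (I - P) x : x ∈ span{ψ_1, …, ψ_d}, ‖x‖_D = 1}`. -/
def oneSubBeta (m : MDP S A) (π : Policy S A) (ν : S → ℝ) (Ψ : Matrix (S × A) (Fin d) ℝ) : ℝ :=
  sInf ((fun x : S × A → ℝ => x ⬝ᵥ (weightMatrix π ν * (1 - pairMatrix m π)).mulVec x) ''
    {x | x ∈ Submodule.span ℝ (Set.range Ψ.transpose) ∧ normD π ν x = 1})

/-- The random vector `B^{-1/2} (⟨ψ(s,a) - ψ(s',a'), θ⟩ - c(s,a)) ψ(s,a)` as a function of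
`x = (s,a)` and `y = (s',a')`. -/
def noiseVec (m : MDP S A) (π : Policy S A) (ν : S → ℝ) (Ψ : Matrix (S × A) (Fin d) ℝ)
    (θ : Fin d → ℝ) (x y : S × A) : Fin d → ℝ :=
  (gramInvSqrt π ν Ψ).mulVec ((((Ψ x - Ψ y) ⬝ᵥ θ) - costVec m x) • Ψ x)

/-- The mean of `noiseVec` under `s ∼ ν, a ∼ π(·|s), s' ∼ 𝖯(·|s,a), a' ∼ π(·|s')`. -/
def noiseMean (m : MDP S A) (π : Policy S A) (ν : S → ℝ) (Ψ : Matrix (S × A) (Fin d) ℝ)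
    (θ : Fin d → ℝ) : Fin d → ℝ :=
  ∑ x, ∑ y, (weight π ν x * pairMatrix m π x y) • noiseVec m π ν Ψ θ x y

/-- The covariance matrix of `noiseVec` under the same law. -/
def noiseCov (m : MDP S A) (π : Policy S A) (ν : S → ℝ) (Ψ : Matrix (S × A) (Fin d) ℝ)
    (θ : Fin d → ℝ) : Matrix (Fin d) (Fin d) ℝ :=
  ∑ x, ∑ y, (weight π ν x * pairMatrix m π x y) •
    Matrix.vecMulVec (noiseVec m π ν Ψ θ x y - noiseMean m π ν Ψ θ)
      (noiseVec m π ν Ψ θ x y - noiseMean m π ν Ψ θ)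

/-- `W₁ = 22 tr((I - M)⁻¹ Σ (I - M)⁻ᵀ) + 4 / (μ (1 - β)²) ‖Q* - Ψ θ*‖_D²`. -/
def wOne (m : MDP S A) (π : Policy S A) (ν : S → ℝ) (Ψ : Matrix (S × A) (Fin d) ℝ)
    (θ : Fin d → ℝ) (Q : S × A → ℝ) : ℝ :=
  22 * ((1 - projTransition m π ν Ψ)⁻¹ * noiseCov m π ν Ψ θ *
      ((1 - projTransition m π ν Ψ)⁻¹).transpose).trace +
    4 / (minEig π ν Ψ * oneSubBeta m π ν Ψ ^ 2) * normD π ν (Q - Ψ.mulVec θ) ^ 2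

/-- The smallest weight `min_{s,a} ν(s) π(a|s)`. -/
def minWeight (π : Policy S A) (ν : S → ℝ) : ℝ := ⨅ x, weight π ν x

end Features

section Constants

open scoped Matrix.Norms.L2Operator

/-- The spectral norm of a real matrix. -/
def specNorm {m n : Type*} [Fintype m] [Fintype n] [DecidableEq n] (M : Matrix m n ℝ) : ℝ := ‖M‖

variable {S A : Type*} [Fintype S] [Fintype A] [DecidableEq S] [DecidableEq A] {d : ℕ}

/-- `C_M = C_P / √(min_{s,a} ν(s) π(a|s)) · ‖Ψ‖₂ ‖I - P‖₂`. -/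
def constM (m : MDP S A) (π : Policy S A) (ν : S → ℝ) (Ψ : Matrix (S × A) (Fin d) ℝ)
    (CP : ℝ) : ℝ :=
  CP / Real.sqrt (minWeight π ν) * specNorm Ψ * specNorm (1 - pairMatrix m π)

/-- `C_max = max {C_P, C_M, C_R}` with `C_R = C_P ‖Ψ‖₂`. -/
def constMax (m : MDP S A) (π : Policy S A) (ν : S → ℝ) (Ψ : Matrix (S × A) (Fin d) ℝ)
    (CP : ℝ) : ℝ :=
  max CP (max (constM m π ν Ψ CP) (CP * specNorm Ψ))

end Constants

section Algorithm

variable {S A : Type*} [Fintype S] [Fintype A] {d : ℕ}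

/-- The stochastic operator `(⟨ψ(s,a) - ψ(s',a'), θ⟩ - c(s,a) + ρ) ψ(s,a)` at
`x = (s,a)`, `y = (s',a')`. -/
def stochOp (m : MDP S A) (Ψ : Matrix (S × A) (Fin d) ℝ) (θ : Fin d → ℝ) (ρ : ℝ)
    (x y : S × A) : Fin d → ℝ :=
  (((Ψ x - Ψ y) ⬝ᵥ θ) - costVec m x + ρ) • Ψ x

/-- The parameters of the method with constant batch sizes: step size `η`, batch sizes `N`, `N'`,
inner iterations `T`, and skipping parameters `τ`, `τ'`. -/
structure Params where
  η : ℝ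
  N : ℕ
  N' : ℕ
  T : ℕ
  τ : ℕ
  τ' : ℕ

/-- `ρ̃`: the average cost over `N'` state-action pairs, each the last one of a fresh block of
`τ' + 1` successive pairs of the trajectory `z`. -/
def rhoTilde (m : MDP S A) (q : Params) (z : ℕ → S × A) : ℝ :=
  (1 / (q.N' : ℝ)) * ∑ i ∈ Finset.range q.N', costVec m (z (i * (q.τ' + 1) + q.τ'))

/-- Number of pairs of the trajectory consumed before the tuples for `ĝ` are collected. -/
def offsetG (q : Params) : ℕ := q.N' * (q.τ' + 1)

/-- `ĝ(θ̃, ρ̃)`: the average of the stochastic operator over `N` tuples `(z_j, z_{j+1})`, each the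
last one of a fresh block of `τ' + 1` successive tuples; such a block consists of the `τ' + 2`
successive pairs following the pairs that have been used before. -/
def gHat (m : MDP S A) (Ψ : Matrix (S × A) (Fin d) ℝ) (q : Params) (z : ℕ → S × A)
    (θ : Fin d → ℝ) : Fin d → ℝ :=
  (1 / (q.N : ℝ)) • ∑ i ∈ Finset.range q.N,
    stochOp m Ψ θ (rhoTilde m q z)
      (z (offsetG q + i * (q.τ' + 2) + q.τ')) (z (offsetG q + i * (q.τ' + 2) + q.τ' + 1))

/-- Number of pairs of the trajectory consumed before the inner iterations start. -/
def offsetT (q : Params) : ℕ := offsetG q + q.N * (q.τ' + 2)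

/-- The inner iterates: `innerIter … t` is `θ_{t+1}`, with `θ_1 = θ̃`. The step from `θ_{t+1}` uses
the last tuple of the `t`-th (from `t = 0`) fresh block of `τ + 1` successive tuples. -/
def innerIter (m : MDP S A) (Ψ : Matrix (S × A) (Fin d) ℝ) (q : Params) (z : ℕ → S × A)
    (θ : Fin d → ℝ) : ℕ → Fin d → ℝ
  | 0 => θ
  | t + 1 =>
    let x := z (offsetT q + t * (q.τ + 2) + q.τ)
    let y := z (offsetT q + t * (q.τ + 2) + q.τ + 1)
    let u := innerIter m Ψ q z θ t
    u - q.η • (stochOp m Ψ u (rhoTilde m q z) x y - stochOp m Ψ θ (rhoTilde m q z) x y +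
      gHat m Ψ q z θ)

/-- The output `T⁻¹ ∑_{t=1}^T θ_t` of one epoch that starts at `θ̃ = θ` and reads the trajectory
`z` from time `0` on. -/
def epoch (m : MDP S A) (Ψ : Matrix (S × A) (Fin d) ℝ) (q : Params) (z : ℕ → S × A)
    (θ : Fin d → ℝ) : Fin d → ℝ :=
  (1 / (q.T : ℝ)) • ∑ t ∈ Finset.range q.T, innerIter m Ψ q z θ t

/-- Number of pairs of the trajectory consumed by one epoch. -/
def epochLength (q : Params) : ℕ := offsetT q + q.T * (q.τ + 2)

/-- The output `θ̂_k` of the variance-reduced temporal difference method after `k` epochs run on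
the single trajectory `z`, from the initial point `θ0`. -/
def vrtd (m : MDP S A) (Ψ : Matrix (S × A) (Fin d) ℝ) (q : Params) (z : ℕ → S × A)
    (θ0 : Fin d → ℝ) : ℕ → Fin d → ℝ
  | 0 => θ0
  | k + 1 => epoch m Ψ q (fun n => z (k * epochLength q + n)) (vrtd m Ψ q z θ0 k)

end Algorithm

section Conditions

variable {S A : Type*} [Fintype S] [Fintype A] [DecidableEq S] [DecidableEq A] {d : ℕ}

/-- The conditions on the step size, the number of inner iterations, the batch sizes and the
skipping parameters. -/
def ParamConditions (m : MDP S A) (π : Policy S A) (ν : S → ℝ) (Ψ : Matrix (S × A) (Fin d) ℝ)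
    (CP ϱ : ℝ) (q : Params) : Prop :=
  0 < q.η ∧ q.η ≤ oneSubBeta m π ν Ψ / 845 ∧
  64 / (minEig π ν Ψ * oneSubBeta m π ν Ψ * q.η) ≤ (q.T : ℝ) ∧
  1160 / (minEig π ν Ψ * oneSubBeta m π ν Ψ ^ 2) ≤ (q.N : ℝ) ∧
  1 / (minEig π ν Ψ * oneSubBeta m π ν Ψ ^ 2) ≤ (q.N' : ℝ) ∧
  ϱ ^ q.τ ≤ Real.sqrt (minEig π ν Ψ) * q.η / constM m π ν Ψ CP ∧
  ϱ ^ q.τ' ≤ min (minWeight π ν / CP) (1 / (4 * constMax m π ν Ψ CP + 1))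

end Conditions

end AverageReward

end

open AverageReward

open MeasureTheory

noncomputable section

namespace AverageReward

/-! Measure every error from θ*, and let A = Ψᵀ D (I - P) Ψ (`meanMat`), for which u·Au ≥ (1 -
β)‖Ψu‖_D². Given the samples, each update is affine in the errors, so the mean errors of the inner
iterates obey a deterministic recursion y ↦ y - η(Ay + bias). The variance reduction terms are
centred, and the only defect is that samples are not exactly stationary. Since T ≥ 64/(μ(1 - β)η),
averaging this recursion shrinks ‖·‖_D² by 1/64 up to the bias (`mean_step_le`, `Mixes.mean_le`).
Sampling variance enters the mean only through the size of the biases, hence always multiplied by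
ϱ^τ or ϱ^(2τ').

The biases are controlled by second moments, which must stay bounded over the epochs. For a given
reference estimate the averaged inner recursion has the fixed point s = -A⁻¹(error of the estimate).
Around s the sampling noise is bounded by the distances of the iterate and of the starting point
from s, so the descent in `Mixes.step_sq_le` holds without additive noise. Thus one epoch contracts
the mean square by 2/5 (`Mixes.avg_sq_le`), up to a multiple of the size of s. That size is the
second moment of an average of N nearly stationary centred terms, at most 6/N times their stationary
second moment (`Mixes.sum_sq_le`); the noise part of the latter is compared with the trace in W₁ by
`IsModel.trace_eq` and `noiseVar_le`.

Mixing is used in two forms. The conditional law of a sample is w + δ with δ of zero sum and ‖δ‖₁ ≤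
C_P ϱ^t; this additive form gives the biases. Once C_P ϱ^t is below the least weight, |δ| ≤ w
pointwise, and second moments at most double. The Poisson equation turns the conditional mean of the
noise into a multiple of (I - P)(Ψθ* - Q̄*), so its bias is measured by ‖Q̄* - Ψθ*‖_D, the other
term of W₁.

The analysis is done for an abstract `TDModel` and a finite weighted family of paths; a trajectory
reduces to this because K epochs read finitely many pairs (`IsTrajectory.mixes`,
`IsModel.integral_vrtd`). -/

/-- The data of linear temporal difference learning on a finite chain, together with the
quantitative properties that the convergence analysis uses. -/
structure TDModel (X : Type*) [Fintype X] (d : ℕ) where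
  w : X → ℝ
  P : X → X → ℝ
  c : X → ℝ
  Ψ : X → Fin d → ℝ
  θs : Fin d → ℝ
  Q : X → ℝ
  cbar : ℝ
  mu : ℝ
  lam : ℝ
  wmin : ℝ
  -- `sI` and `sΨ` stand for ‖I - P‖₂ and ‖Ψ‖₂; the analysis knows them only through `res_le` and
  -- `val_le`.
  sI : ℝ
  sΨ : ℝ
  CP : ℝ
  ϱ : ℝ
  d_pos : 0 < d
  wmin_pos : 0 < wmin
  wmin_le : ∀ x, wmin ≤ w x
  w_sum : ∑ x, w x = 1
  P_nonneg : ∀ x y, 0 ≤ P x y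
  P_sum : ∀ x, ∑ y, P x y = 1
  w_P : ∀ y, ∑ x, w x * P x y = w y
  Ψ_le : ∀ x, Ψ x ⬝ᵥ Ψ x ≤ 1
  mu_pos : 0 < mu
  mu_le : ∀ u, mu * (u ⬝ᵥ u) ≤ ∑ x, w x * (Ψ x ⬝ᵥ u) ^ 2
  lam_pos : 0 < lam
  lam_le : ∀ u, lam * ∑ x, w x * (Ψ x ⬝ᵥ u) ^ 2 ≤
    ∑ x, w x * ((Ψ x ⬝ᵥ u) * (Ψ x ⬝ᵥ u - ∑ y, P x y * (Ψ y ⬝ᵥ u)))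
  c_le : ∀ x, |c x| ≤ cbar
  -- Weak form of the projected Bellman equation: the noise at θ* has zero stationary mean in every
  -- direction.
  bellman : ∀ v, ∑ x, w x * ((Ψ x ⬝ᵥ v) *
    (Ψ x ⬝ᵥ θs - ∑ y, P x y * (Ψ y ⬝ᵥ θs) - c x + ∑ x, w x * c x)) = 0
  poisson : ∀ x, Q x - ∑ y, P x y * Q y = c x - ∑ x, w x * c x
  sI_nonneg : 0 ≤ sI
  res_le : ∀ (f : X → ℝ) x, |f x - ∑ y, P x y * f y| ≤ sI * √(∑ x, f x ^ 2)
  sΨ_nonneg : 0 ≤ sΨ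
  val_le : ∀ u : Fin d → ℝ, √(∑ x, (Ψ x ⬝ᵥ u) ^ 2) ≤ sΨ * √(u ⬝ᵥ u)
  CP_nonneg : 0 ≤ CP
  ϱ_pos : 0 < ϱ
  ϱ_lt : ϱ < 1

/-! ### Weighted norms, stationary expectations and the mean matrix. -/

namespace TDModel

variable {X : Type*} [Fintype X] {d : ℕ} (M : TDModel X d)

/-- The value function `Ψ u`. -/
def val (u : Fin d → ℝ) (x : X) : ℝ := M.Ψ x ⬝ᵥ u

/-- The squared norm `‖f‖_D²`. -/
def nD (f : X → ℝ) : ℝ := ∑ x, M.w x * f x ^ 2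

/-- `(I - P) f`. -/
def res (f : X → ℝ) (x : X) : ℝ := f x - ∑ y, M.P x y * f y

/-- The stationary average cost. -/
def rho : ℝ := ∑ x, M.w x * M.c x

/-- The stationary expectation of a function of a tuple of successive pairs. -/
def st (h : X → X → ℝ) : ℝ := ∑ x, M.w x * ∑ y, M.P x y * h x y

/-- The mean matrix `Ψᵀ D (I - P) Ψ`. -/
def meanMat : Matrix (Fin d) (Fin d) ℝ :=
  fun i j => ∑ x, M.w x * (M.Ψ x i * M.res (fun y => M.Ψ y j) x)

/-- The constant `‖Ψ‖ ‖I - P‖ / √wmin`. -/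
def K0 : ℝ := M.sI * M.sΨ / √M.wmin

lemma w_pos (x : X) : 0 < M.w x := M.wmin_pos.trans_le (M.wmin_le x)

lemma w_nonneg (x : X) : 0 ≤ M.w x := (M.w_pos x).le

lemma nD_nonneg (f : X → ℝ) : 0 ≤ M.nD f :=
  Finset.sum_nonneg fun x _ => mul_nonneg (M.w_nonneg x) (sq_nonneg _)

lemma K0_nonneg : 0 ≤ M.K0 :=
  div_nonneg (mul_nonneg M.sI_nonneg M.sΨ_nonneg) (Real.sqrt_nonneg _)

lemma dot_self_nonneg (u : Fin d → ℝ) : 0 ≤ u ⬝ᵥ u :=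
  Finset.sum_nonneg fun _ _ => mul_self_nonneg _

lemma dot_sq_le (u v : Fin d → ℝ) : (u ⬝ᵥ v) ^ 2 ≤ (u ⬝ᵥ u) * (v ⬝ᵥ v) := by
  have h := Finset.sum_mul_sq_le_sq_mul_sq Finset.univ u v
  simpa only [dotProduct, sq] using h

lemma abs_dot_le (u v : Fin d → ℝ) : |u ⬝ᵥ v| ≤ √(u ⬝ᵥ u) * √(v ⬝ᵥ v) := by
  rw [← Real.sqrt_mul (dot_self_nonneg u)]
  exact Real.abs_le_sqrt (dot_sq_le u v)

lemma val_add (u v : Fin d → ℝ) : M.val (u + v) = M.val u + M.val v := by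
  ext x; simp [val, dotProduct_add]

lemma val_sub (u v : Fin d → ℝ) : M.val (u - v) = M.val u - M.val v := by
  ext x; simp [val, dotProduct_sub]

lemma val_smul (r : ℝ) (u : Fin d → ℝ) : M.val (r • u) = r • M.val u := by
  ext x; simp [val, dotProduct_smul]

lemma res_eq (f : X → ℝ) (x : X) : M.res f x = ∑ y, M.P x y * (f x - f y) := by
  simp only [mul_sub, Finset.sum_sub_distrib, ← Finset.sum_mul, M.P_sum, one_mul, res]

lemma nD_add_le (f g : X → ℝ) : M.nD (f + g) ≤ 2 * M.nD f + 2 * M.nD g := by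
  simp only [nD, Finset.mul_sum, ← Finset.sum_add_distrib]
  refine Finset.sum_le_sum fun x _ => ?_
  have := mul_nonneg (M.w_nonneg x) (sq_nonneg (f x - g x))
  simp only [Pi.add_apply]; nlinarith

lemma nD_neg (f : X → ℝ) : M.nD (-f) = M.nD f := by simp [nD]

lemma nD_sub_le (f g : X → ℝ) : M.nD (f - g) ≤ 2 * M.nD f + 2 * M.nD g := by
  have := M.nD_add_le f (-g)
  rwa [nD_neg, ← sub_eq_add_neg] at this

lemma nD_smul (r : ℝ) (f : X → ℝ) : M.nD (r • f) = r ^ 2 * M.nD f := by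
  simp only [nD, Finset.mul_sum, Pi.smul_apply, smul_eq_mul]
  exact Finset.sum_congr rfl fun y _ => by ring

lemma mu_le' (u : Fin d → ℝ) : M.mu * (u ⬝ᵥ u) ≤ M.nD (M.val u) := M.mu_le u

lemma nD_val_le (u : Fin d → ℝ) : M.nD (M.val u) ≤ u ⬝ᵥ u := by
  have h : M.nD (M.val u) ≤ ∑ x, M.w x * (u ⬝ᵥ u) := by
    refine Finset.sum_le_sum fun x _ => mul_le_mul_of_nonneg_left ?_ (M.w_nonneg x)
    refine (dot_sq_le _ _).trans ?_
    have := M.Ψ_le x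
    nlinarith [dot_self_nonneg u]
  rwa [← Finset.sum_mul, M.w_sum, one_mul] at h

lemma sqrt_mu_mul_le (u : Fin d → ℝ) : √M.mu * √(u ⬝ᵥ u) ≤ √(M.nD (M.val u)) := by
  rw [← Real.sqrt_mul M.mu_pos.le]
  exact Real.sqrt_le_sqrt (M.mu_le u)

/-! ### Stationary expectations -/

lemma st_add (h k : X → X → ℝ) : M.st (fun x y => h x y + k x y) = M.st h + M.st k := by
  simp only [st, mul_add, Finset.sum_add_distrib]

lemma st_sub (h k : X → X → ℝ) : M.st (fun x y => h x y - k x y) = M.st h - M.st k := by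
  simp only [st, mul_sub, Finset.sum_sub_distrib]

lemma st_mul (r : ℝ) (h : X → X → ℝ) : M.st (fun x y => r * h x y) = r * M.st h := by
  simp only [st, Finset.mul_sum]
  exact Finset.sum_congr rfl fun x _ => Finset.sum_congr rfl fun y _ => by ring

lemma st_const (r : ℝ) : M.st (fun _ _ => r) = r := by
  simp only [st, ← Finset.sum_mul, M.P_sum, one_mul, M.w_sum]

lemma st_left (f : X → ℝ) : M.st (fun x _ => f x) = ∑ x, M.w x * f x := by
  simp only [st, ← Finset.sum_mul, M.P_sum, one_mul]

lemma st_right (f : X → ℝ) : M.st (fun _ y => f y) = ∑ x, M.w x * f x := by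
  simp only [st, Finset.mul_sum]
  rw [Finset.sum_comm]
  refine Finset.sum_congr rfl fun y _ => ?_
  rw [← M.w_P y, Finset.sum_mul]
  exact Finset.sum_congr rfl fun y _ => by ring

lemma st_mono {h k : X → X → ℝ} (hk : ∀ x y, h x y ≤ k x y) : M.st h ≤ M.st k :=
  Finset.sum_le_sum fun x _ => mul_le_mul_of_nonneg_left
    (Finset.sum_le_sum fun y _ => mul_le_mul_of_nonneg_left (hk x y) (M.P_nonneg x y))
    (M.w_nonneg x)

lemma st_nonneg {h : X → X → ℝ} (hk : ∀ x y, 0 ≤ h x y) : 0 ≤ M.st h :=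
  Finset.sum_nonneg fun x _ => mul_nonneg (M.w_nonneg x)
    (Finset.sum_nonneg fun y _ => mul_nonneg (M.P_nonneg x y) (hk x y))

lemma st_sum {ι : Type*} (s : Finset ι) (h : ι → X → X → ℝ) :
    M.st (fun x y => ∑ i ∈ s, h i x y) = ∑ i ∈ s, M.st (h i) := by
  simp only [st, Finset.mul_sum]
  exact (Finset.sum_congr rfl fun x _ => Finset.sum_comm).trans Finset.sum_comm

lemma st_diff_sq_le (f : X → ℝ) : M.st (fun x y => (f x - f y) ^ 2) ≤ 4 * M.nD f := by
  have h : M.st (fun x y => (f x - f y) ^ 2) ≤ M.st (fun x y => 2 * f x ^ 2 + 2 * f y ^ 2) :=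
    M.st_mono fun x y => by nlinarith [sq_nonneg (f x + f y)]
  rw [M.st_add, M.st_mul, M.st_mul, M.st_left (fun x => f x ^ 2),
    M.st_right (fun x => f x ^ 2)] at h
  unfold nD; linarith

/-- (I - P)f at x is the P(x,·)-mean of f x - f y, so Cauchy–Schwarz reduces the bound to
`st_diff_sq_le`, where stationarity of w gives the 4. -/
lemma nD_res_le (f : X → ℝ) : M.nD (M.res f) ≤ 4 * M.nD f := by
  refine le_trans ?_ (M.st_diff_sq_le f)
  refine Finset.sum_le_sum fun x _ => mul_le_mul_of_nonneg_left ?_ (M.w_nonneg x)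
  rw [res_eq]
  have h := Finset.sum_mul_sq_le_sq_mul_sq Finset.univ (fun y => √(M.P x y))
    (fun y => √(M.P x y) * (f x - f y))
  have e1 : ∀ y, √(M.P x y) * (√(M.P x y) * (f x - f y)) = M.P x y * (f x - f y) := fun y => by
    rw [← mul_assoc, Real.mul_self_sqrt (M.P_nonneg x y)]
  have e2 : ∀ y, (√(M.P x y) * (f x - f y)) ^ 2 = M.P x y * (f x - f y) ^ 2 := fun y => by
    rw [mul_pow, Real.sq_sqrt (M.P_nonneg x y)]
  simpa only [e1, e2, Real.sq_sqrt (M.P_nonneg x _), M.P_sum, one_mul] using h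

/-! ### The mean matrix -/

lemma res_val (u : Fin d → ℝ) (x : X) :
    M.res (M.val u) x = ∑ j, M.res (fun y => M.Ψ y j) x * u j := by
  simp only [res, val, dotProduct, sub_mul, Finset.sum_sub_distrib, Finset.mul_sum,
    Finset.sum_mul]
  congr 1
  rw [Finset.sum_comm]
  exact Finset.sum_congr rfl fun j _ => Finset.sum_congr rfl fun y _ => by ring

lemma dot_meanMat (v u : Fin d → ℝ) :
    v ⬝ᵥ M.meanMat.mulVec u = ∑ x, M.w x * (M.val v x * M.res (M.val u) x) := by
  simp only [res_val, Matrix.mulVec, meanMat, val, dotProduct, Finset.mul_sum, Finset.sum_mul]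
  rw [Finset.sum_congr rfl fun i _ => Finset.sum_comm, Finset.sum_comm]
  refine Finset.sum_congr rfl fun x _ => ?_
  rw [Finset.sum_comm]
  exact Finset.sum_congr rfl fun j _ => Finset.sum_congr rfl fun i _ => by ring

lemma st_val_mul (v u : Fin d → ℝ) :
    M.st (fun x y => M.val v x * (M.val u x - M.val u y)) = v ⬝ᵥ M.meanMat.mulVec u := by
  rw [dot_meanMat]
  simp only [st, res_eq, Finset.mul_sum]
  exact Finset.sum_congr rfl fun j _ => Finset.sum_congr rfl fun i _ => by ring

lemma lam_le' (u : Fin d → ℝ) : M.lam * M.nD (M.val u) ≤ u ⬝ᵥ M.meanMat.mulVec u := by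
  rw [dot_meanMat]; exact M.lam_le u

/-- Self-bounding: for v = Au, |v|² is the D-product of Ψv and (I - P)Ψu, and half of |v|² is
absorbed because ‖Ψv‖_D ≤ |v|. -/
lemma mean_sq_le (u : Fin d → ℝ) :
    M.meanMat.mulVec u ⬝ᵥ M.meanMat.mulVec u ≤ 4 * M.nD (M.val u) := by
  set v := M.meanMat.mulVec u with hv
  have h1 : v ⬝ᵥ v ≤ 1 / 2 * M.nD (M.val v) + 1 / 2 * M.nD (M.res (M.val u)) := by
    conv_lhs => rw [hv, ← hv, dot_meanMat]
    simp only [nD, Finset.mul_sum, ← Finset.sum_add_distrib]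
    refine Finset.sum_le_sum fun x _ => ?_
    nlinarith [mul_nonneg (M.w_nonneg x) (sq_nonneg (M.val v x - M.res (M.val u) x))]
  linarith [M.nD_val_le v, M.nD_res_le (M.val u)]

lemma lam_le_two : M.lam ≤ 2 := by
  let u : Fin d → ℝ := fun _ => 1
  have hu : 0 < u ⬝ᵥ u := by
    simp [u, dotProduct, M.d_pos]
  have hn : 0 < M.nD (M.val u) := (mul_pos M.mu_pos hu).trans_le (M.mu_le u)
  have h1 : u ⬝ᵥ M.meanMat.mulVec u ≤ M.nD (M.val u) + 1 / 4 * M.nD (M.res (M.val u)) := by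
    rw [dot_meanMat]
    simp only [nD, Finset.mul_sum, ← Finset.sum_add_distrib]
    refine Finset.sum_le_sum fun x _ => ?_
    nlinarith [mul_nonneg (M.w_nonneg x) (sq_nonneg (M.val u x - 1 / 2 * M.res (M.val u) x))]
  have h2 := M.lam_le' u
  have h3 := M.nD_res_le (M.val u)
  nlinarith

lemma mu_le_one : M.mu ≤ 1 := by
  let u : Fin d → ℝ := fun _ => 1
  have hu : 0 < u ⬝ᵥ u := by
    simp [u, dotProduct, M.d_pos]
  have := (M.mu_le' u).trans (M.nD_val_le u)
  nlinarith

lemma isUnit_meanMat : IsUnit M.meanMat := by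
  rw [← Matrix.mulVec_injective_iff_isUnit]
  intro u v huv
  have h0 : M.meanMat.mulVec (u - v) = 0 := by
    rw [Matrix.mulVec_sub]; exact sub_eq_zero.mpr huv
  have h1 := M.lam_le' (u - v)
  rw [h0, dotProduct_zero] at h1
  have h2 := M.mu_le' (u - v)
  have h3 := M.nD_nonneg (M.val (u - v))
  have h4 : M.nD (M.val (u - v)) ≤ 0 := by
    by_contra h; push Not at h
    nlinarith [mul_pos M.lam_pos h]
  have h5 : (u - v) ⬝ᵥ (u - v) = 0 :=
    le_antisymm (by by_contra h; push Not at h; nlinarith [mul_pos M.mu_pos h])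
      (dot_self_nonneg _)
  exact sub_eq_zero.mp (dotProduct_self_eq_zero.mp h5)

/-- The solution `u` of `Ψᵀ D (I - P) Ψ u = e`. -/
def solve (e : Fin d → ℝ) : Fin d → ℝ := M.meanMat⁻¹.mulVec e

lemma mean_solve (e : Fin d → ℝ) : M.meanMat.mulVec (M.solve e) = e := by
  have h := (Matrix.isUnit_iff_isUnit_det _).mp M.isUnit_meanMat
  rw [solve, Matrix.mulVec_mulVec, Matrix.mul_nonsing_inv _ h, Matrix.one_mulVec]

lemma solve_add (e f : Fin d → ℝ) : M.solve (e + f) = M.solve e + M.solve f :=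
  Matrix.mulVec_add _ _ _

lemma solve_smul (r : ℝ) (f : Fin d → ℝ) : M.solve (r • f) = r • M.solve f :=
  Matrix.mulVec_smul _ _ _

/-- Coercivity gives λ‖Ψu‖_D² ≤ u·e ≤ |u||e|, and `mu_le` trades |u| for ‖Ψu‖_D/√μ; squaring gives
the factor 1/(μλ²). -/
lemma nD_solve_le (e : Fin d → ℝ) :
    M.nD (M.val (M.solve e)) ≤ (e ⬝ᵥ e) / (M.mu * M.lam ^ 2) := by
  set u := M.solve e with hu
  have h1 := M.lam_le' u
  rw [hu, mean_solve, ← hu] at h1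
  have h2 := dot_sq_le u e
  have h3 := M.mu_le' u
  have h4 := M.nD_nonneg (M.val u)
  rw [le_div_iff₀ (mul_pos M.mu_pos (pow_pos M.lam_pos 2))]
  rcases h4.eq_or_lt with h | h
  · rw [← h, zero_mul]; exact dot_self_nonneg e
  · have h5 : (M.lam * M.nD (M.val u)) ^ 2 ≤ (u ⬝ᵥ u) * (e ⬝ᵥ e) :=
      (pow_le_pow_left₀ (mul_nonneg M.lam_pos.le h4) h1 2).trans h2
    have h6 : M.mu * (M.lam * M.nD (M.val u)) ^ 2 ≤ M.nD (M.val u) * (e ⬝ᵥ e) := by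
      calc _ ≤ M.mu * ((u ⬝ᵥ u) * (e ⬝ᵥ e)) := mul_le_mul_of_nonneg_left h5 M.mu_pos.le
        _ = M.mu * (u ⬝ᵥ u) * (e ⬝ᵥ e) := by ring
        _ ≤ _ := mul_le_mul_of_nonneg_right h3 (dot_self_nonneg e)
    refine le_of_mul_le_mul_left ?_ h
    nlinarith

end TDModel

namespace TDModel

variable {X : Type*} [Fintype X] {d : ℕ} (M : TDModel X d)

/-! ### Bounds for perturbations of the stationary distribution -/

lemma sqrt_sum_sq_le (f : X → ℝ) : √(∑ x, f x ^ 2) ≤ √(M.nD f) / √M.wmin := by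
  rw [le_div_iff₀ (Real.sqrt_pos.mpr M.wmin_pos), ← Real.sqrt_mul
    (Finset.sum_nonneg fun _ _ => sq_nonneg _)]
  refine Real.sqrt_le_sqrt ?_
  rw [Finset.sum_mul]
  refine Finset.sum_le_sum fun x _ => ?_
  rw [mul_comm]
  exact mul_le_mul_of_nonneg_right (M.wmin_le x) (sq_nonneg _)

lemma abs_le_sqrt_sum_sq (f : X → ℝ) (x : X) : |f x| ≤ √(∑ x, f x ^ 2) :=
  Real.abs_le_sqrt (Finset.single_le_sum (f := fun x => f x ^ 2)
    (fun _ _ => sq_nonneg _) (Finset.mem_univ x))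

lemma abs_val_le (v : Fin d → ℝ) (x : X) : |M.val v x| ≤ √(v ⬝ᵥ v) := by
  refine Real.abs_le_sqrt ((dot_sq_le _ _).trans ?_)
  nlinarith [M.Ψ_le x, dot_self_nonneg v]

/-- One factor is paid for in the D-norm, at the price 1/√wmin, the other in the Euclidean norm.
With C_P the resulting constant `K0` becomes C_M. -/
lemma abs_val_res_val_le (v u : Fin d → ℝ) (x : X) :
    |M.val v x * M.res (M.val u) x| ≤ M.K0 * √(M.nD (M.val v)) * √(u ⬝ᵥ u) := by
  rw [abs_mul]
  have h1 := (abs_le_sqrt_sum_sq (M.val v) x).trans (M.sqrt_sum_sq_le _)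
  have h2 : |M.res (M.val u) x| ≤ M.sI * (M.sΨ * √(u ⬝ᵥ u)) :=
    (M.res_le _ x).trans (mul_le_mul_of_nonneg_left (M.val_le u) M.sI_nonneg)
  calc _ ≤ √(M.nD (M.val v)) / √M.wmin * (M.sI * (M.sΨ * √(u ⬝ᵥ u))) :=
        mul_le_mul h1 h2 (abs_nonneg _) (by positivity)
    _ = _ := by unfold K0; ring

/-- Here g need not lie in the span of the features, so the 1/√wmin falls on g and the Euclidean
norm on v. -/
lemma abs_val_res_le (v : Fin d → ℝ) (g : X → ℝ) (x : X) :
    |M.val v x * M.res g x| ≤ M.K0 * √(v ⬝ᵥ v) * √(M.nD g) := by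
  rw [abs_mul]
  have h1 : |M.val v x| ≤ M.sΨ * √(v ⬝ᵥ v) :=
    (abs_le_sqrt_sum_sq (M.val v) x).trans (M.val_le v)
  have h2 : |M.res g x| ≤ M.sI * (√(M.nD g) / √M.wmin) :=
    (M.res_le _ x).trans (mul_le_mul_of_nonneg_left (M.sqrt_sum_sq_le _) M.sI_nonneg)
  calc _ ≤ M.sΨ * √(v ⬝ᵥ v) * (M.sI * (√(M.nD g) / √M.wmin)) :=
        mul_le_mul h1 h2 (abs_nonneg _) (mul_nonneg M.sΨ_nonneg (Real.sqrt_nonneg _))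
    _ = _ := by unfold K0; ring

/-- The conditional second moment of f x - f y equals 2 f (I - P)f - (I - P)f². Each (I - P) yields
a factor `sI`, whence 3 = 2 + 1. -/
lemma abs_var_val_le (u : Fin d → ℝ) (x : X) :
    |∑ y, M.P x y * (M.val u x - M.val u y) ^ 2| ≤
      3 * (M.K0 * √(M.nD (M.val u)) * √(u ⬝ᵥ u)) := by
  set f := M.val u with hf
  have e : ∑ y, M.P x y * (f x - f y) ^ 2 =
      2 * (f x * M.res f x) - M.res (fun x => f x ^ 2) x := by
    rw [res_eq, res_eq, Finset.mul_sum, Finset.mul_sum, ← Finset.sum_sub_distrib]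
    exact Finset.sum_congr rfl fun y _ => by ring
  have h1 := M.abs_val_res_val_le u u x
  rw [← hf] at h1
  have h2 : |M.res (fun x => f x ^ 2) x| ≤ M.K0 * √(M.nD f) * √(u ⬝ᵥ u) := by
    refine (M.res_le (fun x => f x ^ 2) x).trans ?_
    have h3 : √(∑ x, (f x ^ 2) ^ 2) ≤ √(M.nD f) / √M.wmin * (M.sΨ * √(u ⬝ᵥ u)) := by
      have h4 : √(∑ x, (f x ^ 2) ^ 2) ≤ √(∑ x, f x ^ 2) * √(∑ x, f x ^ 2) := by
        rw [Real.mul_self_sqrt (Finset.sum_nonneg fun x _ => sq_nonneg _)]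
        refine Real.sqrt_le_iff.mpr ⟨Finset.sum_nonneg fun x _ => sq_nonneg _, ?_⟩
        rw [sq (∑ x, f x ^ 2), Finset.sum_mul]
        refine Finset.sum_le_sum fun x _ => ?_
        rw [sq (f x ^ 2)]
        exact mul_le_mul_of_nonneg_left (Finset.single_le_sum (f := fun x => f x ^ 2)
          (fun x _ => sq_nonneg _) (Finset.mem_univ x)) (sq_nonneg _)
      exact h4.trans (mul_le_mul (M.sqrt_sum_sq_le f) (M.val_le u) (Real.sqrt_nonneg _)
        (by positivity))
    calc _ ≤ M.sI * (√(M.nD f) / √M.wmin * (M.sΨ * √(u ⬝ᵥ u))) :=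
          mul_le_mul_of_nonneg_left h3 M.sI_nonneg
      _ = _ := by unfold K0; ring
  rw [e, abs_le]
  rw [abs_le] at h1 h2
  constructor <;> linarith [h1.1, h1.2, h2.1, h2.2]

lemma abs_sum_mul_le {δ g : X → ℝ} {ε B : ℝ} (hδ : ∑ x, |δ x| ≤ ε) (hg : ∀ x, |g x| ≤ B)
    (hB : 0 ≤ B) : |∑ x, δ x * g x| ≤ ε * B := by
  refine (Finset.abs_sum_le_sum_abs _ _).trans ?_
  refine le_trans ?_ (mul_le_mul_of_nonneg_right hδ hB)
  rw [Finset.sum_mul]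
  refine Finset.sum_le_sum fun x _ => ?_
  rw [abs_mul]
  exact mul_le_mul_of_nonneg_left (hg x) (abs_nonneg _)

end TDModel

/-! ### Finite expectations -/

section Expectation

variable {I X : Type*} [Fintype I] (p : I → ℝ) (z : I → ℕ → X)

/-- The expectation of a function of the path under the weights `p` of the paths `z`. -/
def Ex (f : (ℕ → X) → ℝ) : ℝ := ∑ i, p i * f (z i)

variable {p z}

lemma Ex_add (f g : (ℕ → X) → ℝ) : Ex p z (fun ζ => f ζ + g ζ) = Ex p z f + Ex p z g := by
  simp only [Ex, mul_add, Finset.sum_add_distrib]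

lemma Ex_sub (f g : (ℕ → X) → ℝ) : Ex p z (fun ζ => f ζ - g ζ) = Ex p z f - Ex p z g := by
  simp only [Ex, mul_sub, Finset.sum_sub_distrib]

lemma Ex_mul (r : ℝ) (f : (ℕ → X) → ℝ) : Ex p z (fun ζ => r * f ζ) = r * Ex p z f := by
  simp only [Ex, Finset.mul_sum]
  exact Finset.sum_congr rfl fun i _ => by ring

lemma Ex_neg (f : (ℕ → X) → ℝ) : Ex p z (fun ζ => -f ζ) = -Ex p z f := by
  simp only [Ex, mul_neg, Finset.sum_neg_distrib]

lemma Ex_sum {ι : Type*} (s : Finset ι) (f : ι → (ℕ → X) → ℝ) :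
    Ex p z (fun ζ => ∑ i ∈ s, f i ζ) = ∑ i ∈ s, Ex p z (f i) := by
  simp only [Ex, Finset.mul_sum]
  exact Finset.sum_comm

lemma Ex_const (hp : ∑ i, p i = 1) (r : ℝ) : Ex p z (fun _ => r) = r := by
  simp only [Ex, ← Finset.sum_mul, hp, one_mul]

lemma Ex_mono (hp : ∀ i, 0 ≤ p i) {f g : (ℕ → X) → ℝ} (h : ∀ ζ, f ζ ≤ g ζ) :
    Ex p z f ≤ Ex p z g :=
  Finset.sum_le_sum fun i _ => mul_le_mul_of_nonneg_left (h _) (hp i)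

lemma Ex_nonneg (hp : ∀ i, 0 ≤ p i) {f : (ℕ → X) → ℝ} (h : ∀ ζ, 0 ≤ f ζ) : 0 ≤ Ex p z f :=
  Finset.sum_nonneg fun i _ => mul_nonneg (hp i) (h _)

lemma Ex_sq_le (hp : ∀ i, 0 ≤ p i) (hp1 : ∑ i, p i = 1) (f : (ℕ → X) → ℝ) :
    Ex p z f ^ 2 ≤ Ex p z (fun ζ => f ζ ^ 2) := by
  have h : 0 ≤ Ex p z (fun ζ => (f ζ - Ex p z f) ^ 2) := Ex_nonneg hp fun ζ => sq_nonneg _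
  have e : (fun ζ => (f ζ - Ex p z f) ^ 2) =
      fun ζ => f ζ ^ 2 - (2 * Ex p z f) * f ζ + Ex p z f ^ 2 := by ext ζ; ring
  rw [e, Ex_add, Ex_sub, Ex_mul, Ex_const hp1] at h
  nlinarith

lemma Ex_sqrt_le (hp : ∀ i, 0 ≤ p i) (hp1 : ∑ i, p i = 1) {f : (ℕ → X) → ℝ}
    (hf : ∀ ζ, 0 ≤ f ζ) : Ex p z (fun ζ => √(f ζ)) ≤ √(Ex p z f) := by
  refine Real.le_sqrt_of_sq_le ((Ex_sq_le hp hp1 _).trans ?_)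
  exact Ex_mono hp fun ζ => (Real.sq_sqrt (hf ζ)).le

variable (p z) {d : ℕ}

/-- The expectation of a random vector. -/
def ExV (f : (ℕ → X) → Fin d → ℝ) : Fin d → ℝ := fun k => Ex p z fun ζ => f ζ k

variable {p z}

lemma dot_ExV (v : Fin d → ℝ) (f : (ℕ → X) → Fin d → ℝ) :
    v ⬝ᵥ ExV p z f = Ex p z fun ζ => v ⬝ᵥ f ζ := by
  simp only [dotProduct, ExV, Ex_sum, Ex_mul]

lemma ExV_add (f g : (ℕ → X) → Fin d → ℝ) :
    ExV p z (fun ζ => f ζ + g ζ) = ExV p z f + ExV p z g := by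
  ext k; simp only [ExV, Pi.add_apply, Ex_add]

lemma ExV_sub (f g : (ℕ → X) → Fin d → ℝ) :
    ExV p z (fun ζ => f ζ - g ζ) = ExV p z f - ExV p z g := by
  ext k; simp only [ExV, Pi.sub_apply, Ex_sub]

lemma ExV_smul (r : ℝ) (f : (ℕ → X) → Fin d → ℝ) :
    ExV p z (fun ζ => r • f ζ) = r • ExV p z f := by
  ext k; simp only [ExV, Pi.smul_apply, smul_eq_mul, Ex_mul]

lemma ExV_sum {ι : Type*} (s : Finset ι) (f : ι → (ℕ → X) → Fin d → ℝ) :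
    ExV p z (fun ζ => ∑ i ∈ s, f i ζ) = ∑ i ∈ s, ExV p z (f i) := by
  ext k; simp only [ExV, Finset.sum_apply, Ex_sum]

end Expectation

/-! ### Mixing trajectories -/

section Mixing

variable {I X : Type*} [Fintype I] [Fintype X] {d : ℕ}

/-- Under the weights `p`, the paths `z` up to time `L` form a random trajectory whose tuple of
successive pairs at time `j` has, conditionally on the path before time `m`, a distribution that
is within `CP * ϱ ^ (j - m)` of the stationary one. -/
structure TDModel.Mixes (M : TDModel X d) (p : I → ℝ) (z : I → ℕ → X) (L : ℕ) : Prop where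
  nonneg : ∀ i, 0 ≤ p i
  sum_eq : ∑ i, p i = 1
  -- `q` is the conditional law of the pair at time j given the path before m. The move from x to y
  -- is exactly P, so all deviation from stationarity lies in x.
  law : ∀ m j, m ≤ j → j + 1 < L → ∃ q : (ℕ → X) → X → ℝ, (∀ ζ, ∑ x, q ζ x = 1) ∧
    (∀ ζ, ∑ x, |q ζ x - M.w x| ≤ M.CP * M.ϱ ^ (j - m)) ∧
    ∀ H : (ℕ → X) → X → X → ℝ, (∀ x y, DependsOn (fun ζ => H ζ x y) (Set.Iio m)) →
      Ex p z (fun ζ => H ζ (ζ j) (ζ (j + 1))) =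
        Ex p z (fun ζ => ∑ x, q ζ x * ∑ y, M.P x y * H ζ x y)

namespace TDModel

variable {M : TDModel X d} {p : I → ℝ} {z : I → ℕ → X} {L : ℕ}

/-- The conditional law is w + δ: w gives the stationary expectation, and only the δ-part needs a
bound. That δ has zero sum lets summands of H that do not depend on the tuple drop out. -/
lemma Mixes.le (hM : M.Mixes p z L) {m j : ℕ} (hmj : m ≤ j) (hj : j + 1 < L)
    {H : (ℕ → X) → X → X → ℝ} (hH : ∀ x y, DependsOn (fun ζ => H ζ x y) (Set.Iio m))
    {G : (ℕ → X) → ℝ}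
    (hG : ∀ ζ, ∀ δ : X → ℝ, ∑ x, δ x = 0 → ∑ x, |δ x| ≤ M.CP * M.ϱ ^ (j - m) →
      ∑ x, δ x * ∑ y, M.P x y * H ζ x y ≤ G ζ) :
    Ex p z (fun ζ => H ζ (ζ j) (ζ (j + 1))) ≤ Ex p z (fun ζ => M.st (H ζ)) + Ex p z G := by
  obtain ⟨q, hq1, hq, hE⟩ := hM.law m j hmj hj
  rw [hE H hH, ← Ex_add]
  refine Ex_mono hM.nonneg fun ζ => ?_
  have h := hG ζ (fun x => q ζ x - M.w x) (by rw [Finset.sum_sub_distrib, hq1, M.w_sum, sub_self])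
    (hq ζ)
  simp only [sub_mul, Finset.sum_sub_distrib] at h
  unfold st
  linarith

lemma Mixes.abs_le (hM : M.Mixes p z L) {m j : ℕ} (hmj : m ≤ j) (hj : j + 1 < L)
    {H : (ℕ → X) → X → X → ℝ} (hH : ∀ x y, DependsOn (fun ζ => H ζ x y) (Set.Iio m))
    {G : (ℕ → X) → ℝ}
    (hG : ∀ ζ, ∀ δ : X → ℝ, ∑ x, δ x = 0 → ∑ x, |δ x| ≤ M.CP * M.ϱ ^ (j - m) →
      |∑ x, δ x * ∑ y, M.P x y * H ζ x y| ≤ G ζ) :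
    |Ex p z (fun ζ => H ζ (ζ j) (ζ (j + 1))) - Ex p z (fun ζ => M.st (H ζ))| ≤ Ex p z G := by
  have h1 := hM.le hmj hj hH (G := G) fun ζ δ h0 hδ => (le_abs_self _).trans (hG ζ δ h0 hδ)
  have h2 := hM.le hmj hj (H := fun ζ x y => -H ζ x y)
    (fun x y ζ ζ' h => congrArg Neg.neg (hH x y h)) (G := G) fun ζ δ h0 hδ => by
      simp only [mul_neg, Finset.sum_neg_distrib]
      exact (neg_le_abs _).trans (hG ζ δ h0 hδ)
  have e : ∀ ζ, M.st (fun x y => -H ζ x y) = -M.st (H ζ) := fun ζ => by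
    simp only [st, mul_neg, Finset.sum_neg_distrib]
  simp only [e, Ex_neg] at h2
  rw [_root_.abs_le]; constructor <;> linarith

/-- A weighted bound on the perturbation dominates a sum against it. -/
lemma sum_mul_le_st {δ : X → ℝ} {r : ℝ} (hδ : ∀ x, |δ x| ≤ r * M.w x) {h k : X → X → ℝ}
    (hk : ∀ x y, |h x y| ≤ k x y) : |∑ x, δ x * ∑ y, M.P x y * h x y| ≤ r * M.st k := by
  refine (Finset.abs_sum_le_sum_abs _ _).trans ?_
  rw [st, Finset.mul_sum]
  refine Finset.sum_le_sum fun x _ => ?_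
  rw [abs_mul, ← mul_assoc]
  refine mul_le_mul (hδ x) ?_ (abs_nonneg _) ((abs_nonneg _).trans (hδ x))
  refine (Finset.abs_sum_le_sum_abs _ _).trans (Finset.sum_le_sum fun y _ => ?_)
  rw [abs_mul, abs_of_nonneg (M.P_nonneg x y)]
  exact mul_le_mul_of_nonneg_left (hk x y) (M.P_nonneg x y)

/-- Additive mixing becomes multiplicative: t steps bring the ℓ¹ distance below the least weight,
and the other s steps remain as a factor. -/
lemma abs_le_mul_w {δ : X → ℝ} {t s : ℕ} (hδ : ∑ x, |δ x| ≤ M.CP * M.ϱ ^ (t + s))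
    (ht : M.CP * M.ϱ ^ t ≤ M.wmin) (x : X) : |δ x| ≤ M.ϱ ^ s * M.w x := by
  have h1 : |δ x| ≤ ∑ x, |δ x| :=
    Finset.single_le_sum (f := fun x => |δ x|) (fun x _ => abs_nonneg _) (Finset.mem_univ x)
  refine (h1.trans hδ).trans ?_
  rw [pow_add, ← mul_assoc, mul_comm]
  exact mul_le_mul_of_nonneg_left (ht.trans (M.wmin_le x)) (pow_nonneg M.ϱ_pos.le _)

lemma geom_sum_le {r : ℝ} (h0 : 0 ≤ r) (h1 : r ≤ 1 / 4) (n : ℕ) :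
    ∑ i ∈ Finset.range n, r ^ i ≤ 4 / 3 := by
  have h := geom_sum_eq (show r ≠ 1 by linarith) n
  rw [h, div_le_iff_of_neg (by linarith)]
  have := pow_nonneg h0 n
  nlinarith

/-- The second moment of a sum of `N` functions of tuples that are collected every `b` steps, for
a function of the tuple with vanishing stationary mean that depends on the path before time `m`. -/
lemma Mixes.sum_sq_le (hM : M.Mixes p z L) {m t b N : ℕ} (hb : M.ϱ ^ b ≤ 1 / 4)
    (hL : m + N * b + t + 1 < L) (ht : M.CP * M.ϱ ^ t ≤ M.wmin)
    {f : (ℕ → X) → X → X → ℝ} (hf : ∀ x y, DependsOn (fun ζ => f ζ x y) (Set.Iio m))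
    (hdep : ∀ i, DependsOn (fun ζ : ℕ → X => f ζ (ζ (m + i * b + t)) (ζ (m + i * b + t + 1)))
      (Set.Iio (m + (i + 1) * b)))
    (h0 : ∀ ζ, M.st (f ζ) = 0) :
    Ex p z (fun ζ => (∑ i ∈ Finset.range N,
      f ζ (ζ (m + i * b + t)) (ζ (m + i * b + t + 1))) ^ 2) ≤
      6 * N * Ex p z (fun ζ => M.st fun x y => f ζ x y ^ 2) := by
  set σ := Ex p z (fun ζ => M.st fun x y => f ζ x y ^ 2) with hσ
  have hσ0 : 0 ≤ σ := Ex_nonneg hM.nonneg fun ζ => M.st_nonneg fun x y => sq_nonneg _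
  have hst : ∀ ζ, 0 ≤ M.st fun x y => f ζ x y ^ 2 := fun ζ => M.st_nonneg fun x y => sq_nonneg _
  let F : ℕ → (ℕ → X) → ℝ := fun i ζ => f ζ (ζ (m + i * b + t)) (ζ (m + i * b + t + 1))
  have hidx : ∀ i, i < N → m + i * b + t + 1 < L := fun i hi => by
    have : i * b ≤ N * b := Nat.mul_le_mul_right b hi.le
    omega
  -- The conditional law is at most twice w, so a second moment at most doubles.
  have hsq : ∀ i, i < N → Ex p z (fun ζ => F i ζ ^ 2) ≤ 2 * σ := fun i hi => by
    have h := hM.le (m := m) (j := m + i * b + t) (by omega) (hidx i hi)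
      (H := fun ζ x y => f ζ x y ^ 2) (fun x y ζ ζ' h => congrArg (· ^ 2) (hf x y h))
      (G := fun ζ => M.st fun x y => f ζ x y ^ 2) (fun ζ δ _ hδ => by
        have hδ' := abs_le_mul_w (M := M) (δ := δ) (t := t) (s := i * b)
          (by convert hδ using 3; omega) ht
        refine (le_abs_self _).trans ((sum_mul_le_st hδ' (k := fun x y => f ζ x y ^ 2)
          fun x y => (abs_of_nonneg (sq_nonneg _)).le).trans ?_)
        exact mul_le_of_le_one_left (hst ζ) (pow_le_one₀ M.ϱ_pos.le M.ϱ_lt.le))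
    rw [← hσ] at h
    change Ex p z (fun ζ => f ζ (ζ (m + i * b + t)) (ζ (m + i * b + t + 1)) ^ 2) ≤ _
    linarith
  -- Condition on the path through the end of block i. The stationary part vanishes since f is
  -- centred, and the δ-part is bounded by ½F_i² + ½f², that is by ½·2σ + ½σ in the mean.
  have hcross : ∀ i j, i < j → j < N →
      Ex p z (fun ζ => F i ζ * F j ζ) ≤ (M.ϱ ^ b) ^ (j - i - 1) * (3 / 2 * σ) := by
    intro i j hij hj
    obtain ⟨k, rfl⟩ : ∃ k, j = i + 1 + k := ⟨j - i - 1, by omega⟩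
    have hk : i + 1 + k - i - 1 = k := by omega
    have hmul : (i + 1 + k) * b = (i + 1) * b + k * b := by ring
    rw [hk]
    have h := hM.le (m := m + (i + 1) * b) (j := m + (i + 1 + k) * b + t) (by omega) (hidx _ hj)
      (H := fun ζ x y => F i ζ * f ζ x y)
      (fun x y ζ ζ' h => by
        have h1 : F i ζ = F i ζ' := hdep i h
        have h2 : f ζ x y = f ζ' x y := hf x y fun n hn => h n (by
          simp only [Set.mem_Iio] at hn ⊢; omega)
        simp only [h1, h2])
      (G := fun ζ => (M.ϱ ^ b) ^ k *
        (1 / 2 * F i ζ ^ 2 + 1 / 2 * M.st fun x y => f ζ x y ^ 2))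
      (fun ζ δ _ hδ => by
        have hδ' := abs_le_mul_w (M := M) (δ := δ) (t := t) (s := k * b)
          (by convert hδ using 3; omega) ht
        refine (le_abs_self _).trans ((sum_mul_le_st hδ'
          (k := fun x y => 1 / 2 * F i ζ ^ 2 + 1 / 2 * f ζ x y ^ 2) fun x y => ?_).trans ?_)
        · rw [_root_.abs_le]; constructor <;>
            nlinarith [sq_nonneg (F i ζ - f ζ x y), sq_nonneg (F i ζ + f ζ x y)]
        · rw [M.st_add, M.st_const, M.st_mul, ← pow_mul, mul_comm b k])
    have e1 : ∀ ζ, M.st (fun x y => F i ζ * f ζ x y) = 0 := fun ζ => by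
      rw [M.st_mul, h0, mul_zero]
    simp only [e1, Ex_mul, Ex_add, ← hσ] at h
    have e2 : Ex p z (fun _ => (0 : ℝ)) = 0 := Ex_const hM.sum_eq 0
    rw [e2, zero_add] at h
    refine h.trans (mul_le_mul_of_nonneg_left ?_ (pow_nonneg (pow_nonneg M.ϱ_pos.le _) _))
    have := hsq i (by omega)
    linarith
  -- Each new term adds at most 2·(4/3)(3/2)σ + 2σ = 6σ.
  have key : ∀ n, n ≤ N → Ex p z (fun ζ => (∑ i ∈ Finset.range n, F i ζ) ^ 2) ≤ 6 * n * σ := by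
    intro n
    induction n with
    | zero => intro _; simp [Ex]
    | succ n ih =>
      intro hn
      have e : (fun ζ => (∑ i ∈ Finset.range (n + 1), F i ζ) ^ 2) = fun ζ =>
          (∑ i ∈ Finset.range n, F i ζ) ^ 2 + 2 * ∑ i ∈ Finset.range n, F i ζ * F n ζ +
            F n ζ ^ 2 := by
        ext ζ; rw [Finset.sum_range_succ, ← Finset.sum_mul]; ring
      rw [e, Ex_add, Ex_add, Ex_mul, Ex_sum]
      have h1 : ∑ i ∈ Finset.range n, Ex p z (fun ζ => F i ζ * F n ζ) ≤ 4 / 3 * (3 / 2 * σ) := by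
        refine (Finset.sum_le_sum fun i hi => hcross i n (Finset.mem_range.mp hi) hn).trans ?_
        rw [← Finset.sum_mul]
        refine mul_le_mul_of_nonneg_right ?_ (by linarith)
        rw [← Finset.sum_range_reflect]
        refine le_trans (le_of_eq (Finset.sum_congr rfl fun i hi => ?_))
          (geom_sum_le (pow_nonneg M.ϱ_pos.le b) hb n)
        have := Finset.mem_range.mp hi
        congr 1; omega
      have h2 := ih (by omega)
      have h3 := hsq n hn
      push_cast
      linarith
  exact key N le_rfl

end TDModel
end Mixing

/-! ### One inner step, in mean square and in the mean. -/

lemma sum_le_of_descent {a b e : ℕ → ℝ} {r : ℝ} (ha : ∀ t, 0 ≤ a t) (T : ℕ)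
    (h : ∀ t < T, a (t + 1) ≤ a t - r * b t + e t) :
    r * ∑ t ∈ Finset.range T, b t ≤ a 0 + ∑ t ∈ Finset.range T, e t := by
  have key : a T + r * ∑ t ∈ Finset.range T, b t ≤ a 0 + ∑ t ∈ Finset.range T, e t := by
    induction T with
    | zero => simp
    | succ n ih =>
      rw [Finset.sum_range_succ, Finset.sum_range_succ]
      have := ih fun t ht => h t (by omega)
      have := h n (by omega)
      linarith
  linarith [ha T]

namespace TDModel

variable {I X : Type*} [Fintype I] [Fintype X] {d : ℕ}
variable {M : TDModel X d} {p : I → ℝ} {z : I → ℕ → X} {L : ℕ}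

lemma nD_average_le (M : TDModel X d) (T : ℕ) (hT : 0 < T) (f : ℕ → X → ℝ) :
    M.nD ((1 / (T : ℝ)) • ∑ t ∈ Finset.range T, f t) ≤
      (1 / (T : ℝ)) * ∑ t ∈ Finset.range T, M.nD (f t) := by
  have hT' : (0 : ℝ) < T := by exact_mod_cast hT
  rw [nD_smul]
  have h : M.nD (∑ t ∈ Finset.range T, f t) ≤ T * ∑ t ∈ Finset.range T, M.nD (f t) := by
    simp only [nD, Finset.sum_apply]
    rw [Finset.sum_comm, Finset.mul_sum]
    refine Finset.sum_le_sum fun x _ => ?_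
    have := sq_sum_le_card_mul_sum_sq (s := Finset.range T) (f := fun t => f t x)
    rw [Finset.card_range] at this
    rw [← Finset.mul_sum]
    nlinarith [M.w_nonneg x]
  calc _ ≤ (1 / (T : ℝ)) ^ 2 * (T * ∑ t ∈ Finset.range T, M.nD (f t)) :=
        mul_le_mul_of_nonneg_left h (sq_nonneg _)
    _ = _ := by field_simp

lemma val_sum {ι : Type*} (M : TDModel X d) (s : Finset ι) (f : ι → Fin d → ℝ) :
    M.val (∑ t ∈ s, f t) = ∑ t ∈ s, M.val (f t) := by
  ext x
  simp [val, dotProduct_sum]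

/-- The condition on τ makes the mixing error of order η. Its √μ is exactly what turns the Euclidean
norm of u into the D-norm. -/
lemma pow_mul_le_avg {τ : ℕ} {η : ℝ}
    (hτ : M.CP * M.K0 * M.ϱ ^ τ ≤ √M.mu * η) (hη : 0 ≤ η) (v u : Fin d → ℝ) :
    M.CP * M.ϱ ^ τ * (M.K0 * √(M.nD (M.val v)) * √(u ⬝ᵥ u)) ≤
      η / 2 * (M.nD (M.val v) + M.nD (M.val u)) := by
  have h1 : M.CP * M.ϱ ^ τ * (M.K0 * √(M.nD (M.val v)) * √(u ⬝ᵥ u)) ≤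
      (√M.mu * η) * (√(M.nD (M.val v)) * √(u ⬝ᵥ u)) := by
    refine le_trans (le_of_eq (by ring)) (mul_le_mul_of_nonneg_right hτ (by positivity))
  have h2 := mul_le_mul_of_nonneg_left (M.sqrt_mu_mul_le u)
    (mul_nonneg hη (Real.sqrt_nonneg (M.nD (M.val v))))
  have h3 := Real.sq_sqrt (M.nD_nonneg (M.val v))
  have h4 := Real.sq_sqrt (M.nD_nonneg (M.val u))
  nlinarith [mul_nonneg hη (sq_nonneg (√(M.nD (M.val v)) - √(M.nD (M.val u))))]

/-- The square of the step is bounded by 2s² + 2|a|², but the product y·a is kept exact because it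
cancels after taking expectations. -/
lemma step_sq_pointwise (y a ψ : Fin d → ℝ) (s η : ℝ) (hψ : ψ ⬝ᵥ ψ ≤ 1) :
    (y - η • (s • ψ + a)) ⬝ᵥ (y - η • (s • ψ + a)) ≤
      y ⬝ᵥ y - 2 * η * (y ⬝ᵥ a) - 2 * η * ((ψ ⬝ᵥ y) * s) + 2 * η ^ 2 * s ^ 2 +
        2 * η ^ 2 * (a ⬝ᵥ a) := by
  have h1 : (y - η • (s • ψ + a)) ⬝ᵥ (y - η • (s • ψ + a)) =
      y ⬝ᵥ y - 2 * η * (y ⬝ᵥ a) - 2 * η * ((ψ ⬝ᵥ y) * s) +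
        η ^ 2 * (s ^ 2 * (ψ ⬝ᵥ ψ) + 2 * (s * (ψ ⬝ᵥ a)) + a ⬝ᵥ a) := by
    simp only [sub_dotProduct, dotProduct_sub, smul_dotProduct, dotProduct_smul, add_dotProduct,
      dotProduct_add, smul_eq_mul, dotProduct_comm y ψ, dotProduct_comm a ψ, dotProduct_comm a y]
    ring
  have h2 : 0 ≤ s ^ 2 * (ψ ⬝ᵥ ψ) - 2 * (s * (ψ ⬝ᵥ a)) + a ⬝ᵥ a := by
    have := dot_self_nonneg (s • ψ - a)
    simp only [sub_dotProduct, dotProduct_sub, smul_dotProduct, dotProduct_smul, smul_eq_mul,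
      dotProduct_comm a ψ] at this
    nlinarith
  rw [h1]
  have h3 : s ^ 2 * (ψ ⬝ᵥ ψ) ≤ s ^ 2 := mul_le_of_le_one_right (sq_nonneg s) hψ
  have h4 : s ^ 2 * (ψ ⬝ᵥ ψ) + 2 * (s * (ψ ⬝ᵥ a)) + a ⬝ᵥ a ≤ 2 * s ^ 2 + 2 * (a ⬝ᵥ a) := by
    linarith
  nlinarith [mul_le_mul_of_nonneg_left h4 (sq_nonneg η)]

/-- One inner step, in mean square around the point `y = 0`, where `g` is the starting point. -/
lemma Mixes.step_sq_le (hM : M.Mixes p z L) {m τ : ℕ} {η : ℝ} (hL : m + τ + 1 < L) (hη0 : 0 < η)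
    (hη : η ≤ M.lam / 845) (hτ : M.CP * M.K0 * M.ϱ ^ τ ≤ √M.mu * η)
    {y g : (ℕ → X) → Fin d → ℝ} (hy : DependsOn y (Set.Iio m)) (hg : DependsOn g (Set.Iio m)) :
    Ex p z (fun ζ => (y ζ - η • (((M.Ψ (ζ (m + τ)) - M.Ψ (ζ (m + τ + 1))) ⬝ᵥ (y ζ - g ζ)) •
      M.Ψ (ζ (m + τ)) + M.meanMat.mulVec (g ζ))) ⬝ᵥ
      (y ζ - η • (((M.Ψ (ζ (m + τ)) - M.Ψ (ζ (m + τ + 1))) ⬝ᵥ (y ζ - g ζ)) •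
      M.Ψ (ζ (m + τ)) + M.meanMat.mulVec (g ζ)))) ≤
    Ex p z (fun ζ => y ζ ⬝ᵥ y ζ) - η * M.lam * Ex p z (fun ζ => M.nD (M.val (y ζ))) +
      η * M.lam / 28 * Ex p z (fun ζ => M.nD (M.val (g ζ))) := by
  -- The bound of `step_sq_pointwise` as a function of the tuple; 8 = 2·4 comes from `mean_sq_le`.
  let H : (ℕ → X) → X → X → ℝ := fun ζ x x' =>
    (y ζ ⬝ᵥ y ζ - 2 * η * (y ζ ⬝ᵥ M.meanMat.mulVec (g ζ)) + 8 * η ^ 2 * M.nD (M.val (g ζ))) -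
      2 * η * (M.val (y ζ) x * (M.val (y ζ - g ζ) x - M.val (y ζ - g ζ) x')) +
      2 * η ^ 2 * (M.val (y ζ - g ζ) x - M.val (y ζ - g ζ) x') ^ 2
  have h1 : Ex p z (fun ζ => (y ζ - η • (((M.Ψ (ζ (m + τ)) - M.Ψ (ζ (m + τ + 1))) ⬝ᵥ
      (y ζ - g ζ)) • M.Ψ (ζ (m + τ)) + M.meanMat.mulVec (g ζ))) ⬝ᵥ
      (y ζ - η • (((M.Ψ (ζ (m + τ)) - M.Ψ (ζ (m + τ + 1))) ⬝ᵥ (y ζ - g ζ)) •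
      M.Ψ (ζ (m + τ)) + M.meanMat.mulVec (g ζ)))) ≤
      Ex p z (fun ζ => H ζ (ζ (m + τ)) (ζ (m + τ + 1))) := by
    refine Ex_mono hM.nonneg fun ζ => (step_sq_pointwise _ _ _ _ _ (M.Ψ_le _)).trans ?_
    have := mul_le_mul_of_nonneg_left (M.mean_sq_le (g ζ)) (by positivity : 0 ≤ 2 * η ^ 2)
    simp only [H, val, sub_dotProduct]
    linarith
  have h2 := hM.le (m := m) (j := m + τ) (by omega) hL (H := H)
    (fun x x' ζ ζ' h => by simp only [H, hy h, hg h])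
    -- Against δ the first bracket of `H` disappears; the two summands here bound the parts linear
    -- and quadratic in the temporal difference.
    (G := fun ζ => 2 * η * (η / 2 * (M.nD (M.val (y ζ)) + M.nD (M.val (y ζ - g ζ)))) +
      2 * η ^ 2 * (3 * (η / 2 * (M.nD (M.val (y ζ - g ζ)) + M.nD (M.val (y ζ - g ζ))))))
    (fun ζ δ hδ0 hδ => by
      rw [Nat.add_sub_cancel_left] at hδ
      have e : ∑ x, δ x * ∑ x', M.P x x' * H ζ x x' =
          2 * η * (-∑ x, δ x * (M.val (y ζ) x * M.res (M.val (y ζ - g ζ)) x)) +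
          2 * η ^ 2 * ∑ x, δ x *
            ∑ x', M.P x x' * (M.val (y ζ - g ζ) x - M.val (y ζ - g ζ) x') ^ 2 := by
        have e1 : ∀ x, ∑ x', M.P x x' * H ζ x x' = (y ζ ⬝ᵥ y ζ - 2 * η *
            (y ζ ⬝ᵥ M.meanMat.mulVec (g ζ)) + 8 * η ^ 2 * M.nD (M.val (g ζ))) +
            2 * η * (-(M.val (y ζ) x * M.res (M.val (y ζ - g ζ)) x)) +
            2 * η ^ 2 * ∑ x', M.P x x' * (M.val (y ζ - g ζ) x - M.val (y ζ - g ζ) x') ^ 2 := by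
          intro x
          have e2 : ∀ x', M.P x x' * H ζ x x' = (y ζ ⬝ᵥ y ζ - 2 * η *
              (y ζ ⬝ᵥ M.meanMat.mulVec (g ζ)) + 8 * η ^ 2 * M.nD (M.val (g ζ))) * M.P x x' +
              (2 * η * -M.val (y ζ) x) *
                (M.P x x' * (M.val (y ζ - g ζ) x - M.val (y ζ - g ζ) x')) +
              2 * η ^ 2 * (M.P x x' * (M.val (y ζ - g ζ) x - M.val (y ζ - g ζ) x') ^ 2) :=
            fun x' => by simp only [H]; ring
          simp only [e2, Finset.sum_add_distrib, ← Finset.mul_sum, M.P_sum, ← res_eq]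
          ring
        simp only [e1, mul_add, Finset.sum_add_distrib, ← Finset.sum_mul, hδ0, Finset.mul_sum]
        simp only [← Finset.sum_neg_distrib, Finset.mul_sum]
        simp only [zero_mul, zero_add, mul_neg]
        congr 1
        · exact Finset.sum_congr rfl fun i _ => by ring
        · exact Finset.sum_congr rfl fun i _ => Finset.sum_congr rfl fun j _ => by ring
      rw [e]
      have b1 := (abs_sum_mul_le hδ (M.abs_val_res_val_le (y ζ) (y ζ - g ζ))
        (mul_nonneg (mul_nonneg M.K0_nonneg (Real.sqrt_nonneg _)) (Real.sqrt_nonneg _))).trans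
        (pow_mul_le_avg hτ hη0.le _ _)
      have b2 := abs_sum_mul_le hδ (M.abs_var_val_le (y ζ - g ζ)) (by
        have := mul_nonneg (mul_nonneg M.K0_nonneg (Real.sqrt_nonneg
          (M.nD (M.val (y ζ - g ζ))))) (Real.sqrt_nonneg ((y ζ - g ζ) ⬝ᵥ (y ζ - g ζ)))
        linarith)
      have b3 := pow_mul_le_avg hτ hη0.le (y ζ - g ζ) (y ζ - g ζ)
      refine add_le_add (mul_le_mul_of_nonneg_left ((neg_le_abs _).trans b1) (by positivity))
        (mul_le_mul_of_nonneg_left ((le_abs_self _).trans (b2.trans ?_)) (by positivity))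
      linarith)
  refine (h1.trans h2).trans ?_
  rw [← Ex_add, ← Ex_mul, ← Ex_mul, ← Ex_sub, ← Ex_add]
  refine Ex_mono hM.nonneg fun ζ => ?_
  have e : M.st (H ζ) = (y ζ ⬝ᵥ y ζ - 2 * η * (y ζ ⬝ᵥ M.meanMat.mulVec (g ζ)) +
      8 * η ^ 2 * M.nD (M.val (g ζ))) - 2 * η * (y ζ ⬝ᵥ M.meanMat.mulVec (y ζ - g ζ)) +
      2 * η ^ 2 * M.st (fun x x' => (M.val (y ζ - g ζ) x - M.val (y ζ - g ζ) x') ^ 2) := by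
    simp only [H]
    rw [M.st_add, M.st_sub, M.st_const, M.st_mul, M.st_mul, M.st_val_mul]
  -- The two products y·Ag cancel and leave the pure drift -2η y·Ay.
  rw [e, Matrix.mulVec_sub, dotProduct_sub]
  have i1 := M.st_diff_sq_le (M.val (y ζ - g ζ))
  have i2 := M.lam_le' (y ζ)
  have i3 := M.nD_sub_le (M.val (y ζ)) (M.val (g ζ))
  rw [← M.val_sub] at i3
  have i4 := M.nD_nonneg (M.val (y ζ))
  have i5 := M.nD_nonneg (M.val (g ζ))
  have i6 := M.nD_nonneg (M.val (y ζ - g ζ))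
  set a := M.nD (M.val (y ζ))
  set b := M.nD (M.val (g ζ))
  set u := M.nD (M.val (y ζ - g ζ))
  -- With 6ηu ≤ u and u ≤ 2a + 2b the bracket in `j1` is at most 21a + 28b. The step size then works
  -- because 23/845 < 1 and 30/845 < 1/28.
  have hη1 : η ≤ 1 / 6 := by linarith [M.lam_le_two]
  have j1 : η ^ 2 * (a + u + 8 * u + 6 * η * u + 8 * b) ≤ η ^ 2 * (23 * a + 30 * b) := by
    refine mul_le_mul_of_nonneg_left ?_ (sq_nonneg η)
    nlinarith
  have j2 : η ^ 2 * (23 * a + 30 * b) ≤ η * (M.lam / 845) * (23 * a + 30 * b) := by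
    rw [sq]
    exact mul_le_mul_of_nonneg_right (mul_le_mul_of_nonneg_left hη hη0.le) (by linarith)
  have j3 := mul_le_mul_of_nonneg_left i1 (by positivity : 0 ≤ 2 * η ^ 2)
  have j4 := mul_le_mul_of_nonneg_left i2 (by positivity : 0 ≤ 2 * η)
  have j5 : 0 ≤ η * M.lam * a := mul_nonneg (mul_nonneg hη0.le M.lam_pos.le) i4
  have j6 : 0 ≤ η * M.lam * b := mul_nonneg (mul_nonneg hη0.le M.lam_pos.le) i5
  nlinarith

/-- The bias of one inner step. -/
lemma Mixes.abs_dot_step_bias_le (hM : M.Mixes p z L) {m τ : ℕ} (hL : m + τ + 1 < L)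
    {u : (ℕ → X) → Fin d → ℝ} (hu : DependsOn u (Set.Iio m)) (v : Fin d → ℝ) :
    |v ⬝ᵥ (ExV p z (fun ζ => ((M.Ψ (ζ (m + τ)) - M.Ψ (ζ (m + τ + 1))) ⬝ᵥ u ζ) •
      M.Ψ (ζ (m + τ))) - M.meanMat.mulVec (ExV p z u))| ≤
      M.CP * M.ϱ ^ τ * M.K0 * √(M.nD (M.val v)) * Ex p z (fun ζ => √(u ζ ⬝ᵥ u ζ)) := by
  have h := hM.abs_le (m := m) (j := m + τ) (by omega) hL
    (H := fun ζ x x' => M.val v x * (M.val (u ζ) x - M.val (u ζ) x'))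
    (fun x x' ζ ζ' h => by simp only [hu h])
    (G := fun ζ => M.CP * M.ϱ ^ τ * M.K0 * √(M.nD (M.val v)) * √(u ζ ⬝ᵥ u ζ))
    (fun ζ δ _ hδ => by
      rw [Nat.add_sub_cancel_left] at hδ
      have e : ∀ x, ∑ x', M.P x x' * (M.val v x * (M.val (u ζ) x - M.val (u ζ) x')) =
          M.val v x * M.res (M.val (u ζ)) x := fun x => by
        rw [res_eq, Finset.mul_sum]
        exact Finset.sum_congr rfl fun i _ => by ring
      simp only [e]
      refine (abs_sum_mul_le hδ (M.abs_val_res_val_le v (u ζ))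
        (mul_nonneg (mul_nonneg M.K0_nonneg (Real.sqrt_nonneg _)) (Real.sqrt_nonneg _))).trans
        (le_of_eq (by ring)))
  rw [Ex_mul] at h
  refine le_trans (le_of_eq (congrArg _ ?_)) h
  have e2 : v ⬝ᵥ M.meanMat.mulVec (ExV p z u) = Ex p z fun ζ => v ⬝ᵥ M.meanMat.mulVec (u ζ) := by
    simp only [Matrix.dotProduct_mulVec, dot_ExV]
  rw [dotProduct_sub, dot_ExV, e2]
  simp only [st_val_mul]
  congr 1
  refine congrArg _ (funext fun ζ => ?_)
  simp only [smul_dotProduct, smul_eq_mul, val, sub_dotProduct, dotProduct_comm v]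
  ring

/-- One step of the mean iteration with a perturbation `s`. -/
lemma mean_step_le {η κ : ℝ} (hη0 : 0 < η) (hη : η ≤ M.lam / 845) (y s : Fin d → ℝ)
    (hκ : 0 ≤ κ) (hs : ∀ v, |v ⬝ᵥ s| ≤ κ * √(M.nD (M.val v))) :
    (y - η • (M.meanMat.mulVec y + s)) ⬝ᵥ (y - η • (M.meanMat.mulVec y + s)) ≤
      y ⬝ᵥ y - η * M.lam * M.nD (M.val y) + 3 * η * κ ^ 2 / M.lam := by
  set a := M.meanMat.mulVec y with ha
  have e : (y - η • (a + s)) ⬝ᵥ (y - η • (a + s)) =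
      y ⬝ᵥ y - 2 * η * (y ⬝ᵥ a) - 2 * η * (y ⬝ᵥ s) + η ^ 2 * ((a + s) ⬝ᵥ (a + s)) := by
    simp only [sub_dotProduct, dotProduct_sub, smul_dotProduct, dotProduct_smul, smul_eq_mul,
      add_dotProduct, dotProduct_add, dotProduct_comm s y, dotProduct_comm a y]
    ring
  have h1 : (a + s) ⬝ᵥ (a + s) ≤ 2 * (a ⬝ᵥ a) + 2 * (s ⬝ᵥ s) := by
    have := dot_self_nonneg (a - s)
    simp only [sub_dotProduct, dotProduct_sub, add_dotProduct, dotProduct_add,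
      dotProduct_comm s a] at this ⊢
    linarith
  have h2 : s ⬝ᵥ s ≤ κ ^ 2 := by
    have h3 := (le_abs_self _).trans (hs s)
    have h4 : κ * √(M.nD (M.val s)) ≤ κ * √(s ⬝ᵥ s) :=
      mul_le_mul_of_nonneg_left (Real.sqrt_le_sqrt (M.nD_val_le s)) hκ
    have h5 := Real.sq_sqrt (dot_self_nonneg s)
    nlinarith [sq_nonneg (√(s ⬝ᵥ s) - κ)]
  have h3 := M.mean_sq_le y
  rw [← ha] at h3
  have h4 := M.lam_le' y
  rw [← ha] at h4
  have h5 := (neg_le_abs _).trans (hs y)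
  have hn := M.nD_nonneg (M.val y)
  set n := M.nD (M.val y)
  have hl := M.lam_pos
  -- Young's inequality: the perturbation uses λn/2 of the drift 2λn, the quadratic term 8ηn another
  -- λn/2, and λn is left. The κ² parts add up to 2 + 1 = 3.
  have h6 : 2 * (κ * √n) ≤ M.lam / 2 * n + 2 * (κ ^ 2 / M.lam) := by
    have h7 := Real.sq_sqrt hn
    have h8 : 0 ≤ (M.lam * √n - 2 * κ) ^ 2 / (2 * M.lam) := by positivity
    have h9 : (M.lam * √n - 2 * κ) ^ 2 / (2 * M.lam) =
        M.lam / 2 * √n ^ 2 + 2 * (κ ^ 2 / M.lam) - 2 * (κ * √n) := by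
      field_simp; ring
    rw [h7] at h9; linarith
  have h10 : 2 * η * κ ^ 2 ≤ κ ^ 2 / M.lam := by
    rw [le_div_iff₀ hl]
    have : 2 * η * M.lam ≤ 1 := by nlinarith [M.lam_le_two]
    nlinarith [sq_nonneg κ]
  have h11 : (y - η • (a + s)) ⬝ᵥ (y - η • (a + s)) ≤ y ⬝ᵥ y - 2 * η * (M.lam * n) +
      η * (M.lam / 2 * n + 2 * (κ ^ 2 / M.lam)) + η * (8 * η * n + κ ^ 2 / M.lam) := by
    rw [e]
    have k1 := mul_le_mul_of_nonneg_left h4 (by positivity : 0 ≤ 2 * η)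
    have k2 := mul_le_mul_of_nonneg_left (h5.trans (le_refl _)) (by positivity : 0 ≤ 2 * η)
    have k3 := mul_le_mul_of_nonneg_left h6 hη0.le
    have k4 : (a + s) ⬝ᵥ (a + s) ≤ 8 * n + 2 * κ ^ 2 := by linarith
    have k5 := mul_le_mul_of_nonneg_left k4 (sq_nonneg η)
    have k6 := mul_le_mul_of_nonneg_left h10 hη0.le
    nlinarith
  have h12 : η * (8 * η * n) ≤ η * (M.lam / 2 * n) :=
    mul_le_mul_of_nonneg_left (mul_le_mul_of_nonneg_right (by linarith) hn) hη0.le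
  refine h11.trans (le_of_sub_nonneg ?_)
  have : 3 * η * κ ^ 2 / M.lam = 3 * η * (κ ^ 2 / M.lam) := by ring
  rw [this]
  nlinarith

end TDModel

/-! ### The reference estimate and the average-cost estimate. -/

namespace TDModel

variable {I X : Type*} [Fintype I] [Fintype X] {d : ℕ}
variable {M : TDModel X d} {p : I → ℝ} {z : I → ℕ → X} {L : ℕ}

/-- The accumulated bias of a sum of functions of tuples collected every `b` steps. -/
lemma Mixes.abs_sum_bias_le (hM : M.Mixes p z L) {m t b N : ℕ} (hb : M.ϱ ^ b ≤ 1 / 4)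
    (hL : m + N * b + t + 1 < L)
    {H : (ℕ → X) → X → X → ℝ} (hH : ∀ x y, DependsOn (fun ζ => H ζ x y) (Set.Iio m))
    (h0 : ∀ ζ, M.st (H ζ) = 0) {B : (ℕ → X) → ℝ} (hB0 : ∀ ζ, 0 ≤ B ζ)
    (hB : ∀ ζ (δ : X → ℝ) (ε : ℝ), ∑ x, δ x = 0 → ∑ x, |δ x| ≤ ε →
      |∑ x, δ x * ∑ y, M.P x y * H ζ x y| ≤ ε * B ζ) :
    |Ex p z (fun ζ => ∑ i ∈ Finset.range N,
      H ζ (ζ (m + i * b + t)) (ζ (m + i * b + t + 1)))| ≤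
      4 / 3 * (M.CP * M.ϱ ^ t) * Ex p z B := by
  have hB1 : 0 ≤ Ex p z B := Ex_nonneg hM.nonneg hB0
  have hε : 0 ≤ M.CP * M.ϱ ^ t := mul_nonneg M.CP_nonneg (pow_nonneg M.ϱ_pos.le _)
  rw [Ex_sum]
  refine (Finset.abs_sum_le_sum_abs _ _).trans ?_
  -- The i-th sample is i·b + t steps after time m, so the biases form a geometric series of ratio
  -- ϱ^b ≤ 1/4.
  have h1 : ∀ i ∈ Finset.range N, |Ex p z (fun ζ =>
      H ζ (ζ (m + i * b + t)) (ζ (m + i * b + t + 1)))| ≤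
      (M.ϱ ^ b) ^ i * (M.CP * M.ϱ ^ t * Ex p z B) := by
    intro i hi
    have hi' : i * b ≤ N * b := Nat.mul_le_mul_right b (Finset.mem_range.mp hi).le
    have h := hM.abs_le (m := m) (j := m + i * b + t) (by omega) (by omega) hH
      (G := fun ζ => M.CP * M.ϱ ^ (i * b + t) * B ζ) (fun ζ δ hδ0 hδ => by
        refine hB ζ δ _ hδ0 (hδ.trans (le_of_eq ?_))
        congr 2; omega)
    have e : Ex p z (fun ζ => M.st (H ζ)) = 0 := by simp only [h0]; exact Ex_const hM.sum_eq 0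
    rw [e, sub_zero, Ex_mul] at h
    refine h.trans (le_of_eq ?_)
    rw [pow_add, mul_comm i b, pow_mul]; ring
  refine (Finset.sum_le_sum h1).trans ?_
  rw [← Finset.sum_mul]
  refine (mul_le_mul_of_nonneg_right (geom_sum_le (pow_nonneg M.ϱ_pos.le b) hb N)
    (mul_nonneg hε hB1)).trans (le_of_eq (by ring))

/-- The parameters of the method meet the conditions of the convergence theorem. -/
structure Tuned (M : TDModel X d) (q : Params) : Prop where
  η_pos : 0 < q.η
  η_le : q.η ≤ M.lam / 845
  T_le : 64 / (M.mu * M.lam * q.η) ≤ q.T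
  N_le : 1160 / (M.mu * M.lam ^ 2) ≤ q.N
  N'_le : 1 / (M.mu * M.lam ^ 2) ≤ q.N'
  τ_le : M.CP * M.K0 * M.ϱ ^ q.τ ≤ √M.mu * q.η
  mix_le : M.CP * M.ϱ ^ q.τ' ≤ M.wmin
  -- τ' + 1 is the spacing of the cost samples; the tuples are spaced by τ' + 2. Either spacing
  -- makes correlations decay by 1/4 per block.
  rate_le : M.ϱ ^ (q.τ' + 1) ≤ 1 / 4

variable (M) (q : Params)

/-- The stochastic operator at the solution of the projected Bellman equation. -/
def noise (x y : X) : Fin d → ℝ := (M.val M.θs x - M.val M.θs y - M.c x + M.rho) • M.Ψ x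

/-- The error of the average-cost estimate of an epoch that starts at time `m`. -/
def rhoErr (m : ℕ) (ζ : ℕ → X) : ℝ :=
  1 / (q.N' : ℝ) * ∑ i ∈ Finset.range q.N', (M.c (ζ (m + i * (q.τ' + 1) + q.τ')) - M.rho)

/-- The stochastic operator along the tuples of the reference estimate, without the error of the
average-cost estimate. -/
def gradTerm (u : Fin d → ℝ) (x y : X) : Fin d → ℝ :=
  (M.val u x - M.val u y) • M.Ψ x + M.noise x y

/-- The reference estimate `ĝ` of an epoch that starts at time `m`. -/
def gradEst (m : ℕ) (u : (ℕ → X) → Fin d → ℝ) (ζ : ℕ → X) : Fin d → ℝ :=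
  (1 / (q.N : ℝ)) • ∑ i ∈ Finset.range q.N,
    (M.gradTerm (u ζ) (ζ (m + offsetG q + i * (q.τ' + 2) + q.τ'))
      (ζ (m + offsetG q + i * (q.τ' + 2) + q.τ' + 1)) +
      M.rhoErr q m ζ • M.Ψ (ζ (m + offsetG q + i * (q.τ' + 2) + q.τ')))

/-- The errors of the inner iterates of an epoch that starts at time `m`. -/
def innerErr (m : ℕ) (u : (ℕ → X) → Fin d → ℝ) : ℕ → (ℕ → X) → Fin d → ℝ
  | 0 => u
  | t + 1 => fun ζ =>
    innerErr m u t ζ - q.η • (((M.Ψ (ζ (m + offsetT q + t * (q.τ + 2) + q.τ)) -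
      M.Ψ (ζ (m + offsetT q + t * (q.τ + 2) + q.τ + 1))) ⬝ᵥ (innerErr m u t ζ - u ζ)) •
      M.Ψ (ζ (m + offsetT q + t * (q.τ + 2) + q.τ)) + M.gradEst q m u ζ)

/-- The deviation of the reference estimate from the mean operator. -/
def gradErr (m : ℕ) (u : (ℕ → X) → Fin d → ℝ) (ζ : ℕ → X) : Fin d → ℝ :=
  M.gradEst q m u ζ - M.meanMat.mulVec (u ζ)

/-- The stationary second moment of the noise after the solution of the linear system. -/
def noiseVar : ℝ := M.st fun x y => M.nD (M.val (M.solve (M.noise x y)))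

variable {M q}

lemma cbar_nonneg [Nonempty X] : 0 ≤ M.cbar :=
  (abs_nonneg _).trans (M.c_le (Classical.arbitrary X))

lemma nonempty (M : TDModel X d) : Nonempty X := by
  by_contra h
  rw [not_nonempty_iff] at h
  have := M.w_sum
  simp at this

lemma abs_rho_le : |M.rho| ≤ M.cbar := by
  refine (Finset.abs_sum_le_sum_abs _ _).trans ?_
  have h : ∑ x, |M.w x * M.c x| ≤ ∑ x, M.w x * M.cbar := Finset.sum_le_sum fun x _ => by
    rw [abs_mul, abs_of_nonneg (M.w_nonneg x)]
    exact mul_le_mul_of_nonneg_left (M.c_le x) (M.w_nonneg x)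
  rwa [← Finset.sum_mul, M.w_sum, one_mul] at h

lemma abs_rhoErr_le (m : ℕ) (ζ : ℕ → X) : |M.rhoErr q m ζ| ≤ 2 * M.cbar := by
  have := M.nonempty
  have h : ∀ x, |M.c x - M.rho| ≤ 2 * M.cbar := fun x =>
    (abs_sub _ _).trans (by linarith [M.c_le x, M.abs_rho_le])
  rw [rhoErr, abs_mul, abs_of_nonneg (by positivity)]
  have h2 : |∑ i ∈ Finset.range q.N', (M.c (ζ (m + i * (q.τ' + 1) + q.τ')) - M.rho)| ≤
      q.N' * (2 * M.cbar) := by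
    refine (Finset.abs_sum_le_sum_abs _ _).trans ((Finset.sum_le_sum fun i _ => h _).trans ?_)
    simp
  refine (mul_le_mul_of_nonneg_left h2 (by positivity)).trans ?_
  rw [← mul_assoc]
  refine mul_le_of_le_one_left (mul_nonneg zero_le_two M.cbar_nonneg) ?_
  rw [one_div]; exact inv_mul_le_one

lemma dependsOn_rhoErr (m : ℕ) :
    DependsOn (M.rhoErr q m) (Set.Iio (m + offsetG q)) := by
  intro ζ ζ' h
  unfold rhoErr
  congr 1
  refine Finset.sum_congr rfl fun i hi => ?_
  rw [h]
  have : (i + 1) * (q.τ' + 1) ≤ q.N' * (q.τ' + 1) :=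
    Nat.mul_le_mul_right _ (Finset.mem_range.mp hi)
  simp only [Set.mem_Iio, offsetG]
  rw [add_mul] at this
  omega

lemma dependsOn_gradEst {m : ℕ} {u : (ℕ → X) → Fin d → ℝ} (hu : DependsOn u (Set.Iio m)) :
    DependsOn (M.gradEst q m u) (Set.Iio (m + offsetT q)) := by
  intro ζ ζ' h
  have h1 : u ζ = u ζ' := hu fun n hn => h n (by simp only [Set.mem_Iio] at hn ⊢; omega)
  have h2 : M.rhoErr q m ζ = M.rhoErr q m ζ' := dependsOn_rhoErr m fun n hn => h n (by
    simp only [Set.mem_Iio, offsetT] at hn ⊢; omega)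
  unfold gradEst
  congr 1
  refine Finset.sum_congr rfl fun i hi => ?_
  have : (i + 1) * (q.τ' + 2) ≤ q.N * (q.τ' + 2) :=
    Nat.mul_le_mul_right _ (Finset.mem_range.mp hi)
  rw [add_mul] at this
  rw [h1, h2, h _ (by simp only [Set.mem_Iio, offsetT]; omega),
    h (m + offsetG q + i * (q.τ' + 2) + q.τ' + 1) (by simp only [Set.mem_Iio, offsetT]; omega)]

lemma dependsOn_innerErr {m : ℕ} {u : (ℕ → X) → Fin d → ℝ} (hu : DependsOn u (Set.Iio m)) (t : ℕ) :
    DependsOn (M.innerErr q m u t) (Set.Iio (m + offsetT q + t * (q.τ + 2))) := by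
  induction t with
  | zero => exact fun ζ ζ' h => hu fun n hn => h n (by simp only [Set.mem_Iio] at hn ⊢; omega)
  | succ t ih =>
    intro ζ ζ' h
    have e : (t + 1) * (q.τ + 2) = t * (q.τ + 2) + (q.τ + 2) := by ring
    rw [e] at h
    have h0 : u ζ = u ζ' := hu fun n hn => h n (by simp only [Set.mem_Iio] at hn ⊢; omega)
    have h1 : M.innerErr q m u t ζ = M.innerErr q m u t ζ' :=
      ih fun n hn => h n (by simp only [Set.mem_Iio] at hn ⊢; omega)
    have h2 : M.gradEst q m u ζ = M.gradEst q m u ζ' :=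
      dependsOn_gradEst hu fun n hn => h n (by simp only [Set.mem_Iio] at hn ⊢; omega)
    simp only [innerErr]
    rw [h0, h1, h2, h (m + offsetT q + t * (q.τ + 2) + q.τ) (by simp only [Set.mem_Iio]; omega),
      h (m + offsetT q + t * (q.τ + 2) + q.τ + 1) (by simp only [Set.mem_Iio]; omega)]

lemma Tuned.rate_le' (hq : M.Tuned q) : M.ϱ ^ (q.τ' + 2) ≤ 1 / 4 :=
  (pow_le_pow_of_le_one M.ϱ_pos.le M.ϱ_lt.le (by omega)).trans hq.rate_le

lemma Tuned.muN (hq : M.Tuned q) : 1160 ≤ q.N * (M.mu * M.lam ^ 2) :=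
  (div_le_iff₀ (mul_pos M.mu_pos (pow_pos M.lam_pos 2))).mp hq.N_le

lemma Tuned.muN' (hq : M.Tuned q) : 1 ≤ q.N' * (M.mu * M.lam ^ 2) :=
  (div_le_iff₀ (mul_pos M.mu_pos (pow_pos M.lam_pos 2))).mp hq.N'_le

lemma Tuned.muT (hq : M.Tuned q) : 64 ≤ q.T * (M.mu * M.lam * q.η) :=
  (div_le_iff₀ (mul_pos (mul_pos M.mu_pos M.lam_pos) hq.η_pos)).mp hq.T_le

lemma Tuned.N_pos (hq : M.Tuned q) : (0 : ℝ) < q.N :=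
  (div_pos (by norm_num) (mul_pos M.mu_pos (pow_pos M.lam_pos 2))).trans_le hq.N_le

lemma Tuned.N'_pos (hq : M.Tuned q) : (0 : ℝ) < q.N' :=
  (div_pos (by norm_num) (mul_pos M.mu_pos (pow_pos M.lam_pos 2))).trans_le hq.N'_le

lemma Tuned.T_pos (hq : M.Tuned q) : (0 : ℝ) < q.T :=
  (div_pos (by norm_num) (mul_pos (mul_pos M.mu_pos M.lam_pos) hq.η_pos)).trans_le hq.T_le

lemma st_rho : M.st (fun x _ => M.c x - M.rho) = 0 := by
  rw [M.st_sub, M.st_const, M.st_left (fun x => M.c x), rho, sub_self]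

/-- The second moment of the error of the average-cost estimate. -/
lemma Mixes.rhoErr_sq_le (hM : M.Mixes p z L) (hq : M.Tuned q) {m : ℕ}
    (hL : m + offsetG q + q.τ' + 1 < L) :
    Ex p z (fun ζ => M.rhoErr q m ζ ^ 2) ≤ 6 * M.cbar ^ 2 / q.N' := by
  have h := hM.sum_sq_le (m := m) (t := q.τ') (b := q.τ' + 1) (N := q.N') hq.rate_le
    (by simpa only [offsetG] using hL) hq.mix_le (f := fun _ x _ => M.c x - M.rho)
    (fun x y ζ ζ' _ => rfl)
    (fun i ζ ζ' h => by
      simp only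
      rw [h]; simp only [Set.mem_Iio]; rw [add_mul]; omega)
    (fun _ => st_rho)
  have e : (fun ζ => M.rhoErr q m ζ ^ 2) = fun ζ => (1 / (q.N' : ℝ)) ^ 2 *
      (∑ i ∈ Finset.range q.N', (M.c (ζ (m + i * (q.τ' + 1) + q.τ')) - M.rho)) ^ 2 := by
    ext ζ; rw [rhoErr, mul_pow]
  -- A variance is at most the second moment; this avoids the cruder bound (2c̄)².
  have h1 : M.st (fun x _ => (M.c x - M.rho) ^ 2) ≤ M.cbar ^ 2 := by
    have e1 : (fun (x _ : X) => (M.c x - M.rho) ^ 2) =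
        fun x _ => M.c x ^ 2 - 2 * M.rho * (M.c x - M.rho) - M.rho ^ 2 := by
      ext x y; ring
    have e2 : M.st (fun x _ => M.c x ^ 2 - 2 * M.rho * (M.c x - M.rho) - M.rho ^ 2) =
        M.st (fun x _ => M.c x ^ 2) - 2 * M.rho * 0 - M.rho ^ 2 := by
      rw [M.st_sub, M.st_sub, M.st_mul, st_rho, M.st_const]
    have h2 : M.st (fun x _ => M.c x ^ 2) ≤ M.st (fun _ _ => M.cbar ^ 2) :=
      M.st_mono fun x _ => by rw [← sq_abs]; exact pow_le_pow_left₀ (abs_nonneg _) (M.c_le x) 2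
    rw [M.st_const] at h2
    rw [e1, e2]; nlinarith [sq_nonneg M.rho]
  rw [Ex_const hM.sum_eq] at h
  rw [e, Ex_mul]
  have hN := hq.N'_pos
  calc _ ≤ (1 / (q.N' : ℝ)) ^ 2 * (6 * q.N' * M.cbar ^ 2) := by
        refine mul_le_mul_of_nonneg_left (h.trans ?_) (sq_nonneg _)
        exact mul_le_mul_of_nonneg_left h1 (by positivity)
    _ = _ := by field_simp

lemma dot_noise (v : Fin d → ℝ) (x y : X) :
    v ⬝ᵥ M.noise x y = M.val v x * (M.val M.θs x - M.val M.θs y - M.c x + M.rho) := by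
  rw [noise, dotProduct_smul, smul_eq_mul, dotProduct_comm, mul_comm]; rfl

/-- Averaging over the next pair and replacing c - ρ* by (I - P)Q leaves (I - P)(Ψθ* - Q). This is
how the distance to the differential value function enters the bias. -/
lemma sum_P_dot_noise (v : Fin d → ℝ) (x : X) :
    ∑ y, M.P x y * (v ⬝ᵥ M.noise x y) =
      M.val v x * M.res (fun x => M.val M.θs x - M.Q x) x := by
  have h := M.poisson x
  have e : ∀ y, M.P x y * (v ⬝ᵥ M.noise x y) =
      M.val v x * ((M.val M.θs x - M.c x + M.rho) * M.P x y - M.P x y * M.val M.θs y) := fun y => by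
    rw [dot_noise]; ring
  simp only [e]
  rw [← Finset.mul_sum, Finset.sum_sub_distrib, ← Finset.mul_sum, M.P_sum, res]
  simp only [mul_sub, Finset.sum_sub_distrib]
  rw [rho]
  linear_combination (M.val v x) * h

lemma st_dot_noise (v : Fin d → ℝ) : M.st (fun x y => v ⬝ᵥ M.noise x y) = 0 := by
  rw [st, ← M.bellman v]
  refine Finset.sum_congr rfl fun x _ => ?_
  congr 1
  rw [sum_P_dot_noise]
  have h := M.poisson x
  simp only [res, mul_sub, Finset.sum_sub_distrib, val]
  linear_combination -(M.Ψ x ⬝ᵥ v) * h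

lemma st_dot_gradTerm (v u : Fin d → ℝ) :
    M.st (fun x y => v ⬝ᵥ (M.gradTerm u x y - M.meanMat.mulVec u)) = 0 := by
  have e : ∀ x y, v ⬝ᵥ (M.gradTerm u x y - M.meanMat.mulVec u) =
      M.val v x * (M.val u x - M.val u y) + v ⬝ᵥ M.noise x y - v ⬝ᵥ M.meanMat.mulVec u := by
    intro x y
    simp only [gradTerm, dotProduct_sub, dotProduct_add, dotProduct_smul, smul_eq_mul]
    rw [show v ⬝ᵥ M.Ψ x = M.val v x from dotProduct_comm _ _]; ring
  simp only [e]
  rw [M.st_sub, M.st_add, M.st_const, st_val_mul, st_dot_noise]; ring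

lemma val_solve_eq (e : Fin d → ℝ) (x : X) :
    M.val (M.solve e) x = (Matrix.vecMul (M.Ψ x) M.meanMat⁻¹) ⬝ᵥ e := by
  rw [val, solve, Matrix.dotProduct_mulVec]

/-- The part of the fluctuation depending on u goes through the crude `nD_solve_le`. The noise at θ*
is kept behind A⁻¹, so that its second moment can later be compared with the trace in W₁. -/
lemma st_nD_solve_gradTerm_le (u : Fin d → ℝ) :
    M.st (fun x y => M.nD (M.val (M.solve (M.gradTerm u x y - M.meanMat.mulVec u)))) ≤
      8 * M.nD (M.val u) / (M.mu * M.lam ^ 2) + 2 * M.noiseVar := by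
  have hml : 0 < M.mu * M.lam ^ 2 := mul_pos M.mu_pos (pow_pos M.lam_pos 2)
  let a : X → X → Fin d → ℝ := fun x y => (M.val u x - M.val u y) • M.Ψ x - M.meanMat.mulVec u
  have h1 : ∀ x y, M.nD (M.val (M.solve (M.gradTerm u x y - M.meanMat.mulVec u))) ≤
      2 / (M.mu * M.lam ^ 2) * (a x y ⬝ᵥ a x y) +
        2 * M.nD (M.val (M.solve (M.noise x y))) := by
    intro x y
    have e : M.gradTerm u x y - M.meanMat.mulVec u = a x y + M.noise x y := by
      simp only [a, gradTerm]; abel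
    rw [e, solve_add, val_add]
    refine (M.nD_add_le _ _).trans ?_
    have := M.nD_solve_le (a x y)
    have e2 : 2 / (M.mu * M.lam ^ 2) * (a x y ⬝ᵥ a x y) =
      2 * ((a x y ⬝ᵥ a x y) / (M.mu * M.lam ^ 2)) := by ring
    rw [e2]; linarith
  refine (M.st_mono h1).trans ?_
  rw [M.st_add, M.st_mul, M.st_mul]
  -- `a` is centred, so subtracting its mean can only lower the second moment bounded by
  -- `st_diff_sq_le`.
  have h2 : M.st (fun x y => a x y ⬝ᵥ a x y) ≤ 4 * M.nD (M.val u) := by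
    have h3 : ∀ x y, a x y ⬝ᵥ a x y ≤ (M.val u x - M.val u y) ^ 2 -
        2 * (M.val (M.meanMat.mulVec u) x * (M.val u x - M.val u y)) +
        M.meanMat.mulVec u ⬝ᵥ M.meanMat.mulVec u := by
      intro x y
      have e : a x y ⬝ᵥ a x y = (M.val u x - M.val u y) ^ 2 * (M.Ψ x ⬝ᵥ M.Ψ x) -
          2 * (M.val (M.meanMat.mulVec u) x * (M.val u x - M.val u y)) +
          M.meanMat.mulVec u ⬝ᵥ M.meanMat.mulVec u := by
        simp only [a, sub_dotProduct, dotProduct_sub, smul_dotProduct, dotProduct_smul,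
          smul_eq_mul, dotProduct_comm (M.meanMat.mulVec u) (M.Ψ x)]
        simp only [val]; ring
      rw [e]
      have := mul_le_of_le_one_right (sq_nonneg (M.val u x - M.val u y)) (M.Ψ_le x)
      linarith
    refine (M.st_mono h3).trans ?_
    rw [M.st_add, M.st_sub, M.st_mul, st_val_mul, M.st_const]
    have := M.st_diff_sq_le (M.val u)
    have := dot_self_nonneg (M.meanMat.mulVec u)
    linarith
  have h4 := mul_le_mul_of_nonneg_left h2 (by positivity : 0 ≤ 2 / (M.mu * M.lam ^ 2))
  rw [noiseVar]
  refine add_le_add (h4.trans (le_of_eq (by ring))) le_rfl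

lemma gradErr_eq (hq : M.Tuned q) (m : ℕ) (u : (ℕ → X) → Fin d → ℝ) (ζ : ℕ → X) :
    M.gradErr q m u ζ = (1 / (q.N : ℝ)) • (∑ i ∈ Finset.range q.N,
      (M.gradTerm (u ζ) (ζ (m + offsetG q + i * (q.τ' + 2) + q.τ'))
        (ζ (m + offsetG q + i * (q.τ' + 2) + q.τ' + 1)) - M.meanMat.mulVec (u ζ))) +
      M.rhoErr q m ζ • ((1 / (q.N : ℝ)) • ∑ i ∈ Finset.range q.N,
        M.Ψ (ζ (m + offsetG q + i * (q.τ' + 2) + q.τ'))) := by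
  have hN := hq.N_pos
  rw [gradErr, gradEst, Finset.sum_add_distrib, Finset.sum_sub_distrib, Finset.sum_const,
    Finset.card_range, smul_add, smul_sub, ← Finset.smul_sum, smul_comm (M.rhoErr q m ζ)]
  have : (1 / (q.N : ℝ)) • q.N • M.meanMat.mulVec (u ζ) = M.meanMat.mulVec (u ζ) := by
    rw [← Nat.cast_smul_eq_nsmul ℝ, smul_smul, one_div, inv_mul_cancel₀ hN.ne', one_smul]
  rw [this]; abel

lemma avg_features_le (N : ℕ) (x : ℕ → X) :
    ((1 / (N : ℝ)) • ∑ i ∈ Finset.range N, M.Ψ (x i)) ⬝ᵥ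
      ((1 / (N : ℝ)) • ∑ i ∈ Finset.range N, M.Ψ (x i)) ≤ 1 := by
  rcases Nat.eq_zero_or_pos N with rfl | hN
  · simp
  have hN' : (0 : ℝ) < N := by exact_mod_cast hN
  have h : (∑ i ∈ Finset.range N, M.Ψ (x i)) ⬝ᵥ (∑ i ∈ Finset.range N, M.Ψ (x i)) ≤
      (N : ℝ) * N := by
    rw [sum_dotProduct]
    have h1 : ∀ i ∈ Finset.range N, M.Ψ (x i) ⬝ᵥ ∑ j ∈ Finset.range N, M.Ψ (x j) ≤ N := by
      intro i _
      rw [dotProduct_sum]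
      refine (Finset.sum_le_sum (g := fun _ => (1 : ℝ)) fun j _ => ?_).trans (by simp)
      have h2 := (le_abs_self _).trans (abs_dot_le (M.Ψ (x i)) (M.Ψ (x j)))
      have h3 : ∀ x, √(M.Ψ x ⬝ᵥ M.Ψ x) ≤ 1 := fun x => Real.sqrt_le_one.mpr (M.Ψ_le x)
      exact h2.trans (mul_le_one₀ (h3 _) (Real.sqrt_nonneg _) (h3 _))
    refine (Finset.sum_le_sum h1).trans (by simp)
  rw [smul_dotProduct, dotProduct_smul, smul_eq_mul, smul_eq_mul]
  calc _ ≤ 1 / (N : ℝ) * (1 / (N : ℝ) * ((N : ℝ) * N)) := by gcongr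
    _ = 1 := by field_simp

/-- The second moment of the reference estimate's error after the solution of the linear
system. -/
lemma Mixes.gradErr_sq_le (hM : M.Mixes p z L) (hq : M.Tuned q) {m : ℕ}
    (hL : m + offsetT q + q.τ' + 1 < L) {u : (ℕ → X) → Fin d → ℝ}
    (hu : DependsOn u (Set.Iio m)) :
    Ex p z (fun ζ => M.nD (M.val (M.solve (M.gradErr q m u ζ)))) ≤
      96 / 1160 * Ex p z (fun ζ => M.nD (M.val (u ζ))) + 24 * (M.noiseVar / q.N) +
        12 * M.cbar ^ 2 := by
  have hml : 0 < M.mu * M.lam ^ 2 := mul_pos M.mu_pos (pow_pos M.lam_pos 2)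
  have hN := hq.N_pos
  have hN' := hq.N'_pos
  let F : (ℕ → X) → Fin d → ℝ := fun ζ => ∑ i ∈ Finset.range q.N,
      (M.gradTerm (u ζ) (ζ (m + offsetG q + i * (q.τ' + 2) + q.τ'))
        (ζ (m + offsetG q + i * (q.τ' + 2) + q.τ' + 1)) - M.meanMat.mulVec (u ζ))
  have h1 : ∀ ζ, M.nD (M.val (M.solve (M.gradErr q m u ζ))) ≤
      2 * (1 / (q.N : ℝ)) ^ 2 * M.nD (M.val (M.solve (F ζ))) +
        2 / (M.mu * M.lam ^ 2) * M.rhoErr q m ζ ^ 2 := by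
    intro ζ
    rw [gradErr_eq hq, solve_add, val_add]
    refine (M.nD_add_le _ _).trans ?_
    rw [solve_smul, val_smul, nD_smul, solve_smul, val_smul, nD_smul]
    have h2 := (M.nD_solve_le ((1 / (q.N : ℝ)) • ∑ i ∈ Finset.range q.N,
        M.Ψ (ζ (m + offsetG q + i * (q.τ' + 2) + q.τ')))).trans
        (div_le_div_of_nonneg_right (avg_features_le q.N fun i =>
          ζ (m + offsetG q + i * (q.τ' + 2) + q.τ')) hml.le)
    have h3 := mul_le_mul_of_nonneg_left h2 (sq_nonneg (M.rhoErr q m ζ))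
    have e : 2 / (M.mu * M.lam ^ 2) * M.rhoErr q m ζ ^ 2 =
      2 * (M.rhoErr q m ζ ^ 2 * (1 / (M.mu * M.lam ^ 2))) := by ring
    rw [e]; linarith
  have h2 : Ex p z (fun ζ => M.nD (M.val (M.solve (F ζ)))) ≤ 6 * q.N *
      (8 / (M.mu * M.lam ^ 2) * Ex p z (fun ζ => M.nD (M.val (u ζ))) + 2 * M.noiseVar) := by
    -- For each pair x' the value of the solution is a linear functional of the summand, so the
    -- scalar `sum_sq_le` applies and the results are summed with the weights w.
    have h3 : ∀ x', Ex p z (fun ζ => M.val (M.solve (F ζ)) x' ^ 2) ≤ 6 * q.N * Ex p z (fun ζ =>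
        M.st fun x y =>
          M.val (M.solve (M.gradTerm (u ζ) x y - M.meanMat.mulVec (u ζ))) x' ^ 2) := by
      intro x'
      have h := hM.sum_sq_le (m := m + offsetG q) (t := q.τ') (b := q.τ' + 2) (N := q.N)
        hq.rate_le' (by simp only [offsetT] at hL; omega) hq.mix_le
        (f := fun ζ x y => M.val (M.solve (M.gradTerm (u ζ) x y - M.meanMat.mulVec (u ζ))) x')
        (fun x y ζ ζ' h => by
          have : u ζ = u ζ' := hu fun n hn => h n (by simp only [Set.mem_Iio] at hn ⊢; omega)
          simp only [this])
        (fun i ζ ζ' h => by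
          rw [add_mul] at h
          have : u ζ = u ζ' := hu fun n hn => h n (by simp only [Set.mem_Iio] at hn ⊢; omega)
          simp only [this]
          rw [h (m + offsetG q + i * (q.τ' + 2) + q.τ') (by simp only [Set.mem_Iio]; omega),
            h (m + offsetG q + i * (q.τ' + 2) + q.τ' + 1) (by simp only [Set.mem_Iio]; omega)])
        (fun ζ => by simp only [val_solve_eq]; exact st_dot_gradTerm _ _)
      refine le_trans (le_of_eq (congrArg _ (funext fun ζ => ?_))) h
      simp only [F, val_solve_eq, dotProduct_sum]
    have e1 : Ex p z (fun ζ => M.nD (M.val (M.solve (F ζ)))) =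
        ∑ x', M.w x' * Ex p z (fun ζ => M.val (M.solve (F ζ)) x' ^ 2) := by
      simp only [nD, Ex_sum, Ex_mul]
    rw [e1]
    refine (Finset.sum_le_sum fun x' _ =>
      mul_le_mul_of_nonneg_left (h3 x') (M.w_nonneg x')).trans ?_
    have e2 : ∑ x', M.w x' * (6 * q.N * Ex p z (fun ζ => M.st fun x y =>
          M.val (M.solve (M.gradTerm (u ζ) x y - M.meanMat.mulVec (u ζ))) x' ^ 2)) =
        6 * q.N * Ex p z (fun ζ => M.st fun x y =>
          M.nD (M.val (M.solve (M.gradTerm (u ζ) x y - M.meanMat.mulVec (u ζ))))) := by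
      simp only [nD, st_sum, st_mul, Ex_sum, Ex_mul, Finset.mul_sum]
      exact Finset.sum_congr rfl fun x _ => by ring
    rw [e2]
    refine mul_le_mul_of_nonneg_left ?_ (by positivity)
    rw [← Ex_mul, ← Ex_const hM.sum_eq (z := z) (2 * M.noiseVar), ← Ex_add]
    refine Ex_mono hM.nonneg fun ζ => (st_nD_solve_gradTerm_le (u ζ)).trans (le_of_eq (by ring))
  refine (Ex_mono hM.nonneg h1).trans ?_
  rw [Ex_add, Ex_mul, Ex_mul]
  have h3 := hM.rhoErr_sq_le hq (m := m) (by simp only [offsetT] at hL; omega)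
  have hV : 0 ≤ Ex p z (fun ζ => M.nD (M.val (u ζ))) := Ex_nonneg hM.nonneg fun ζ => M.nD_nonneg _
  set V := Ex p z (fun ζ => M.nD (M.val (u ζ)))
  -- 96 = 2·6·8 and 24 = 2·6·2: splitting off the cost error, the second moment of the sum, and the
  -- constants of `st_nD_solve_gradTerm_le`.
  have h4 : 2 * (1 / (q.N : ℝ)) ^ 2 * Ex p z (fun ζ => M.nD (M.val (M.solve (F ζ)))) ≤
      96 / 1160 * V + 24 * (M.noiseVar / q.N) := by
    refine (mul_le_mul_of_nonneg_left h2 (by positivity)).trans ?_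
    have e : 2 * (1 / (q.N : ℝ)) ^ 2 * (6 * q.N * (8 / (M.mu * M.lam ^ 2) * V + 2 * M.noiseVar)) =
        96 * V * (1 / (q.N * (M.mu * M.lam ^ 2))) + 24 * (M.noiseVar / q.N) := by
      field_simp; ring
    rw [e]
    have := one_div_le_one_div_of_le (by norm_num) hq.muN
    nlinarith
  have h5 : 2 / (M.mu * M.lam ^ 2) * Ex p z (fun ζ => M.rhoErr q m ζ ^ 2) ≤ 12 * M.cbar ^ 2 := by
    refine (mul_le_mul_of_nonneg_left h3 (by positivity)).trans ?_
    have e : 2 / (M.mu * M.lam ^ 2) * (6 * M.cbar ^ 2 / q.N') =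
        12 * M.cbar ^ 2 * (1 / (q.N' * (M.mu * M.lam ^ 2))) := by field_simp; ring
    rw [e]
    have := one_div_le_one_div_of_le (by norm_num) hq.muN'
    nlinarith [sq_nonneg M.cbar]
  linarith

end TDModel

/-! ### Bias of the reference estimate. -/

namespace TDModel

variable {I X : Type*} [Fintype I] [Fintype X] {d : ℕ}
variable {M : TDModel X d} {p : I → ℝ} {z : I → ℕ → X} {L : ℕ} {q : Params}

variable (M) in
/-- The squared distance of the solution to the differential value function. -/
def gap : ℝ := M.nD fun x => M.val M.θs x - M.Q x

lemma sqrt_dot_le (u : Fin d → ℝ) : √(u ⬝ᵥ u) ≤ √(M.nD (M.val u)) / √M.mu := by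
  rw [le_div_iff₀ (Real.sqrt_pos.mpr M.mu_pos), mul_comm]
  exact M.sqrt_mu_mul_le u

lemma Mixes.abs_rhoErr_mean_le (hM : M.Mixes p z L) (hq : M.Tuned q) {m : ℕ}
    (hL : m + offsetG q + q.τ' + 1 < L) :
    |Ex p z (M.rhoErr q m)| ≤ 4 / 3 * (M.CP * M.ϱ ^ q.τ') * (M.cbar / q.N') := by
  have := M.nonempty
  have h := hM.abs_sum_bias_le (m := m) (t := q.τ') (b := q.τ' + 1) (N := q.N') hq.rate_le
    (by simpa only [offsetG] using hL) (H := fun _ x _ => M.c x - M.rho)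
    (fun x y ζ ζ' _ => rfl) (fun _ => st_rho) (B := fun _ => M.cbar) (fun _ => M.cbar_nonneg)
    (fun ζ δ ε h0 hδ => by
      have e : ∑ x, δ x * ∑ y, M.P x y * (M.c x - M.rho) = ∑ x, δ x * M.c x := by
        simp only [← Finset.sum_mul, M.P_sum, one_mul, mul_sub, Finset.sum_sub_distrib, h0,
          zero_mul, sub_zero]
      rw [e]
      exact abs_sum_mul_le hδ M.c_le M.cbar_nonneg)
  rw [Ex_const hM.sum_eq] at h
  have e : Ex p z (M.rhoErr q m) = 1 / (q.N' : ℝ) * Ex p z (fun ζ =>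
      ∑ i ∈ Finset.range q.N', (M.c (ζ (m + i * (q.τ' + 1) + q.τ')) - M.rho)) := by
    rw [← Ex_mul]; rfl
  have hN' := hq.N'_pos
  rw [e, abs_mul, abs_of_pos (by positivity)]
  exact (mul_le_mul_of_nonneg_left h (by positivity)).trans (le_of_eq (by ring))

/-- The bias of the reference estimate. -/
lemma Mixes.abs_dot_gradErr_le (hM : M.Mixes p z L) (hq : M.Tuned q) {m : ℕ}
    (hL : m + offsetT q + q.τ' + 1 < L) {u : (ℕ → X) → Fin d → ℝ}
    (hu : DependsOn u (Set.Iio m)) (v : Fin d → ℝ) :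
    |v ⬝ᵥ ExV p z (M.gradErr q m u)| ≤ 4 / 3 * (M.CP * M.ϱ ^ q.τ') *
      ((M.K0 * √(Ex p z fun ζ => M.nD (M.val (u ζ))) + M.K0 * √M.gap + 2 * M.cbar) /
        (q.N * √M.mu) + M.cbar / q.N') * √(M.nD (M.val v)) := by
  have := M.nonempty
  have hN := hq.N_pos
  have hmu := Real.sqrt_pos.mpr M.mu_pos
  have hε : 0 ≤ M.CP * M.ϱ ^ q.τ' := mul_nonneg M.CP_nonneg (pow_nonneg M.ϱ_pos.le _)
  have hK := M.K0_nonneg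
  have hc := M.cbar_nonneg
  set n := √(M.nD (M.val v)) with hn
  set W := Ex p z fun ζ => M.nD (M.val (u ζ)) with hW
  set a := ∑ x, M.w x * M.val v x with ha
  have hvv : √(v ⬝ᵥ v) ≤ n / √M.mu := M.sqrt_dot_le v
  have ha' : |a| ≤ n := by
    refine Real.abs_le_sqrt ?_
    have h := Finset.sum_mul_sq_le_sq_mul_sq Finset.univ (fun x => √(M.w x))
      (fun x => √(M.w x) * M.val v x)
    have e1 : ∀ x, √(M.w x) * (√(M.w x) * M.val v x) = M.w x * M.val v x := fun x => by
      rw [← mul_assoc, Real.mul_self_sqrt (M.w_nonneg x)]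
    have e2 : ∀ x, (√(M.w x) * M.val v x) ^ 2 = M.w x * M.val v x ^ 2 := fun x => by
      rw [mul_pow, Real.sq_sqrt (M.w_nonneg x)]
    simp only [e1, e2, Real.sq_sqrt (M.w_nonneg _), M.w_sum, one_mul] at h
    exact h
  -- The perturbed mean has one residual from the current error u and one from Ψθ* - Q; the latter
  -- accounts for `gap`.
  have h1 := hM.abs_sum_bias_le (m := m + offsetG q) (t := q.τ') (b := q.τ' + 2) (N := q.N)
    hq.rate_le' (by simp only [offsetT] at hL; omega)
    (H := fun ζ x y => v ⬝ᵥ (M.gradTerm (u ζ) x y - M.meanMat.mulVec (u ζ)))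
    (fun x y ζ ζ' h => by
      have : u ζ = u ζ' := hu fun n hn => h n (by simp only [Set.mem_Iio] at hn ⊢; omega)
      simp only [this])
    (fun ζ => st_dot_gradTerm _ _)
    (B := fun ζ => M.K0 * n * √(u ζ ⬝ᵥ u ζ) + M.K0 * √(v ⬝ᵥ v) * √M.gap)
    (fun ζ => by positivity)
    (fun ζ δ ε h0 hδ => by
      have e : ∀ x, ∑ y, M.P x y * (v ⬝ᵥ (M.gradTerm (u ζ) x y - M.meanMat.mulVec (u ζ))) =
          M.val v x * M.res (M.val (u ζ)) x +
            M.val v x * M.res (fun x => M.val M.θs x - M.Q x) x -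
            v ⬝ᵥ M.meanMat.mulVec (u ζ) := by
        intro x
        have e2 : ∀ y, M.P x y * (v ⬝ᵥ (M.gradTerm (u ζ) x y - M.meanMat.mulVec (u ζ))) =
            M.val v x * (M.P x y * (M.val (u ζ) x - M.val (u ζ) y)) +
              M.P x y * (v ⬝ᵥ M.noise x y) - M.P x y * (v ⬝ᵥ M.meanMat.mulVec (u ζ)) := by
          intro y
          simp only [gradTerm, dotProduct_sub, dotProduct_add, dotProduct_smul, smul_eq_mul]
          rw [show v ⬝ᵥ M.Ψ x = M.val v x from dotProduct_comm _ _]; ring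
        simp only [e2]
        rw [Finset.sum_sub_distrib, Finset.sum_add_distrib, sum_P_dot_noise, ← Finset.sum_mul,
          M.P_sum, one_mul, ← Finset.mul_sum, ← res_eq]
      have e3 : ∑ x, δ x * ∑ y, M.P x y *
          (v ⬝ᵥ (M.gradTerm (u ζ) x y - M.meanMat.mulVec (u ζ))) =
          ∑ x, δ x * (M.val v x * M.res (M.val (u ζ)) x) +
          ∑ x, δ x * (M.val v x * M.res (fun x => M.val M.θs x - M.Q x) x) := by
        simp only [e, mul_sub, mul_add, Finset.sum_sub_distrib, Finset.sum_add_distrib,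
          ← Finset.sum_mul, h0, zero_mul, sub_zero]
      rw [e3, mul_add]
      refine (abs_add_le _ _).trans (add_le_add
        (abs_sum_mul_le hδ (M.abs_val_res_val_le v (u ζ)) (by positivity))
        (abs_sum_mul_le hδ (M.abs_val_res_le v _) (by positivity))))
  -- The cost error reads only pairs before `m + offsetG q`, so it is frozen by conditioning there.
  -- Subtracting the stationary mean `a` of the feature value centres the product; `a` times the
  -- mean cost error is treated separately.
  have h2 := hM.abs_sum_bias_le (m := m + offsetG q) (t := q.τ') (b := q.τ' + 2) (N := q.N)
    hq.rate_le' (by simp only [offsetT] at hL; omega)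
    (H := fun ζ x _ => M.rhoErr q m ζ * (M.val v x - a))
    (fun x y ζ ζ' h => by
      have : M.rhoErr q m ζ = M.rhoErr q m ζ' := dependsOn_rhoErr m h
      simp only [this])
    (fun ζ => by
      rw [M.st_mul, M.st_sub, M.st_const, M.st_left (M.val v), ← ha, sub_self, mul_zero])
    (B := fun ζ => 2 * M.cbar * √(v ⬝ᵥ v)) (fun ζ => by positivity)
    (fun ζ δ ε h0 hδ => by
      have e : ∑ x, δ x * ∑ y, M.P x y * (M.rhoErr q m ζ * (M.val v x - a)) =
          M.rhoErr q m ζ * ∑ x, δ x * M.val v x := by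
        have e2 : ∀ x, δ x * ∑ y, M.P x y * (M.rhoErr q m ζ * (M.val v x - a)) =
            M.rhoErr q m ζ * (δ x * M.val v x) - δ x * (M.rhoErr q m ζ * a) := fun x => by
          rw [← Finset.sum_mul, M.P_sum]; ring
        rw [Finset.sum_congr rfl fun x _ => e2 x, Finset.sum_sub_distrib, ← Finset.sum_mul, h0,
          zero_mul, sub_zero, ← Finset.mul_sum]
      rw [e, abs_mul]
      have h3 := abs_sum_mul_le hδ (M.abs_val_le v) (Real.sqrt_nonneg _)
      calc _ ≤ 2 * M.cbar * (ε * √(v ⬝ᵥ v)) :=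
            mul_le_mul (abs_rhoErr_le m ζ) h3 (abs_nonneg _) (by positivity)
        _ = _ := by ring)
  rw [Ex_const hM.sum_eq] at h2
  rw [Ex_add, Ex_const hM.sum_eq, Ex_mul] at h1
  have h3 := hM.abs_rhoErr_mean_le hq (m := m) (by simp only [offsetT] at hL; omega)
  have e : v ⬝ᵥ ExV p z (M.gradErr q m u) =
      1 / (q.N : ℝ) * Ex p z (fun ζ => ∑ i ∈ Finset.range q.N,
        v ⬝ᵥ (M.gradTerm (u ζ) (ζ (m + offsetG q + i * (q.τ' + 2) + q.τ'))
        (ζ (m + offsetG q + i * (q.τ' + 2) + q.τ' + 1)) - M.meanMat.mulVec (u ζ))) +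
      1 / (q.N : ℝ) * Ex p z (fun ζ => ∑ i ∈ Finset.range q.N, M.rhoErr q m ζ *
        (M.val v (ζ (m + offsetG q + i * (q.τ' + 2) + q.τ')) - a)) +
      a * Ex p z (M.rhoErr q m) := by
    rw [dot_ExV, ← Ex_mul, ← Ex_mul, ← Ex_mul, ← Ex_add, ← Ex_add]
    refine congrArg _ (funext fun ζ => ?_)
    have e4 : ∀ i, M.rhoErr q m ζ * (M.val v (ζ (m + offsetG q + i * (q.τ' + 2) + q.τ')) - a) =
        M.rhoErr q m ζ * (v ⬝ᵥ M.Ψ (ζ (m + offsetG q + i * (q.τ' + 2) + q.τ'))) -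
          M.rhoErr q m ζ * a := fun i => by
      rw [dotProduct_comm v, mul_sub]; rfl
    simp only [e4, Finset.sum_sub_distrib, Finset.sum_const, Finset.card_range, nsmul_eq_mul]
    rw [gradErr_eq hq, dotProduct_add, dotProduct_smul, dotProduct_smul, dotProduct_smul,
      dotProduct_sum, dotProduct_sum, ← Finset.mul_sum]
    simp only [smul_eq_mul]
    field_simp
    ring
  have hW1 : Ex p z (fun ζ => √(u ζ ⬝ᵥ u ζ)) ≤ √W / √M.mu := by
    have h4 : Ex p z (fun ζ => √(u ζ ⬝ᵥ u ζ)) ≤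
        Ex p z (fun ζ => (1 / √M.mu) * √(M.nD (M.val (u ζ)))) :=
      Ex_mono hM.nonneg fun ζ => (M.sqrt_dot_le (u ζ)).trans (le_of_eq (by ring))
    rw [Ex_mul] at h4
    refine h4.trans ?_
    rw [div_eq_mul_one_div √W, mul_comm]
    exact mul_le_mul_of_nonneg_right (Ex_sqrt_le hM.nonneg hM.sum_eq fun ζ => M.nD_nonneg _)
      (by positivity)
  rw [e]
  refine (abs_add_three _ _ _).trans ?_
  rw [abs_mul, abs_mul, abs_mul, abs_of_pos (by positivity : 0 < 1 / (q.N : ℝ))]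
  have g1 : 1 / (q.N : ℝ) * (4 / 3 * (M.CP * M.ϱ ^ q.τ') *
      (M.K0 * n * Ex p z (fun ζ => √(u ζ ⬝ᵥ u ζ)) + M.K0 * √(v ⬝ᵥ v) * √M.gap)) ≤
      1 / (q.N : ℝ) * (4 / 3 * (M.CP * M.ϱ ^ q.τ') *
      (M.K0 * n * (√W / √M.mu) + M.K0 * (n / √M.mu) * √M.gap)) := by
    have : 0 ≤ n := Real.sqrt_nonneg _
    gcongr
  have g2 : 1 / (q.N : ℝ) * (4 / 3 * (M.CP * M.ϱ ^ q.τ') * (2 * M.cbar * √(v ⬝ᵥ v))) ≤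
      1 / (q.N : ℝ) * (4 / 3 * (M.CP * M.ϱ ^ q.τ') * (2 * M.cbar * (n / √M.mu))) := by
    gcongr
  have g3 : |a| * |Ex p z (M.rhoErr q m)| ≤
      n * (4 / 3 * (M.CP * M.ϱ ^ q.τ') * (M.cbar / q.N')) :=
    mul_le_mul ha' h3 (abs_nonneg _) (Real.sqrt_nonneg _)
  have k1 := (mul_le_mul_of_nonneg_left h1 (by positivity : 0 ≤ 1 / (q.N : ℝ))).trans g1
  have k2 := (mul_le_mul_of_nonneg_left h2 (by positivity : 0 ≤ 1 / (q.N : ℝ))).trans g2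
  refine (add_le_add (add_le_add k1 k2) g3).trans (le_of_eq ?_)
  field_simp

end TDModel

/-! ### One epoch. -/

namespace TDModel

variable {I X : Type*} [Fintype I] [Fintype X] {d : ℕ}
variable {M : TDModel X d} {p : I → ℝ} {z : I → ℕ → X} {L : ℕ} {q : Params}

/-- The number `W` bounds the noise quantities of the model like `W₁` does. -/
structure NoiseBound (M : TDModel X d) (W : ℝ) : Prop where
  -- W₁ contains 22 times the trace, and `noiseVar` is compared with twice the trace; hence W / 11.
  noiseVar_le : M.noiseVar ≤ W / 11 + 2 * M.cbar ^ 2 / (M.mu * M.lam ^ 2)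
  gap_le : 4 / (M.mu * M.lam ^ 2) * M.gap ≤ W

lemma gap_nonneg (M : TDModel X d) : 0 ≤ M.gap := M.nD_nonneg _

lemma NoiseBound.nonneg {W : ℝ} (h : M.NoiseBound W) : 0 ≤ W :=
  (mul_nonneg (div_nonneg (by norm_num) (mul_pos M.mu_pos (pow_pos M.lam_pos 2)).le)
    M.gap_nonneg).trans h.gap_le

lemma Mixes.inner_idx_lt {m t : ℕ} (hL : m + epochLength q + q.τ' + 1 < L) (ht : t < q.T) :
    m + offsetT q + t * (q.τ + 2) + q.τ + 1 < L := by
  have : (t + 1) * (q.τ + 2) ≤ q.T * (q.τ + 2) := Nat.mul_le_mul_right _ ht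
  rw [add_mul] at this
  unfold epochLength at hL
  omega

lemma innerErr_succ (m : ℕ) (u : (ℕ → X) → Fin d → ℝ) (t : ℕ) (ζ : ℕ → X) :
    M.innerErr q m u (t + 1) ζ = M.innerErr q m u t ζ -
      q.η • (((M.Ψ (ζ (m + offsetT q + t * (q.τ + 2) + q.τ)) -
      M.Ψ (ζ (m + offsetT q + t * (q.τ + 2) + q.τ + 1))) ⬝ᵥ (M.innerErr q m u t ζ - u ζ)) •
      M.Ψ (ζ (m + offsetT q + t * (q.τ + 2) + q.τ)) + M.gradEst q m u ζ) := rfl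

/-- The mean square error of the inner iterates of an epoch. -/
lemma Mixes.avg_sq_le (hM : M.Mixes p z L) (hq : M.Tuned q) {m : ℕ}
    (hL : m + epochLength q + q.τ' + 1 < L) {u : (ℕ → X) → Fin d → ℝ}
    (hu : DependsOn u (Set.Iio m)) {W : ℝ} (hW : M.NoiseBound W) :
    1 / (q.T : ℝ) * ∑ t ∈ Finset.range q.T,
      Ex p z (fun ζ => M.nD (M.val (M.innerErr q m u t ζ))) ≤
      2 / 5 * Ex p z (fun ζ => M.nD (M.val (u ζ))) + 5 * (W / q.N) + 28 * M.cbar ^ 2 := by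
  have hT := hq.T_pos
  have hN := hq.N_pos
  have hml : 0 < M.mu * M.lam ^ 2 := mul_pos M.mu_pos (pow_pos M.lam_pos 2)
  have hηl : 0 < q.η * M.lam := mul_pos hq.η_pos M.lam_pos
  -- The fixed point of the averaged inner recursion: by `hAs` the reference estimate is exactly A(u
  -- - s), as `step_sq_le` requires of the iterates centred at s.
  let s : (ℕ → X) → Fin d → ℝ := fun ζ => -M.solve (M.gradErr q m u ζ)
  have hs : DependsOn s (Set.Iio (m + offsetT q)) := fun ζ ζ' h => by
    have h0 : u ζ = u ζ' := hu fun n hn => h n (by simp only [Set.mem_Iio] at hn ⊢; omega)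
    have h2 : M.gradEst q m u ζ = M.gradEst q m u ζ' := dependsOn_gradEst hu h
    simp only [s, gradErr, h0, h2]
  have hns : ∀ ζ, M.nD (M.val (s ζ)) = M.nD (M.val (M.solve (M.gradErr q m u ζ))) := fun ζ => by
    simp only [s]; rw [← neg_one_smul ℝ, val_smul, nD_smul]; ring
  have hAs : ∀ ζ, M.meanMat.mulVec (u ζ - s ζ) = M.gradEst q m u ζ := fun ζ => by
    simp only [s]
    rw [sub_neg_eq_add, Matrix.mulVec_add, mean_solve, gradErr]; abel
  set V := Ex p z (fun ζ => M.nD (M.val (u ζ))) with hV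
  set S := Ex p z (fun ζ => M.nD (M.val (s ζ))) with hS
  set G := Ex p z (fun ζ => M.nD (M.val (u ζ - s ζ))) with hG
  have hG0 : 0 ≤ G := Ex_nonneg hM.nonneg fun ζ => M.nD_nonneg _
  have hV0 : 0 ≤ V := Ex_nonneg hM.nonneg fun ζ => M.nD_nonneg _
  have hGV : G ≤ 2 * V + 2 * S := by
    rw [hG, hV, hS, ← Ex_mul, ← Ex_mul, ← Ex_add]
    exact Ex_mono hM.nonneg fun ζ => by rw [val_sub]; exact M.nD_sub_le _ _
  have hstep : ∀ t < q.T, Ex p z (fun ζ => (M.innerErr q m u (t + 1) ζ - s ζ) ⬝ᵥ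
      (M.innerErr q m u (t + 1) ζ - s ζ)) ≤ Ex p z (fun ζ => (M.innerErr q m u t ζ - s ζ) ⬝ᵥ
      (M.innerErr q m u t ζ - s ζ)) - q.η * M.lam *
      Ex p z (fun ζ => M.nD (M.val (M.innerErr q m u t ζ - s ζ))) +
      q.η * M.lam / 28 * G := by
    intro t ht
    have h := hM.step_sq_le (m := m + offsetT q + t * (q.τ + 2)) (inner_idx_lt hL ht) hq.η_pos
      hq.η_le hq.τ_le (y := fun ζ => M.innerErr q m u t ζ - s ζ) (g := fun ζ => u ζ - s ζ)
      (fun ζ ζ' h => by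
        have h1 : M.innerErr q m u t ζ = M.innerErr q m u t ζ' := dependsOn_innerErr hu t h
        have h2 : s ζ = s ζ' := hs fun n hn => h n (by simp only [Set.mem_Iio] at hn ⊢; omega)
        simp only [h1, h2])
      (fun ζ ζ' h => by
        have h1 : u ζ = u ζ' := hu fun n hn => h n (by simp only [Set.mem_Iio] at hn ⊢; omega)
        have h2 : s ζ = s ζ' := hs fun n hn => h n (by simp only [Set.mem_Iio] at hn ⊢; omega)
        simp only [h1, h2])
    simp only [hAs, sub_sub_sub_cancel_right] at h
    refine le_trans (le_of_eq (congrArg _ (funext fun ζ => ?_))) h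
    rw [innerErr_succ, sub_right_comm]
  have hsum := sum_le_of_descent
    (a := fun t => Ex p z (fun ζ => (M.innerErr q m u t ζ - s ζ) ⬝ᵥ
      (M.innerErr q m u t ζ - s ζ)))
    (b := fun t => Ex p z (fun ζ => M.nD (M.val (M.innerErr q m u t ζ - s ζ))))
    (e := fun _ => q.η * M.lam / 28 * G) (r := q.η * M.lam)
    (fun t => Ex_nonneg hM.nonneg fun ζ => dot_self_nonneg _) q.T hstep
  simp only [Finset.sum_const, Finset.card_range, nsmul_eq_mul, innerErr] at hsum
  -- The initial Euclidean distance costs 1/μ, which T ≥ 64/(μλη) repays.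
  have h0 : Ex p z (fun ζ => (u ζ - s ζ) ⬝ᵥ (u ζ - s ζ)) ≤ q.T * (q.η * M.lam) / 64 * G := by
    have h1 : M.mu * Ex p z (fun ζ => (u ζ - s ζ) ⬝ᵥ (u ζ - s ζ)) ≤ G := by
      rw [← Ex_mul]; exact Ex_mono hM.nonneg fun ζ => M.mu_le' _
    refine le_of_mul_le_mul_left (h1.trans ?_) M.mu_pos
    have := hq.muT
    nlinarith
  set B := ∑ t ∈ Finset.range q.T,
    Ex p z (fun ζ => M.nD (M.val (M.innerErr q m u t ζ - s ζ))) with hB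
  -- 23/448 = 1/64 + 1/28.
  have hB1 : B ≤ q.T * (23 / 448 * G) := by
    refine le_of_mul_le_mul_left ((hsum.trans (add_le_add_left h0 _)).trans (le_of_eq ?_)) hηl
    ring
  have hZ : ∑ t ∈ Finset.range q.T, Ex p z (fun ζ => M.nD (M.val (M.innerErr q m u t ζ))) ≤
      2 * B + q.T * (2 * S) := by
    have e : (q.T : ℝ) * (2 * S) = ∑ _t ∈ Finset.range q.T, 2 * S := by simp
    rw [e, hB, Finset.mul_sum, ← Finset.sum_add_distrib]
    refine Finset.sum_le_sum fun t _ => ?_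
    rw [hS, ← Ex_mul, ← Ex_mul, ← Ex_add]
    refine Ex_mono hM.nonneg fun ζ => ?_
    have h := M.nD_add_le (M.val (M.innerErr q m u t ζ - s ζ)) (M.val (s ζ))
    rwa [← val_add, sub_add_cancel] at h
  have hS1 := hM.gradErr_sq_le hq (m := m) (by unfold epochLength at hL; omega) hu
  simp only [← hns] at hS1
  rw [← hS, ← hV] at hS1
  have hnv : M.noiseVar / q.N ≤ (W / q.N) / 11 + 2 * M.cbar ^ 2 / 1160 := by
    have h1 := div_le_div_of_nonneg_right hW.noiseVar_le hN.le
    refine h1.trans ?_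
    have e : (W / 11 + 2 * M.cbar ^ 2 / (M.mu * M.lam ^ 2)) / q.N =
        (W / q.N) / 11 + 2 * M.cbar ^ 2 / (q.N * (M.mu * M.lam ^ 2)) := by field_simp
    rw [e]
    have := div_le_div_of_nonneg_left (by positivity : 0 ≤ 2 * M.cbar ^ 2) (by norm_num) hq.muN
    linarith
  have hWN : 0 ≤ W / q.N := div_nonneg hW.nonneg hN.le
  -- Inserting G ≤ 2V + 2S and the bounds for S and the noise gives coefficients below 0.39, 4.82
  -- and 26.6.
  have hfin : ∑ t ∈ Finset.range q.T, Ex p z (fun ζ => M.nD (M.val (M.innerErr q m u t ζ))) ≤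
      q.T * (2 / 5 * V + 5 * (W / q.N) + 28 * M.cbar ^ 2) := by
    refine (hZ.trans (add_le_add_left (mul_le_mul_of_nonneg_left hB1 zero_le_two) _)).trans ?_
    have e : 2 * (q.T * (23 / 448 * G)) + q.T * (2 * S) = q.T * (23 / 224 * G + 2 * S) := by ring
    rw [e]
    refine mul_le_mul_of_nonneg_left ?_ hT.le
    have := sq_nonneg M.cbar
    linarith
  refine (mul_le_mul_of_nonneg_left hfin (by positivity)).trans (le_of_eq ?_)
  field_simp

lemma sq_add_four_le (a b c e : ℝ) :
    (a + b + c + e) ^ 2 ≤ 4 * (a ^ 2 + b ^ 2 + c ^ 2 + e ^ 2) := by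
  linarith [sq_nonneg (a - b), sq_nonneg (a - c), sq_nonneg (a - e), sq_nonneg (b - c),
    sq_nonneg (b - e), sq_nonneg (c - e)]

/-- The size of the bias of the reference estimate. -/
lemma bias_const_le (hq : M.Tuned q) {W C G V : ℝ} (hW : M.NoiseBound W)
    (hC1 : M.CP ≤ C) (hC2 : M.CP * M.K0 ≤ C) (hV0 : 0 ≤ V) (hG : V ≤ 60 * G)
    (hWG : W / q.N ≤ G) (hcG : M.cbar ^ 2 ≤ G) :
    (4 / 3 * (M.CP * M.ϱ ^ q.τ') * ((M.K0 * √V + M.K0 * √M.gap + 2 * M.cbar) /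
        (q.N * √M.mu) + M.cbar / q.N')) ^ 2 ≤
      M.lam ^ 2 * (32 * (C * M.ϱ ^ q.τ') ^ 2 * G) := by
  have := M.nonempty
  have hN := hq.N_pos
  have hN' := hq.N'_pos
  have hl := M.lam_pos
  have hmu := M.mu_pos
  have hsmu := Real.sqrt_pos.mpr M.mu_pos
  have hc := M.cbar_nonneg
  have hϱ : 0 ≤ M.ϱ ^ q.τ' := pow_nonneg M.ϱ_pos.le _
  have hK := M.K0_nonneg
  have hCP := M.CP_nonneg
  have hC0 : 0 ≤ C := hCP.trans hC1
  have hN1 : (1 : ℝ) ≤ q.N := by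
    have : 0 < q.N := by exact_mod_cast hN
    exact_mod_cast this
  set R := C * M.ϱ ^ q.τ' with hR
  have hR0 : 0 ≤ R := mul_nonneg hC0 hϱ
  set a := √V / (q.N * √M.mu) with ha
  set b := √M.gap / (q.N * √M.mu) with hb
  set c := M.cbar / (q.N * √M.mu) with hcc
  set e := M.cbar / q.N' with he
  have ha0 : 0 ≤ a := by positivity
  have hb0 : 0 ≤ b := by positivity
  have hc0 : 0 ≤ c := by positivity
  have he0 : 0 ≤ e := by positivity
  have h1 : 4 / 3 * (M.CP * M.ϱ ^ q.τ') * ((M.K0 * √V + M.K0 * √M.gap + 2 * M.cbar) /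
        (q.N * √M.mu) + M.cbar / q.N') ≤ 4 / 3 * (R * (a + b + 2 * c + e)) := by
    have e1 : 4 / 3 * (M.CP * M.ϱ ^ q.τ') * ((M.K0 * √V + M.K0 * √M.gap + 2 * M.cbar) /
        (q.N * √M.mu) + M.cbar / q.N') = 4 / 3 * ((M.CP * M.K0 * M.ϱ ^ q.τ') * (a + b) +
          (M.CP * M.ϱ ^ q.τ') * (2 * c + e)) := by
      rw [ha, hb, hcc, he]; ring
    have h2 : M.CP * M.K0 * M.ϱ ^ q.τ' ≤ R := mul_le_mul_of_nonneg_right hC2 hϱ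
    have h3 : M.CP * M.ϱ ^ q.τ' ≤ R := mul_le_mul_of_nonneg_right hC1 hϱ
    rw [e1]
    have h4 := mul_le_mul_of_nonneg_right h2 (add_nonneg ha0 hb0)
    have h5 := mul_le_mul_of_nonneg_right h3 (by positivity : 0 ≤ 2 * c + e)
    linarith
  -- One of the two factors N is spent on N μ λ² ≥ 1160, the other is only bounded below by 1.
  have hx : 1 / ((q.N : ℝ) ^ 2 * M.mu) ≤ M.lam ^ 2 * (1 / 1160) := by
    rw [div_le_iff₀ (by positivity)]
    have h2 := mul_le_mul hN1 hq.muN (by norm_num) hN.le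
    linarith
  have hsq : ∀ y : ℝ, 0 ≤ y → (√y / (q.N * √M.mu)) ^ 2 = y * (1 / ((q.N : ℝ) ^ 2 * M.mu)) := by
    intro y hy
    rw [div_pow, mul_pow, Real.sq_sqrt hy, Real.sq_sqrt hmu.le]; ring
  have hG0 : 0 ≤ G := (sq_nonneg _).trans hcG
  have qa : a ^ 2 ≤ M.lam ^ 2 * (60 / 1160 * G) := by
    rw [ha, hsq V hV0]
    calc _ ≤ V * (M.lam ^ 2 * (1 / 1160)) := mul_le_mul_of_nonneg_left hx hV0
      _ ≤ 60 * G * (M.lam ^ 2 * (1 / 1160)) := mul_le_mul_of_nonneg_right hG (by positivity)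
      _ = _ := by ring
  have qb : b ^ 2 ≤ M.lam ^ 2 * (1 / 4 * G) := by
    rw [hb, hsq _ M.gap_nonneg]
    have h2 : M.gap ≤ W / 4 * (M.mu * M.lam ^ 2) := by
      have := hW.gap_le
      rw [div_mul_eq_mul_div, div_le_iff₀ (by positivity)] at this
      linarith
    have h3 : W ≤ G * q.N := (div_le_iff₀ hN).mp hWG
    rw [mul_one_div, div_le_iff₀ (by positivity)]
    have h4 : G * q.N ≤ G * q.N ^ 2 := mul_le_mul_of_nonneg_left (le_self_pow₀ hN1 two_ne_zero) hG0
    have h5 := mul_le_mul_of_nonneg_right (h3.trans h4) (by positivity : 0 ≤ M.mu * M.lam ^ 2)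
    linarith
  have qc : c ^ 2 ≤ M.lam ^ 2 * (1 / 1160 * G) := by
    have e1 : c = √(M.cbar ^ 2) / (q.N * √M.mu) := by rw [Real.sqrt_sq hc]
    rw [e1, hsq _ (sq_nonneg _)]
    calc _ ≤ M.cbar ^ 2 * (M.lam ^ 2 * (1 / 1160)) :=
          mul_le_mul_of_nonneg_left hx (sq_nonneg _)
      _ ≤ G * (M.lam ^ 2 * (1 / 1160)) := mul_le_mul_of_nonneg_right hcG (by positivity)
      _ = _ := by ring
  -- μ ≤ 1 and λ ≤ 2 turn N'μλ² ≥ 1 into 1/N' ≤ 2λ.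
  have qe : e ^ 2 ≤ M.lam ^ 2 * (4 * G) := by
    have h2 : 1 ≤ 2 * (q.N' * M.lam) := by
      have h3 := hq.muN'
      have h4 : (q.N' : ℝ) * (M.mu * M.lam ^ 2) ≤ q.N' * (1 * (2 * M.lam)) := by
        refine mul_le_mul_of_nonneg_left ?_ hN'.le
        refine mul_le_mul M.mu_le_one ?_ (by positivity) (by norm_num)
        nlinarith [M.lam_le_two]
      linarith
    rw [he, div_pow, div_le_iff₀ (by positivity)]
    have h3 : 1 * 1 ≤ 2 * (q.N' * M.lam) * (2 * (q.N' * M.lam)) :=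
      mul_le_mul h2 h2 zero_le_one (zero_le_one.trans h2)
    have h4 := mul_le_mul_of_nonneg_left h3 hG0
    linarith
  have hsum := sq_add_four_le a b (2 * c) e
  have hlG : 0 ≤ M.lam ^ 2 * G := by positivity
  -- 4(60/1160 + 1/4 + 4/1160 + 4) < 18, and (16/9)·18 = 32.
  have hsum2 : (a + b + 2 * c + e) ^ 2 ≤ 18 * (M.lam ^ 2 * G) := by linarith
  calc _ ≤ (4 / 3 * (R * (a + b + 2 * c + e))) ^ 2 := pow_le_pow_left₀ (by positivity) h1 2
    _ = 16 / 9 * R ^ 2 * (a + b + 2 * c + e) ^ 2 := by ring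
    _ ≤ 16 / 9 * R ^ 2 * (18 * (M.lam ^ 2 * G)) := by gcongr
    _ = _ := by ring

/-- The squared error of the mean output of an epoch. -/
lemma Mixes.mean_le (hM : M.Mixes p z L) (hq : M.Tuned q) {m : ℕ}
    (hL : m + epochLength q + q.τ' + 1 < L) {u : (ℕ → X) → Fin d → ℝ}
    (hu : DependsOn u (Set.Iio m)) {W C G : ℝ} (hW : M.NoiseBound W)
    (hC1 : M.CP ≤ C) (hC2 : M.CP * M.K0 ≤ C)
    (hG : Ex p z (fun ζ => M.nD (M.val (u ζ))) ≤ 60 * G)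
    (hWG : W / q.N ≤ G) (hcG : M.cbar ^ 2 ≤ G) :
    M.nD (M.val (ExV p z fun ζ => (1 / (q.T : ℝ)) • ∑ t ∈ Finset.range q.T,
      M.innerErr q m u t ζ)) ≤
      1 / 64 * M.nD (M.val (ExV p z u)) +
      (200 * (C * M.ϱ ^ q.τ') ^ 2 + 2 * (C * M.ϱ ^ q.τ / (M.lam * √M.mu))) * G := by
  have := M.nonempty
  have hT := hq.T_pos
  have hη := hq.η_pos
  have hl := M.lam_pos
  have hsmu := Real.sqrt_pos.mpr M.mu_pos
  have hmu := M.mu_pos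
  have hϱ : 0 ≤ M.ϱ ^ q.τ := pow_nonneg M.ϱ_pos.le _
  have hG0 : 0 ≤ G := (sq_nonneg _).trans hcG
  set V := Ex p z (fun ζ => M.nD (M.val (u ζ))) with hV
  have hV0 : 0 ≤ V := Ex_nonneg hM.nonneg fun ζ => M.nD_nonneg _
  set kh := 4 / 3 * (M.CP * M.ϱ ^ q.τ') * ((M.K0 * √V + M.K0 * √M.gap + 2 * M.cbar) /
        (q.N * √M.mu) + M.cbar / q.N') with hkh
  have hkh0 : 0 ≤ kh := by
    have h1 := M.CP_nonneg
    have h2 := M.K0_nonneg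
    have h3 := M.cbar_nonneg
    have h4 : 0 ≤ M.ϱ ^ q.τ' := pow_nonneg M.ϱ_pos.le _
    positivity
  have hkh2 : kh ^ 2 ≤ M.lam ^ 2 * (32 * (C * M.ϱ ^ q.τ') ^ 2 * G) :=
    bias_const_le hq hW hC1 hC2 hV0 hG hWG hcG
  set g := M.CP * M.K0 * M.ϱ ^ q.τ with hg
  have hg0 : 0 ≤ g := mul_nonneg (mul_nonneg M.CP_nonneg M.K0_nonneg) hϱ
  let Y : ℕ → Fin d → ℝ := fun t => ExV p z (M.innerErr q m u t)
  let D : ℕ → ℝ := fun t => Ex p z (fun ζ => √((M.innerErr q m u t ζ - u ζ) ⬝ᵥ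
    (M.innerErr q m u t ζ - u ζ)))
  let Z : ℕ → ℝ := fun t => Ex p z (fun ζ => M.nD (M.val (M.innerErr q m u t ζ)))
  have hD0 : ∀ t, 0 ≤ D t := fun t => Ex_nonneg hM.nonneg fun ζ => Real.sqrt_nonneg _
  -- Jensen's inequality: the step bias is proportional to a mean Euclidean distance, which the mean
  -- square errors control.
  have hD : ∀ t, M.mu * D t ^ 2 ≤ 2 * Z t + 2 * V := by
    intro t
    have h1 : D t ^ 2 ≤ Ex p z (fun ζ => (M.innerErr q m u t ζ - u ζ) ⬝ᵥ
        (M.innerErr q m u t ζ - u ζ)) :=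
      (Ex_sq_le hM.nonneg hM.sum_eq _).trans (Ex_mono hM.nonneg fun ζ =>
        (Real.sq_sqrt (dot_self_nonneg _)).le)
    refine (mul_le_mul_of_nonneg_left h1 hmu.le).trans ?_
    simp only [Z, hV]
    rw [← Ex_mul, ← Ex_mul, ← Ex_mul, ← Ex_add]
    refine Ex_mono hM.nonneg fun ζ => (M.mu_le' _).trans ?_
    rw [val_sub]; exact M.nD_sub_le _ _
  have hstep : ∀ t < q.T, Y (t + 1) ⬝ᵥ Y (t + 1) ≤ Y t ⬝ᵥ Y t -
      q.η * M.lam * M.nD (M.val (Y t)) + 3 * q.η * (kh + g * D t) ^ 2 / M.lam := by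
    intro t ht
    let b := ExV p z (fun ζ => ((M.Ψ (ζ (m + offsetT q + t * (q.τ + 2) + q.τ)) -
      M.Ψ (ζ (m + offsetT q + t * (q.τ + 2) + q.τ + 1))) ⬝ᵥ (M.innerErr q m u t ζ - u ζ)) •
      M.Ψ (ζ (m + offsetT q + t * (q.τ + 2) + q.τ))) -
      M.meanMat.mulVec (ExV p z fun ζ => M.innerErr q m u t ζ - u ζ)
    -- The means of A(iterate - u) and of Au add up to A applied to the mean iterate; only the step
    -- bias and the mean of `gradErr` remain.
    have e : Y (t + 1) = Y t - q.η • (M.meanMat.mulVec (Y t) +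
        (b + ExV p z (M.gradErr q m u))) := by
      have e1 : M.meanMat.mulVec (ExV p z u) = ExV p z (fun ζ => M.meanMat.mulVec (u ζ)) := by
        ext k
        exact dot_ExV (M.meanMat k) u
      have e2 : ExV p z (M.gradErr q m u) =
          ExV p z (M.gradEst q m u) - M.meanMat.mulVec (ExV p z u) := by
        rw [e1, ← ExV_sub]; rfl
      have e3 : M.meanMat.mulVec (ExV p z fun ζ => M.innerErr q m u t ζ - u ζ) =
          M.meanMat.mulVec (Y t) - M.meanMat.mulVec (ExV p z u) := by
        rw [ExV_sub, Matrix.mulVec_sub]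
      have e4 : Y (t + 1) = Y t - q.η • (ExV p z (fun ζ =>
          ((M.Ψ (ζ (m + offsetT q + t * (q.τ + 2) + q.τ)) -
          M.Ψ (ζ (m + offsetT q + t * (q.τ + 2) + q.τ + 1))) ⬝ᵥ (M.innerErr q m u t ζ - u ζ)) •
          M.Ψ (ζ (m + offsetT q + t * (q.τ + 2) + q.τ))) + ExV p z (M.gradEst q m u)) := by
        rw [← ExV_add, ← ExV_smul, ← ExV_sub]
        rfl
      rw [e4, e2]
      simp only [b, e3]
      congr 2
      abel
    rw [e]
    refine mean_step_le hη hq.η_le (Y t) _ (add_nonneg hkh0 (mul_nonneg hg0 (hD0 t))) fun v => ?_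
    have h1 := hM.abs_dot_step_bias_le (m := m + offsetT q + t * (q.τ + 2)) (inner_idx_lt hL ht)
      (u := fun ζ => M.innerErr q m u t ζ - u ζ)
      (fun ζ ζ' h => by
        have h1 : M.innerErr q m u t ζ = M.innerErr q m u t ζ' := dependsOn_innerErr hu t h
        have h2 : u ζ = u ζ' := hu fun n hn => h n (by simp only [Set.mem_Iio] at hn ⊢; omega)
        simp only [h1, h2]) v
    have h2 := hM.abs_dot_gradErr_le hq (m := m) (by unfold epochLength at hL; omega) hu v
    rw [dotProduct_add]
    refine (abs_add_le _ _).trans ((add_le_add h1 h2).trans (le_of_eq ?_))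
    simp only [D, hg, hkh]
    ring
  have hsum := sum_le_of_descent (a := fun t => Y t ⬝ᵥ Y t) (b := fun t => M.nD (M.val (Y t)))
    (e := fun t => 3 * q.η * (kh + g * D t) ^ 2 / M.lam) (r := q.η * M.lam)
    (fun t => dot_self_nonneg _) q.T hstep
  have hY0 : Y 0 ⬝ᵥ Y 0 ≤ q.T * (q.η * M.lam) / 64 * M.nD (M.val (Y 0)) := by
    refine le_of_mul_le_mul_left ((M.mu_le' _).trans ?_) hmu
    have := hq.muT
    nlinarith [M.nD_nonneg (M.val (Y 0))]
  -- 57 = (2/5)·60 + 5 + 28.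
  have hZ : ∑ t ∈ Finset.range q.T, Z t ≤ q.T * (57 * G) := by
    have h := hM.avg_sq_le hq hL hu hW
    rw [one_div, inv_mul_le_iff₀ hT] at h
    refine h.trans (mul_le_mul_of_nonneg_left ?_ hT.le)
    linarith
  -- One factor g is spent on the conditions on τ and η, the other is kept: this is why ϱ^τ appears
  -- to the first power and over (1 - β)√μ.
  have hgg : g ^ 2 ≤ M.mu * (g * M.lam / (845 * √M.mu)) := by
    have h1 : g ≤ √M.mu * (M.lam / 845) :=
      hq.τ_le.trans (mul_le_mul_of_nonneg_left hq.η_le hsmu.le)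
    have e1 : M.mu * (g * M.lam / (845 * √M.mu)) = g * (√M.mu * (M.lam / 845)) := by
      calc _ = (√M.mu * √M.mu) * (g * M.lam / (845 * √M.mu)) := by rw [Real.mul_self_sqrt hmu.le]
        _ = _ := by field_simp
    rw [e1, sq]
    exact mul_le_mul_of_nonneg_left h1 hg0
  have he : ∀ t, 3 * q.η * (kh + g * D t) ^ 2 / M.lam ≤ q.η * M.lam *
      (6 * (32 * (C * M.ϱ ^ q.τ') ^ 2 * G) +
        12 / 845 * (g / (M.lam * √M.mu)) * (Z t + V)) := by
    intro t
    have h1 : (kh + g * D t) ^ 2 ≤ 2 * kh ^ 2 + 2 * (g ^ 2 * D t ^ 2) := by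
      nlinarith [sq_nonneg (kh - g * D t)]
    have h2 : g ^ 2 * D t ^ 2 ≤ (g * M.lam / (845 * √M.mu)) * (2 * Z t + 2 * V) := by
      calc _ ≤ M.mu * (g * M.lam / (845 * √M.mu)) * D t ^ 2 :=
            mul_le_mul_of_nonneg_right hgg (sq_nonneg _)
        _ = (g * M.lam / (845 * √M.mu)) * (M.mu * D t ^ 2) := by ring
        _ ≤ _ := mul_le_mul_of_nonneg_left (hD t) (by positivity)
    have h3 : (kh + g * D t) ^ 2 ≤ 2 * (M.lam ^ 2 * (32 * (C * M.ϱ ^ q.τ') ^ 2 * G)) +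
        2 * ((g * M.lam / (845 * √M.mu)) * (2 * Z t + 2 * V)) := by linarith
    calc _ ≤ 3 * q.η * (2 * (M.lam ^ 2 * (32 * (C * M.ϱ ^ q.τ') ^ 2 * G)) +
        2 * ((g * M.lam / (845 * √M.mu)) * (2 * Z t + 2 * V))) / M.lam := by gcongr
      _ = _ := by field_simp; ring
  -- 6·32 = 192 ≤ 200, and (12/845)·117 < 2 with 117 = 57 + 60.
  have hE : ∑ t ∈ Finset.range q.T, 3 * q.η * (kh + g * D t) ^ 2 / M.lam ≤
      q.η * M.lam * (q.T * ((200 * (C * M.ϱ ^ q.τ') ^ 2 +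
        2 * (C * M.ϱ ^ q.τ / (M.lam * √M.mu))) * G)) := by
    refine (Finset.sum_le_sum fun t _ => he t).trans ?_
    rw [← Finset.mul_sum]
    refine mul_le_mul_of_nonneg_left ?_ (by positivity)
    have e : ∀ A k : ℝ, ∑ t ∈ Finset.range q.T, (A + k * (Z t + V)) =
        q.T * A + k * (∑ t ∈ Finset.range q.T, Z t + q.T * V) := by
      intro A k
      rw [Finset.sum_add_distrib, ← Finset.mul_sum, Finset.sum_add_distrib]
      simp
    rw [e]
    have h1 : g / (M.lam * √M.mu) ≤ C * M.ϱ ^ q.τ / (M.lam * √M.mu) :=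
      div_le_div_of_nonneg_right (mul_le_mul_of_nonneg_right hC2 hϱ) (by positivity)
    have h2 : ∑ t ∈ Finset.range q.T, Z t + q.T * V ≤ q.T * (117 * G) := by
      have := mul_le_mul_of_nonneg_left hG hT.le
      linarith
    have hg1 : 0 ≤ g / (M.lam * √M.mu) := by positivity
    have h3 : 12 / 845 * (g / (M.lam * √M.mu)) * (∑ t ∈ Finset.range q.T, Z t + q.T * V) ≤
        12 / 845 * (C * M.ϱ ^ q.τ / (M.lam * √M.mu)) * (q.T * (117 * G)) :=
      mul_le_mul (by linarith) h2 (add_nonneg (Finset.sum_nonneg fun t _ =>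
        Ex_nonneg hM.nonneg fun ζ => M.nD_nonneg _) (by positivity)) (by
          have := hg1.trans h1; positivity)
    have h4 : 0 ≤ (C * M.ϱ ^ q.τ') ^ 2 * (q.T * G) := by positivity
    have h5 : 0 ≤ C * M.ϱ ^ q.τ / (M.lam * √M.mu) * (q.T * G) :=
      mul_nonneg (hg1.trans h1) (by positivity)
    linarith
  have hfin : ∑ t ∈ Finset.range q.T, M.nD (M.val (Y t)) ≤ q.T * (1 / 64 * M.nD (M.val (Y 0)) +
      (200 * (C * M.ϱ ^ q.τ') ^ 2 + 2 * (C * M.ϱ ^ q.τ / (M.lam * √M.mu))) * G) := by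
    refine le_of_mul_le_mul_left ((hsum.trans (add_le_add hY0 hE)).trans (le_of_eq ?_))
      (mul_pos hη hl)
    ring
  rw [ExV_smul, ExV_sum, val_smul, val_sum]
  refine (M.nD_average_le q.T (by exact_mod_cast hT) (fun t => M.val (Y t))).trans ?_
  rw [one_div, inv_mul_le_iff₀ hT]
  exact hfin

end TDModel

/-! ### Induction over the epochs. -/

namespace TDModel

variable {I X : Type*} [Fintype I] [Fintype X] {d : ℕ}
variable {M : TDModel X d} {p : I → ℝ} {z : I → ℕ → X} {L : ℕ} {q : Params}

variable (M q) in
/-- The error of the output after `k` epochs. -/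
def iterErr (u : Fin d → ℝ) : ℕ → (ℕ → X) → Fin d → ℝ
  | 0 => fun _ => u
  | k + 1 => fun ζ => (1 / (q.T : ℝ)) • ∑ t ∈ Finset.range q.T,
      M.innerErr q (k * epochLength q) (iterErr u k) t ζ

lemma dependsOn_iterErr (u : Fin d → ℝ) (k : ℕ) :
    DependsOn (M.iterErr q u k) (Set.Iio (k * epochLength q)) := by
  induction k with
  | zero => exact fun ζ ζ' _ => rfl
  | succ k ih =>
    intro ζ ζ' h
    simp only [iterErr]
    congr 1
    refine Finset.sum_congr rfl fun t ht => ?_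
    refine dependsOn_innerErr ih t fun n hn => h n ?_
    have : t * (q.τ + 2) ≤ q.T * (q.τ + 2) :=
      Nat.mul_le_mul_right _ (Finset.mem_range.mp ht).le
    simp only [Set.mem_Iio] at hn ⊢
    rw [add_mul, one_mul]
    conv_rhs => rw [epochLength]
    have e : k * epochLength q = k * (offsetT q + q.T * (q.τ + 2)) := rfl
    omega

/-- The level 60 is invariant under an epoch, since (2/5)·60 plus the additive 5 or 28 stays below
60. -/
lemma Mixes.iterErr_sq_le (hM : M.Mixes p z L) (hq : M.Tuned q) {W : ℝ} (hW : M.NoiseBound W)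
    (u : Fin d → ℝ) (k : ℕ) (hL : k * epochLength q + q.τ' + 1 < L) :
    Ex p z (fun ζ => M.nD (M.val (M.iterErr q u k ζ))) ≤
      60 * (M.nD (M.val u) + W / q.N + M.cbar ^ 2) := by
  have hWN : 0 ≤ W / q.N := div_nonneg hW.nonneg hq.N_pos.le
  have hc := sq_nonneg M.cbar
  have hu := M.nD_nonneg (M.val u)
  induction k with
  | zero => simp only [iterErr]; rw [Ex_const hM.sum_eq]; linarith
  | succ k ih =>
    rw [add_mul, one_mul] at hL
    have h := hM.avg_sq_le hq hL (dependsOn_iterErr (M := M) u k) hW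
    have h1 := ih (by omega)
    have h2 : Ex p z (fun ζ => M.nD (M.val (M.iterErr q u (k + 1) ζ))) ≤
        1 / (q.T : ℝ) * ∑ t ∈ Finset.range q.T, Ex p z (fun ζ =>
          M.nD (M.val (M.innerErr q (k * epochLength q) (M.iterErr q u k) t ζ))) := by
      rw [← Ex_sum, ← Ex_mul]
      refine Ex_mono hM.nonneg fun ζ => ?_
      simp only [iterErr]
      rw [val_smul, val_sum]
      exact M.nD_average_le q.T (by exact_mod_cast hq.T_pos) _
    linarith

/-- The squared error of the mean output after `k` epochs. -/
lemma Mixes.convergence (hM : M.Mixes p z L) (hq : M.Tuned q) {W C : ℝ} (hW : M.NoiseBound W)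
    (hC1 : M.CP ≤ C) (hC2 : M.CP * M.K0 ≤ C) (u : Fin d → ℝ) (k : ℕ)
    (hL : k * epochLength q + q.τ' + 1 < L) :
    M.nD (M.val (ExV p z (M.iterErr q u k))) ≤ 1 / 2 ^ k * M.nD (M.val u) +
      2 * ((200 * (C * M.ϱ ^ q.τ') ^ 2 + 2 * (C * M.ϱ ^ q.τ / (M.lam * √M.mu))) *
        (M.nD (M.val u) + W / q.N + M.cbar ^ 2)) := by
  have hWN : 0 ≤ W / q.N := div_nonneg hW.nonneg hq.N_pos.le
  have hc := sq_nonneg M.cbar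
  have hu := M.nD_nonneg (M.val u)
  have hE : 0 ≤ (200 * (C * M.ϱ ^ q.τ') ^ 2 + 2 * (C * M.ϱ ^ q.τ / (M.lam * √M.mu))) *
        (M.nD (M.val u) + W / q.N + M.cbar ^ 2) := by
    have h1 : 0 ≤ C := M.CP_nonneg.trans hC1
    have h2 := M.ϱ_pos
    have h3 := M.lam_pos
    positivity
  induction k with
  | zero =>
    have e : ExV p z (M.iterErr q u 0) = u := by
      ext j; exact Ex_const hM.sum_eq _
    rw [e, pow_zero]; linarith
  -- 1/64 ≤ 1/2 gives the factor per epoch, and (1/64)·2E + E ≤ 2E keeps the error term.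
  | succ k ih =>
    rw [add_mul, one_mul] at hL
    have h1 := ih (by omega)
    have h2 := hM.mean_le hq hL (dependsOn_iterErr (M := M) u k) hW hC1 hC2
      (hM.iterErr_sq_le hq hW u k (by omega)) (by linarith) (by linarith)
    have h3 : 0 ≤ 1 / (2 : ℝ) ^ k * M.nD (M.val u) := by positivity
    have e : 1 / (2 : ℝ) ^ (k + 1) * M.nD (M.val u) = 1 / 2 * (1 / (2 : ℝ) ^ k * M.nD (M.val u)) := by
      rw [pow_succ]; field_simp
    rw [e]
    refine h2.trans ?_
    linarith

end TDModel

/-! ### Expectations as finite sums over paths. -/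

section Paths

variable {S A : Type*} [Fintype S] [Fintype A] {m : MDP S A} {π : Policy S A}
  {Ω : Type*} [MeasurableSpace Ω] {ℙ : Measure Ω} [IsProbabilityMeasure ℙ] {Y : ℕ → Ω → S × A}

/-- The infinite path that starts with the finite path `i` and continues with `x`. -/
def extendPath {X : Type*} (x : X) {L : ℕ} (i : Fin L → X) (n : ℕ) : X :=
  if h : n < L then i ⟨n, h⟩ else x

lemma extendPath_of_lt {X : Type*} (x : X) {L : ℕ} (i : Fin L → X) {n : ℕ} (h : n < L) :
    extendPath x i n = i ⟨n, h⟩ := dif_pos h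

/-- The event that the trajectory starts with the finite path `i`. -/
def pathEvent {X : Type*} (Y : ℕ → Ω → X) {L : ℕ} (i : Fin L → X) : Set Ω :=
  {ω | ∀ n : Fin L, Y n ω = i n}

lemma measurableSet_pathEvent {X : Type*} {Y : ℕ → Ω → X}
    (hY : ∀ n x, MeasurableSet {ω | Y n ω = x}) {L : ℕ} (i : Fin L → X) :
    MeasurableSet (pathEvent Y i) := by
  have : pathEvent Y i = ⋂ n : Fin L, {ω | Y n ω = i n} := by
    ext ω; simp [pathEvent]
  rw [this]
  exact MeasurableSet.iInter fun n => hY _ _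

/-- The expectation of a function of the path up to time `L` as a finite sum. -/
lemma integral_path {X E : Type*} [Fintype X] [NormedAddCommGroup E] [NormedSpace ℝ E]
    [CompleteSpace E] {Y : ℕ → Ω → X} (hY : ∀ n x, MeasurableSet {ω | Y n ω = x}) (x0 : X) (L : ℕ)
    {f : (ℕ → X) → E} (hf : DependsOn f (Set.Iio L)) :
    ∫ ω, f (fun n => Y n ω) ∂ℙ =
      ∑ i : Fin L → X, ℙ.real (pathEvent Y i) • f (extendPath x0 i) := by
  classical
  have e : (fun ω => f (fun n => Y n ω)) = fun ω => ∑ i : Fin L → X,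
      (pathEvent Y i).indicator (fun _ => f (extendPath x0 i)) ω := by
    ext ω
    rw [Finset.sum_eq_single (fun n : Fin L => Y n ω)]
    · rw [Set.indicator_of_mem (by intro n; rfl)]
      refine hf fun n hn => ?_
      rw [extendPath_of_lt x0 _ hn]
    · intro i _ hi
      refine Set.indicator_of_notMem (fun h => hi ?_) _
      ext n; exact (h n).symm
    · simp
  rw [e, integral_finsetSum]
  · refine Finset.sum_congr rfl fun i _ => ?_
    rw [integral_indicator_const _ (measurableSet_pathEvent hY i)]
  · intro i _
    exact (integrable_const _).indicator (measurableSet_pathEvent hY i)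

end Paths

/-! ### Markov property and mixing of a trajectory. -/

section Trajectory

variable {S A : Type*} [Fintype S] [Fintype A] {m : MDP S A} {π : Policy S A}
  {Ω : Type*} [MeasurableSpace Ω] {ℙ : Measure Ω} [IsProbabilityMeasure ℙ] {Y : ℕ → Ω → S × A}

/-- The Markov property: the next pair is drawn from the transition matrix. -/
lemma IsTrajectory.integral_succ (hY : IsTrajectory m π ℙ Y) (n : ℕ)
    {H : (ℕ → S × A) → S × A → ℝ} (hH : ∀ y, DependsOn (fun ζ => H ζ y) (Set.Iio (n + 1))) :
    ∫ ω, H (fun k => Y k ω) (Y (n + 1) ω) ∂ℙ =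
      ∫ ω, ∑ y, pairMatrix m π (Y n ω) y * H (fun k => Y k ω) y ∂ℙ := by
  classical
  obtain ⟨hm, -, hP⟩ := hY
  have : Nonempty Ω := by
    by_contra h
    rw [not_nonempty_iff] at h
    have h1 : ℙ Set.univ = 1 := measure_univ
    rw [Set.univ_eq_empty_iff.mpr h, measure_empty] at h1
    exact zero_ne_one h1
  let x0 : S × A := Y 0 (Classical.arbitrary Ω)
  have h1 := integral_path (ℙ := ℙ) hm x0 (n + 1)
    (f := fun ζ => ∑ y, pairMatrix m π (ζ n) y * H ζ y) (fun ζ ζ' h => by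
      refine Finset.sum_congr rfl fun y _ => ?_
      rw [h n (by simp)]
      congr 1
      exact hH y h)
  rw [h1]
  have e : (fun ω => H (fun k => Y k ω) (Y (n + 1) ω)) = fun ω => ∑ y : S × A,
      ∑ i : Fin (n + 1) → S × A, (pathEvent Y i ∩ {ω | Y (n + 1) ω = y}).indicator
        (fun _ => H (extendPath x0 i) y) ω := by
    ext ω
    rw [Finset.sum_eq_single (Y (n + 1) ω), Finset.sum_eq_single (fun k : Fin (n + 1) => Y k ω)]
    · rw [Set.indicator_of_mem (by constructor; · intro k; rfl
                                   · rfl)]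
      refine hH _ fun k hk => ?_
      rw [extendPath_of_lt x0 _ hk]
    · intro i _ hi
      refine Set.indicator_of_notMem (fun h => hi ?_) _
      ext k : 1; exact (h.1 k).symm
    · simp
    · intro y _ hy
      refine Finset.sum_eq_zero fun i _ => Set.indicator_of_notMem (fun h => hy ?_) _
      exact h.2.symm
    · simp
  have hms : ∀ (i : Fin (n + 1) → S × A) y,
      MeasurableSet (pathEvent Y i ∩ {ω | Y (n + 1) ω = y}) := fun i y =>
    (measurableSet_pathEvent hm i).inter (hm _ _)
  rw [e, integral_finsetSum _ fun y _ => integrable_finsetSum _ fun i _ =>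
    (integrable_const _).indicator (hms i y), Finset.sum_congr rfl fun y _ =>
      integral_finsetSum _ fun i _ => (integrable_const _).indicator (hms i y), Finset.sum_comm]
  refine Finset.sum_congr rfl fun i _ => ?_
  rw [Finset.smul_sum]
  refine Finset.sum_congr rfl fun y _ => ?_
  rw [integral_indicator_const _ (hms i y)]
  -- The chain rule for cylinder probabilities, applied to the path `i` with y appended.
  have h2 := hP n (fun k => if k = n + 1 then y else extendPath x0 i k)
  have e1 : {ω | ∀ k ≤ n + 1, Y k ω = if k = n + 1 then y else extendPath x0 i k} =
      pathEvent Y i ∩ {ω | Y (n + 1) ω = y} := by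
    ext ω
    constructor
    · intro h
      refine ⟨fun k => ?_, by simpa using h (n + 1) le_rfl⟩
      have := h k (by omega)
      rwa [if_neg (by omega), extendPath_of_lt x0 i k.2] at this
    · rintro ⟨h3, h4⟩ k hk
      split_ifs with hk'
      · rw [hk']; exact h4
      · rw [extendPath_of_lt x0 i (by omega)]; exact h3 ⟨k, by omega⟩
  have e2 : {ω | ∀ k ≤ n, Y k ω = if k = n + 1 then y else extendPath x0 i k} =
      pathEvent Y i := by
    ext ω
    constructor
    · intro h k
      have := h k (by omega)
      rwa [if_neg (by omega), extendPath_of_lt x0 i k.2] at this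
    · intro h3 k hk
      rw [if_neg (by omega), extendPath_of_lt x0 i (by omega)]; exact h3 ⟨k, by omega⟩
  rw [e1, e2, if_neg (by omega), if_pos rfl] at h2
  rw [h2, smul_eq_mul, smul_eq_mul, mul_assoc]

/-- The law of the pair at time `k + n`, given the path before time `k`. -/
lemma IsTrajectory.exists_law [DecidableEq S] (hY : IsTrajectory m π ℙ Y) (k : ℕ) :
    ∃ r : (ℕ → S × A) → S → ℝ, (∀ s, DependsOn (fun ζ => r ζ s) (Set.Iio k)) ∧
      (∀ ζ, r ζ ∈ stdSimplex ℝ S) ∧ ∀ n, ∀ H : (ℕ → S × A) → S × A → ℝ,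
        (∀ y, DependsOn (fun ζ => H ζ y) (Set.Iio k)) →
        ∫ ω, H (fun l => Y l ω) (Y (k + n) ω) ∂ℙ =
          ∫ ω, ∑ x : S × A, (∑ s, r (fun l => Y l ω) s * (stateMatrix m π ^ n) s x.1) *
            π.prob x.1 x.2 * H (fun l => Y l ω) x ∂ℙ := by
  classical
  -- r is the conditional law of the state at time k: the kernel at the previous pair, or the
  -- initial law when k = 0. In both cases the action is a fresh draw from π, so only the state has
  -- to mix.
  have base : ∃ r : (ℕ → S × A) → S → ℝ, (∀ s, DependsOn (fun ζ => r ζ s) (Set.Iio k)) ∧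
      (∀ ζ, r ζ ∈ stdSimplex ℝ S) ∧ ∀ H : (ℕ → S × A) → S × A → ℝ,
        (∀ y, DependsOn (fun ζ => H ζ y) (Set.Iio k)) →
        ∫ ω, H (fun l => Y l ω) (Y k ω) ∂ℙ =
          ∫ ω, ∑ x : S × A, r (fun l => Y l ω) x.1 * π.prob x.1 x.2 *
            H (fun l => Y l ω) x ∂ℙ := by
    cases k with
    | succ k =>
      refine ⟨fun ζ => m.kernel (ζ k).1 (ζ k).2, fun s ζ ζ' h => ?_, fun ζ => m.kernel_mem _ _,
        fun H hH => hY.integral_succ k hH⟩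
      simp only [h k (by simp)]
    | zero =>
      obtain ⟨hm, h0, -⟩ := hY
      have hms : ∀ s, MeasurableSet {ω | (Y 0 ω).1 = s} := fun s => by
        have : {ω | (Y 0 ω).1 = s} = ⋃ a, {ω | Y 0 ω = (s, a)} := by
          ext ω; simp [Prod.ext_iff]
        rw [this]
        exact MeasurableSet.iUnion fun a => hm _ _
      have key : ∀ f : S × A → ℝ, ∫ ω, f (Y 0 ω) ∂ℙ = ∑ x, ℙ.real {ω | Y 0 ω = x} * f x := by
        intro f
        have e : (fun ω => f (Y 0 ω)) = fun ω => ∑ x, {ω | Y 0 ω = x}.indicator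
            (fun _ => f x) ω := by
          ext ω
          rw [Finset.sum_eq_single (Y 0 ω)]
          · rw [Set.indicator_of_mem (by rfl)]
          · exact fun x _ hx => Set.indicator_of_notMem (fun h => hx h.symm) _
          · simp
        rw [e, integral_finsetSum _ fun x _ => (integrable_const _).indicator (hm 0 x)]
        exact Finset.sum_congr rfl fun x _ => by
          rw [integral_indicator_const _ (hm 0 x), smul_eq_mul]
      have hsum : ∑ s, ℙ.real {ω | (Y 0 ω).1 = s} = 1 := by
        have h1 := key fun _ => 1
        rw [integral_const, probReal_univ, smul_eq_mul, mul_one] at h1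
        rw [h1, Fintype.sum_prod_type]
        refine Finset.sum_congr rfl fun s _ => ?_
        simp only [h0, mul_one, ← Finset.mul_sum, (π.prob_mem s).2]
      refine ⟨fun _ s => ℙ.real {ω | (Y 0 ω).1 = s}, fun s ζ ζ' h => rfl,
        fun _ => ⟨fun s => measureReal_nonneg, hsum⟩, fun H hH => ?_⟩
      have hc : ∀ ζ ζ' y, H ζ y = H ζ' y := fun ζ ζ' y => hH y fun n hn => by simp at hn
      have : Nonempty Ω := by
        by_contra h
        rw [not_nonempty_iff] at h
        have h1 : ℙ Set.univ = 1 := measure_univ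
        rw [Set.univ_eq_empty_iff.mpr h, measure_empty] at h1
        exact zero_ne_one h1
      let ζ0 : ℕ → S × A := fun _ => Y 0 (Classical.arbitrary Ω)
      simp only [fun ω => hc (fun l => Y l ω) ζ0]
      rw [key, integral_const, probReal_univ, one_smul]
      refine Finset.sum_congr rfl fun x _ => ?_
      rw [← h0 x.1 x.2]
  obtain ⟨r, hr1, hr2, hr3⟩ := base
  refine ⟨r, hr1, hr2, fun n => ?_⟩
  induction n with
  | zero =>
    intro H hH
    rw [Nat.add_zero, hr3 H hH]
    refine congrArg _ (funext fun ω => Finset.sum_congr rfl fun x _ => ?_)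
    rw [pow_zero, Finset.sum_eq_single x.1]
    · simp
    · intro s _ hs; rw [Matrix.one_apply_ne hs, mul_zero]
    · simp
  | succ n ih =>
    intro H hH
    rw [← add_assoc, hY.integral_succ (k + n) (H := H) fun y ζ ζ' h => hH y fun l hl => h l (by
      simp only [Set.mem_Iio] at hl ⊢; omega)]
    rw [ih (fun ζ x => ∑ y, pairMatrix m π x y * H ζ y) fun x ζ ζ' h =>
      Finset.sum_congr rfl fun y _ => by rw [show H ζ y = H ζ' y from hH y h]]
    refine congrArg _ (funext fun ω => ?_)
    set ρ := r fun l => Y l ω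
    set h := H fun l => Y l ω
    simp only [Finset.mul_sum]
    rw [Finset.sum_comm]
    refine Finset.sum_congr rfl fun y _ => ?_
    have e : ∑ s, ρ s * (stateMatrix m π ^ (n + 1)) s y.1 =
        ∑ s', (∑ s, ρ s * (stateMatrix m π ^ n) s s') * stateMatrix m π s' y.1 := by
      have := congrFun (Matrix.vecMul_vecMul ρ (stateMatrix m π ^ n) (stateMatrix m π)) y.1
      rw [← pow_succ] at this
      exact this.symm
    rw [e, Fintype.sum_prod_type, Finset.sum_mul, Finset.sum_mul]
    refine Finset.sum_congr rfl fun s' _ => ?_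
    simp only [pairMatrix, stateMatrix]
    generalize ∑ s, ρ s * (stateMatrix m π ^ n) s s' = v
    rw [Finset.mul_sum, Finset.sum_mul, Finset.sum_mul]
    exact Finset.sum_congr rfl fun a _ => by ring

lemma stateMatrix_pow_row_sum [DecidableEq S] (n : ℕ) (s : S) :
    ∑ s', (stateMatrix m π ^ n) s s' = 1 := by
  have h1 : (stateMatrix m π).mulVec 1 = 1 := by
    ext s
    simp only [Matrix.mulVec, dotProduct, Pi.one_apply, mul_one, stateMatrix]
    rw [Finset.sum_comm]
    simp only [← Finset.mul_sum, (m.kernel_mem _ _).2, mul_one, (π.prob_mem s).2]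
  have h2 : ∀ n, (stateMatrix m π ^ n).mulVec 1 = 1 := fun n => by
    induction n with
    | zero => simp
    | succ n ih => rw [pow_succ, ← Matrix.mulVec_mulVec, h1, ih]
  have := congrFun (h2 n) s
  simpa [Matrix.mulVec, dotProduct] using this

/-- A trajectory, cut off at a finite time, mixes at the rate of the chain of the states. -/
lemma IsTrajectory.mixes [DecidableEq S] (hY : IsTrajectory m π ℙ Y) {d : ℕ}
    (M : TDModel (S × A) d) {ν : S → ℝ} (hP : M.P = pairMatrix m π) (hw : M.w = weight π ν)
    (hmix : MixingBound m π ν M.CP M.ϱ) (x0 : S × A) (L : ℕ) :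
    M.Mixes (fun i : Fin L → S × A => ℙ.real (pathEvent Y i)) (extendPath x0) L := by
  have hEx : ∀ f : (ℕ → S × A) → ℝ, DependsOn f (Set.Iio L) →
      Ex (fun i : Fin L → S × A => ℙ.real (pathEvent Y i)) (extendPath x0) f =
        ∫ ω, f (fun n => Y n ω) ∂ℙ := fun f hf => (integral_path hY.1 x0 L hf).symm
  refine ⟨fun _ => measureReal_nonneg, ?_, fun k j hkj hj => ?_⟩
  · have := hEx (fun _ => 1) fun _ _ _ => rfl
    simpa [Ex] using this
  · obtain ⟨r, hr1, hr2, hr3⟩ := hY.exists_law k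
    obtain ⟨n, rfl⟩ : ∃ n, j = k + n := ⟨j - k, by omega⟩
    refine ⟨fun ζ x => (∑ s, r ζ s * (stateMatrix m π ^ n) s x.1) * π.prob x.1 x.2,
      fun ζ => ?_, fun ζ => ?_, fun H hH => ?_⟩
    · rw [Fintype.sum_prod_type]
      simp only [← Finset.mul_sum, (π.prob_mem _).2, mul_one]
      rw [Finset.sum_comm]
      simp only [← Finset.mul_sum, stateMatrix_pow_row_sum, mul_one, (hr2 ζ).2]
    · rw [Nat.add_sub_cancel_left, hw, Fintype.sum_prod_type]
      -- Law and weight share the factor π(a|s'), which sums to one; the distance for pairs is that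
      -- for states.
      have e : ∀ s' a, |(∑ s, r ζ s * (stateMatrix m π ^ n) s s') * π.prob s' a -
          weight π ν (s', a)| = |∑ s, r ζ s * ((stateMatrix m π ^ n) s s' - ν s')| *
            π.prob s' a := by
        intro s' a
        rw [weight, ← sub_mul, abs_mul, abs_of_nonneg ((π.prob_mem s').1 a)]
        simp only [mul_sub, Finset.sum_sub_distrib, ← Finset.sum_mul, (hr2 ζ).2, one_mul]
      simp only [e, ← Finset.mul_sum, (π.prob_mem _).2, mul_one]
      calc _ ≤ ∑ s', ∑ s, r ζ s * |(stateMatrix m π ^ n) s s' - ν s'| := by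
            refine Finset.sum_le_sum fun s' _ => (Finset.abs_sum_le_sum_abs _ _).trans
              (Finset.sum_le_sum fun s _ => ?_)
            rw [abs_mul, abs_of_nonneg ((hr2 ζ).1 s)]
        _ = ∑ s, r ζ s * ∑ s', |(stateMatrix m π ^ n) s s' - ν s'| := by
            rw [Finset.sum_comm]; simp only [Finset.mul_sum]
        _ ≤ ∑ s, r ζ s * (M.CP * M.ϱ ^ n) := Finset.sum_le_sum fun s _ =>
            mul_le_mul_of_nonneg_left (hmix n s) ((hr2 ζ).1 s)
        _ = _ := by rw [← Finset.sum_mul, (hr2 ζ).2, one_mul]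
    · rw [hEx, hEx, hP]
      · have h1 := hY.integral_succ (k + n) (H := fun ζ y => H ζ (ζ (k + n)) y)
          (fun y ζ ζ' h => by
            simp only
            rw [h (k + n) (by simp)]
            exact hH _ y fun l hl => h l (by simp only [Set.mem_Iio] at hl ⊢; omega))
        have h2 := hr3 n (fun ζ x => ∑ y, pairMatrix m π x y * H ζ x y)
          (fun x ζ ζ' h => Finset.sum_congr rfl fun y _ => by
            rw [show H ζ x y = H ζ' x y from hH x y h])
        exact h1.trans h2
      · intro ζ ζ' h
        have h' : ∀ l ∈ Set.Iio k, ζ l = ζ' l := fun l hl => h l (by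
          simp only [Set.mem_Iio] at hl ⊢; omega)
        refine Finset.sum_congr rfl fun x _ => ?_
        simp only [show ∀ s, r ζ s = r ζ' s from fun s => hr1 s h',
          show ∀ y, H ζ x y = H ζ' x y from fun y => hH x y h']
      · intro ζ ζ' h
        simp only
        rw [h (k + n) (by simp only [Set.mem_Iio]; omega),
          h (k + n + 1) (by simp only [Set.mem_Iio]; omega)]
        exact hH _ _ fun l hl => h l (by simp only [Set.mem_Iio] at hl ⊢; omega)

/-- At t = 0 two distinct states give 1 - ν s + ν s' ≤ C_P and the same with s and s' exchanged; the
average is 1 ≤ C_P. -/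
lemma MixingBound.one_le [DecidableEq S] [Nontrivial S] {ν : S → ℝ} {CP ϱ : ℝ}
    (hν : IsStationary (stateMatrix m π) ν) (h : MixingBound m π ν CP ϱ) : 1 ≤ CP := by
  obtain ⟨s, s', hs⟩ := exists_pair_ne S
  have key : ∀ s s' : S, s ≠ s' → 1 - ν s + ν s' ≤ CP := by
    intro s s' hs
    have h1 := h 0 s
    rw [pow_zero, pow_zero, mul_one] at h1
    have h2 := Finset.sum_le_univ_sum_of_nonneg (s := {s, s'})
      (fun x => abs_nonneg ((1 : Matrix S S ℝ) s x - ν x))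
    rw [Finset.sum_pair hs, Matrix.one_apply_eq, Matrix.one_apply_ne hs, zero_sub, abs_neg,
      abs_of_nonneg (hν.1.1 s')] at h2
    linarith [le_abs_self (1 - ν s)]
  linarith [key s s' hs, key s' s hs.symm]

/-- On a single state every rate is a mixing rate, so the rate may be decreased to `1 / 4`. -/
lemma MixingBound.exists_rate [DecidableEq S] {ν : S → ℝ} {CP ϱ : ℝ} {τ' : ℕ}
    (hν : IsStationary (stateMatrix m π) ν) (hCP : 0 < CP) (hϱ : 0 < ϱ) (hϱ1 : ϱ < 1)
    (h : MixingBound m π ν CP ϱ)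
    (hτ' : ϱ ^ τ' ≤ 1 / (4 * CP + 1)) :
    ∃ ϱ', 0 < ϱ' ∧ ϱ' ≤ ϱ ∧ MixingBound m π ν CP ϱ' ∧ ϱ' ^ (τ' + 1) ≤ 1 / 4 := by
  rcases subsingleton_or_nontrivial S with hS | hS
  -- With one state C_P may be tiny, and the bound on ϱ^τ' is then too weak. The extra factor in the
  -- power τ' + 1 gives 1/4 even for τ' = 0.
  · refine ⟨min ϱ (1 / 4), by positivity, min_le_left _ _, fun t s => ?_, ?_⟩
    · have e : ∑ s', |(stateMatrix m π ^ t) s s' - ν s'| = 0 := by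
        have h1 := stateMatrix_pow_row_sum (m := m) (π := π) t s
        have h2 := hν.1.2
        rw [Fintype.sum_subsingleton _ s] at h1 h2 ⊢
        rw [h1, h2, sub_self, abs_zero]
      rw [e]; positivity
    · rw [pow_succ]
      have h1 : min ϱ (1 / 4) ^ τ' ≤ 1 :=
        pow_le_one₀ (by positivity) ((min_le_left _ _).trans hϱ1.le)
      have h2 : min ϱ (1 / 4) ≤ 1 / 4 := min_le_right _ _
      have h3 : 0 ≤ min ϱ (1 / 4) := by positivity
      nlinarith
  · refine ⟨ϱ, hϱ, le_rfl, h, ?_⟩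
    have h1 := h.one_le hν
    have h2 : 1 / (4 * CP + 1) ≤ 1 / 5 :=
      one_div_le_one_div_of_le (by norm_num) (by linarith)
    rw [pow_succ]
    have h3 : 0 ≤ ϱ ^ τ' := by positivity
    nlinarith

end Trajectory

/-! ### Stationarity of the weights and the differential Q-function. -/

section Instantiate

variable {S A : Type*} [Fintype S] [Fintype A] {m : MDP S A} {π : Policy S A} {ν : S → ℝ}

lemma weight_nonneg (hν : IsStationary (stateMatrix m π) ν) (x : S × A) : 0 ≤ weight π ν x :=
  mul_nonneg (hν.1.1 _) ((π.prob_mem _).1 _)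

lemma weight_sum (hν : IsStationary (stateMatrix m π) ν) : ∑ x, weight π ν x = 1 := by
  rw [Fintype.sum_prod_type]
  simp only [weight, ← Finset.mul_sum, (π.prob_mem _).2, mul_one, hν.1.2]

lemma pairMatrix_nonneg (x y : S × A) : 0 ≤ pairMatrix m π x y :=
  mul_nonneg ((m.kernel_mem _ _).1 _) ((π.prob_mem _).1 _)

lemma pairMatrix_sum (x : S × A) : ∑ y, pairMatrix m π x y = 1 := by
  rw [Fintype.sum_prod_type]
  simp only [pairMatrix, ← Finset.mul_sum, (π.prob_mem _).2, mul_one, (m.kernel_mem _ _).2]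

lemma weight_pairMatrix (hν : IsStationary (stateMatrix m π) ν) (y : S × A) :
    ∑ x, weight π ν x * pairMatrix m π x y = weight π ν y := by
  have h := congrFun hν.2 y.1
  simp only [Matrix.vecMul, dotProduct, stateMatrix] at h
  rw [Fintype.sum_prod_type, weight]
  conv_rhs => rw [← h]
  rw [Finset.sum_mul]
  refine Finset.sum_congr rfl fun s _ => ?_
  rw [Finset.mul_sum, Finset.sum_mul]
  exact Finset.sum_congr rfl fun a _ => by simp only [weight, pairMatrix]; ring

lemma avgCost_eq : avgCost m π ν = ∑ x, weight π ν x * costVec m x := by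
  rw [Fintype.sum_prod_type, avgCost]
  refine Finset.sum_congr rfl fun s _ => ?_
  rw [Finset.mul_sum]
  exact Finset.sum_congr rfl fun a _ => by simp only [weight, costVec]; ring

/-! ### The Poisson equation -/

lemma pairMatrix_mulVec (f : S × A → ℝ) (x : S × A) :
    (pairMatrix m π).mulVec f x = ∑ s, m.kernel x.1 x.2 s * ∑ a, π.prob s a * f (s, a) := by
  simp only [Matrix.mulVec, dotProduct, pairMatrix]
  rw [Fintype.sum_prod_type]
  refine Finset.sum_congr rfl fun s _ => ?_
  rw [Finset.mul_sum]
  exact Finset.sum_congr rfl fun a _ => by ring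

/-- After one move a pair is seen only through its state, so powers of P reduce to powers of the
state matrix, for which mixing is assumed. -/
lemma pairMatrix_pow_mulVec [DecidableEq S] [DecidableEq A] (f : S × A → ℝ) (t : ℕ) (x : S × A) :
    ((pairMatrix m π) ^ (t + 1)).mulVec f x =
      ∑ s, m.kernel x.1 x.2 s *
        ((stateMatrix m π) ^ t).mulVec (fun s => ∑ a, π.prob s a * f (s, a)) s := by
  induction t generalizing x with
  | zero => rw [zero_add, pow_one, pow_zero, pairMatrix_mulVec, Matrix.one_mulVec]
  | succ t ih =>
    rw [pow_succ', ← Matrix.mulVec_mulVec, pairMatrix_mulVec]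
    refine Finset.sum_congr rfl fun s _ => ?_
    congr 1
    rw [pow_succ' (stateMatrix m π), ← Matrix.mulVec_mulVec]
    simp only [ih]
    generalize ((stateMatrix m π) ^ t).mulVec (fun s => ∑ a, π.prob s a * f (s, a)) = h
    simp only [Matrix.mulVec, dotProduct, stateMatrix, Finset.mul_sum, Finset.sum_mul]
    rw [Finset.sum_comm]
    exact Finset.sum_congr rfl fun s' _ => Finset.sum_congr rfl fun a _ => by ring

/-- The policy average of a centred f has zero ν-mean, so ν can be subtracted from each row of the
power at no cost and the terms decay like ϱ^t. -/
lemma summable_pairMatrix_pow [DecidableEq S] [DecidableEq A] {CP ϱ : ℝ} (h0 : 0 < ϱ) (h1 : ϱ < 1)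
    (hmix : MixingBound m π ν CP ϱ) {f : S × A → ℝ} (hf : ∑ x, weight π ν x * f x = 0)
    (x : S × A) : Summable fun t => ((pairMatrix m π) ^ t).mulVec f x := by
  rw [← summable_nat_add_iff 1]
  let g : S → ℝ := fun s => ∑ a, π.prob s a * f (s, a)
  have hg : ∑ s, ν s * g s = 0 := by
    rw [← hf, Fintype.sum_prod_type]
    refine Finset.sum_congr rfl fun s _ => ?_
    rw [Finset.mul_sum]
    exact Finset.sum_congr rfl fun a _ => by simp only [weight]; ring
  let b := ∑ s, |g s|
  refine Summable.of_norm_bounded (g := fun t => (CP * b) * ϱ ^ t)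
    ((summable_geometric_of_lt_one h0.le h1).mul_left _) fun t => ?_
  have h2 : ∀ s, |((stateMatrix m π) ^ t).mulVec g s| ≤ CP * b * ϱ ^ t := by
    intro s
    have e : ((stateMatrix m π) ^ t).mulVec g s =
        ∑ s', (((stateMatrix m π) ^ t) s s' - ν s') * g s' := by
      simp only [sub_mul, Finset.sum_sub_distrib, hg, sub_zero]; rfl
    rw [e]
    refine (TDModel.abs_sum_mul_le (hmix t s) (B := b) (fun s' => ?_) ?_).trans
      (le_of_eq (by ring))
    · exact Finset.single_le_sum (f := fun s => |g s|) (fun _ _ => abs_nonneg _)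
        (Finset.mem_univ s')
    · exact Finset.sum_nonneg fun _ _ => abs_nonneg _
  rw [Real.norm_eq_abs, pairMatrix_pow_mulVec]
  refine (TDModel.abs_sum_mul_le (δ := m.kernel x.1 x.2) (ε := 1) ?_ h2 ?_).trans
    (le_of_eq (by ring))
  · rw [Finset.sum_congr rfl fun s _ => abs_of_nonneg ((m.kernel_mem _ _).1 s),
      (m.kernel_mem _ _).2]
  · exact (abs_nonneg _).trans (h2 x.1)

lemma basicQ_poisson [DecidableEq S] [DecidableEq A] (hν : IsStationary (stateMatrix m π) ν)
    {CP ϱ : ℝ} (h0 : 0 < ϱ) (h1 : ϱ < 1) (hmix : MixingBound m π ν CP ϱ) (x : S × A) :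
    basicQ m π ν x - ∑ y, pairMatrix m π x y * basicQ m π ν y =
      costVec m x - avgCost m π ν := by
  set f : S × A → ℝ := fun y => costVec m y - avgCost m π ν with hf
  have hf0 : ∑ x, weight π ν x * f x = 0 := by
    simp only [hf, mul_sub, Finset.sum_sub_distrib, ← Finset.sum_mul, weight_sum hν, ← avgCost_eq,
      one_mul, sub_self]
  have hs := summable_pairMatrix_pow h0 h1 hmix hf0
  have e1 : basicQ m π ν x = f x + ∑' t, ((pairMatrix m π) ^ (t + 1)).mulVec f x := by
    rw [basicQ, (hs x).tsum_eq_zero_add, pow_zero, Matrix.one_mulVec]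
  have e2 : ∑ y, pairMatrix m π x y * basicQ m π ν y =
      ∑' t, ((pairMatrix m π) ^ (t + 1)).mulVec f x := by
    simp only [basicQ, ← tsum_mul_left]
    rw [← Summable.tsum_finsetSum fun y _ => (hs y).mul_left _]
    refine tsum_congr fun t => ?_
    rw [pow_succ', ← Matrix.mulVec_mulVec]
    rfl
  rw [e1, e2]; ring

end Instantiate

/-! ### Spectral norm, smallest eigenvalue, inverse square root and the form of I - P. -/

section Spectral

open scoped Matrix.Norms.L2Operator

lemma specNorm_nonneg {k n : Type*} [Fintype k] [Fintype n] [DecidableEq n] (M : Matrix k n ℝ) :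
    0 ≤ specNorm M := norm_nonneg _

lemma sqrt_sum_sq_mulVec_le {k n : Type*} [Fintype k] [Fintype n] [DecidableEq n]
    (M : Matrix k n ℝ) (u : n → ℝ) :
    √(∑ x, M.mulVec u x ^ 2) ≤ specNorm M * √(∑ j, u j ^ 2) := by
  have h := Matrix.l2_opNorm_mulVec M (WithLp.toLp 2 u)
  simpa [EuclideanSpace.norm_eq, specNorm] using h

end Spectral

/-- B minus its least spectral value is Hermitian with nonnegative spectrum, hence positive
semidefinite. -/
lemma minEig_le_dotProduct {d : ℕ} {B : Matrix (Fin d) (Fin d) ℝ} (hB : B.IsHermitian)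
    (u : Fin d → ℝ) : sInf (spectrum ℝ B) * (u ⬝ᵥ u) ≤ u ⬝ᵥ B.mulVec u := by
  have hbdd : BddBelow (spectrum ℝ B) := by
    rw [hB.spectrum_real_eq_range_eigenvalues]
    exact (Set.finite_range _).bddBelow
  have hpos : (B - algebraMap ℝ _ (sInf (spectrum ℝ B))).PosSemidef := by
    rw [Matrix.posSemidef_iff_isHermitian_and_spectrum_nonneg]
    constructor
    · refine hB.sub ?_
      rw [Algebra.algebraMap_eq_smul_one]
      ext i j
      simp [Matrix.one_apply, eq_comm]
    · rw [← spectrum.sub_singleton_eq]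
      rintro _ ⟨a, ha, b, hb, rfl⟩
      rw [Set.mem_singleton_iff] at hb
      subst hb
      exact sub_nonneg.mpr (csInf_le hbdd ha)
  have h := hpos.dotProduct_mulVec_nonneg u
  rw [Algebra.algebraMap_eq_smul_one, Matrix.sub_mulVec, dotProduct_sub, Matrix.smul_mulVec,
    Matrix.one_mulVec, dotProduct_smul, smul_eq_mul] at h
  simp only [star_trivial] at h
  linarith

/-- Relations between a positive definite matrix and its inverse square root. -/
lemma cfc_inv_sqrt_relations {d : ℕ} {B : Matrix (Fin d) (Fin d) ℝ} (hB : B.IsHermitian)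
    (hpos : 0 < sInf (spectrum ℝ B)) {G : Matrix (Fin d) (Fin d) ℝ}
    (hG : G = cfc (fun t : ℝ => (√t)⁻¹) B) :
    G.transpose = G ∧ G * B * G = 1 ∧ B * G * G = 1 ∧ G * B = B * G := by
  have hsa : IsSelfAdjoint B := hB
  have hfin : (spectrum ℝ B).Finite := by
    rw [hB.spectrum_real_eq_range_eigenvalues]; exact Set.finite_range _
  -- The spectrum is finite, so continuity is automatic and `cfc` is multiplicative for every pair
  -- of functions.
  have hcont : ∀ f : ℝ → ℝ, ContinuousOn f (spectrum ℝ B) := fun f =>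
    hfin.continuousOn f
  have hcomm : G * B = B * G := by
    have h := (cfc_commute_cfc (fun t : ℝ => (√t)⁻¹) id B).eq
    rwa [cfc_id ℝ B, ← hG] at h
  have hBGG : B * G * G = 1 := by
    have e : B * G * G = cfc (fun t : ℝ => t * (√t)⁻¹ * (√t)⁻¹) B := by
      rw [cfc_mul _ _ B (hcont _) (hcont _), cfc_mul _ _ B (hcont _) (hcont _), cfc_id' ℝ B, hG]
    rw [e, ← cfc_one ℝ B]
    refine cfc_congr fun t ht => ?_
    have h0 : 0 < t := hpos.trans_le (csInf_le hfin.bddBelow ht)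
    have := Real.sq_sqrt h0.le
    have h1 := Real.sqrt_pos.mpr h0
    simp only [Pi.one_apply]
    field_simp
    linarith
  refine ⟨?_, by rw [hcomm]; exact hBGG, hBGG, hcomm⟩
  have h : IsSelfAdjoint G := by rw [hG]; exact cfc_predicate _ _
  have h2 : G.conjTranspose = G := h
  rwa [Matrix.conjTranspose_eq_transpose_of_trivial] at h2

lemma mulVec_mem_span {X : Type*} {d : ℕ} (Ψ : Matrix X (Fin d) ℝ) (u : Fin d → ℝ) :
    Ψ.mulVec u ∈ Submodule.span ℝ (Set.range Ψ.transpose) := by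
  have e : Ψ.mulVec u = ∑ j, u j • Ψ.transpose j := by
    ext x
    simp [Matrix.mulVec, dotProduct, mul_comm]
  rw [e]
  exact Submodule.sum_mem _ fun j _ => Submodule.smul_mem _ _ (Submodule.subset_span ⟨j, rfl⟩)

/-- Shows that the set defining `oneSubBeta` is bounded below; otherwise the real `sInf` would not
be a lower bound of it. -/
lemma quadratic_lower {S A : Type*} [Fintype S] [Fintype A] {m : MDP S A} {π : Policy S A}
    {ν : S → ℝ} (hν : IsStationary (stateMatrix m π) ν) (f : S × A → ℝ) :
    -(∑ x, weight π ν x * f x ^ 2) ≤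
      ∑ x, weight π ν x * (f x * (f x - ∑ y, pairMatrix m π x y * f y)) := by
  have h : ∀ x, -(weight π ν x * f x ^ 2) + (1 / 2 * (weight π ν x * f x ^ 2) - 1 / 2 *
      ∑ y, weight π ν x * pairMatrix m π x y * f y ^ 2) ≤
      weight π ν x * (f x * (f x - ∑ y, pairMatrix m π x y * f y)) := by
    intro x
    have e1 : ∑ y, pairMatrix m π x y * (f x ^ 2 + 2 * (f x * f y) - f y ^ 2) =
      f x ^ 2 + 2 * (f x * ∑ y, pairMatrix m π x y * f y) -
        ∑ y, pairMatrix m π x y * f y ^ 2 := by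
      simp only [mul_sub, mul_add, Finset.sum_sub_distrib, Finset.sum_add_distrib,
        ← Finset.sum_mul, pairMatrix_sum, one_mul, Finset.mul_sum]
      congr 2
      exact Finset.sum_congr rfl fun y _ => by ring
    have h1 : f x * ∑ y, pairMatrix m π x y * f y ≤
        1 / 2 * f x ^ 2 + 1 / 2 * ∑ y, pairMatrix m π x y * f y ^ 2 := by
      have e2 : 1 / 2 * f x ^ 2 = 1 / 2 * ∑ y, pairMatrix m π x y * f x ^ 2 := by
        rw [← Finset.sum_mul, pairMatrix_sum, one_mul]
      rw [e2, ← mul_add, ← Finset.sum_add_distrib, Finset.mul_sum, Finset.mul_sum]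
      refine Finset.sum_le_sum fun y _ => ?_
      nlinarith [mul_nonneg (pairMatrix_nonneg (m := m) (π := π) x y) (sq_nonneg (f x - f y))]
    have h2 := mul_le_mul_of_nonneg_left h1 (weight_nonneg hν x)
    have e3 : ∑ y, weight π ν x * pairMatrix m π x y * f y ^ 2 =
        weight π ν x * ∑ y, pairMatrix m π x y * f y ^ 2 := by
      rw [Finset.mul_sum]; exact Finset.sum_congr rfl fun y _ => by ring
    have h3 := mul_nonneg (weight_nonneg hν x) (sq_nonneg (f x))
    rw [e3]
    nlinarith
  have h4 := Finset.sum_le_sum fun x (_ : x ∈ Finset.univ) => h x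
  have e : ∑ x, ∑ y, weight π ν x * pairMatrix m π x y * f y ^ 2 =
      ∑ x, weight π ν x * f x ^ 2 := by
    rw [Finset.sum_comm]
    refine Finset.sum_congr rfl fun y _ => ?_
    rw [← Finset.sum_mul, weight_pairMatrix hν]
  rw [Finset.sum_add_distrib, Finset.sum_sub_distrib, ← Finset.mul_sum, ← Finset.mul_sum, e,
    Finset.sum_neg_distrib] at h4
  linarith

/-! ### The MDP as an instance of the abstract model. -/

section Model

variable {S A : Type*} [Fintype S] [Fintype A] [DecidableEq S] [DecidableEq A] {m : MDP S A}
  {π : Policy S A} {ν : S → ℝ} {d : ℕ} {Ψ : Matrix (S × A) (Fin d) ℝ}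

lemma dot_weightMatrix (f g : S × A → ℝ) :
    f ⬝ᵥ (weightMatrix π ν).mulVec g = ∑ x, weight π ν x * (f x * g x) := by
  simp only [weightMatrix, Matrix.mulVec_diagonal, dotProduct]
  exact Finset.sum_congr rfl fun x _ => by ring

lemma normD_sq (hν : IsStationary (stateMatrix m π) ν) (f : S × A → ℝ) :
    normD π ν f ^ 2 = ∑ x, weight π ν x * f x ^ 2 := by
  rw [normD, dot_weightMatrix, Real.sq_sqrt]
  · simp only [sq]
  · exact Finset.sum_nonneg fun x _ => mul_nonneg (weight_nonneg hν x) (mul_self_nonneg _)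

lemma gram_isHermitian : (gram π ν Ψ).IsHermitian := by
  rw [Matrix.IsHermitian, Matrix.conjTranspose_eq_transpose_of_trivial, gram,
    Matrix.transpose_mul, Matrix.transpose_mul, Matrix.transpose_transpose, weightMatrix,
    Matrix.diagonal_transpose, Matrix.mul_assoc]

lemma dot_gram (u v : Fin d → ℝ) :
    u ⬝ᵥ (gram π ν Ψ).mulVec v = ∑ x, weight π ν x * ((Ψ x ⬝ᵥ u) * (Ψ x ⬝ᵥ v)) := by
  rw [gram, ← Matrix.mulVec_mulVec, ← Matrix.mulVec_mulVec, Matrix.dotProduct_mulVec,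
    Matrix.vecMul_transpose, dot_weightMatrix]
  rfl

lemma minEig_le (u : Fin d → ℝ) :
    minEig π ν Ψ * (u ⬝ᵥ u) ≤ ∑ x, weight π ν x * (Ψ x ⬝ᵥ u) ^ 2 := by
  refine (minEig_le_dotProduct gram_isHermitian u).trans (le_of_eq ?_)
  rw [dot_gram]
  simp only [sq]

lemma mulVec_one_sub (f : S × A → ℝ) (x : S × A) :
    (1 - pairMatrix m π).mulVec f x = f x - ∑ y, pairMatrix m π x y * f y := by
  rw [Matrix.sub_mulVec, Matrix.one_mulVec]
  rfl

lemma quadratic_eq (f : S × A → ℝ) :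
    f ⬝ᵥ (weightMatrix π ν * (1 - pairMatrix m π)).mulVec f =
      ∑ x, weight π ν x * (f x * (f x - ∑ y, pairMatrix m π x y * f y)) := by
  rw [← Matrix.mulVec_mulVec, dot_weightMatrix]
  simp only [mulVec_one_sub]

lemma oneSubBeta_le (hν : IsStationary (stateMatrix m π) ν) (u : Fin d → ℝ) :
    oneSubBeta m π ν Ψ * ∑ x, weight π ν x * (Ψ x ⬝ᵥ u) ^ 2 ≤
      ∑ x, weight π ν x * ((Ψ x ⬝ᵥ u) * (Ψ x ⬝ᵥ u - ∑ y, pairMatrix m π x y * (Ψ y ⬝ᵥ u))) := by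
  have hbdd : BddBelow ((fun x : S × A → ℝ =>
      x ⬝ᵥ (weightMatrix π ν * (1 - pairMatrix m π)).mulVec x) ''
      {x | x ∈ Submodule.span ℝ (Set.range Ψ.transpose) ∧ normD π ν x = 1}) := by
    refine ⟨-1, ?_⟩
    rintro _ ⟨f, ⟨-, hf⟩, rfl⟩
    simp only
    rw [quadratic_eq]
    have := quadratic_lower hν f
    rwa [← normD_sq hν, hf, one_pow] at this
  set f : S × A → ℝ := Ψ.mulVec u with hfdef
  have hfx : ∀ x, Ψ x ⬝ᵥ u = f x := fun x => rfl
  simp only [hfx]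
  have hn : 0 ≤ ∑ x, weight π ν x * f x ^ 2 :=
    Finset.sum_nonneg fun x _ => mul_nonneg (weight_nonneg hν x) (sq_nonneg _)
  rcases hn.eq_or_lt with h0 | hpos
  -- A function of zero D-norm cannot be normalised, but then it vanishes wherever the weight is
  -- positive and both sides are zero.
  · have h1 : ∀ x, weight π ν x * f x ^ 2 = 0 := fun x =>
      (Finset.sum_eq_zero_iff_of_nonneg fun x _ =>
        mul_nonneg (weight_nonneg hν x) (sq_nonneg _)).mp h0.symm x (Finset.mem_univ x)
    rw [← h0, mul_zero]
    refine le_of_eq (Finset.sum_eq_zero fun x _ => ?_).symm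
    rcases mul_eq_zero.mp (h1 x) with h | h
    · rw [h, zero_mul]
    · rw [pow_eq_zero_iff two_ne_zero] at h; rw [h]; ring
  · set n := ∑ x, weight π ν x * f x ^ 2 with hndef
    have hs := Real.sqrt_pos.mpr hpos
    have hs2 := Real.sq_sqrt hpos.le
    have hmem : ((√n)⁻¹ • f) ∈ {x | x ∈ Submodule.span ℝ (Set.range Ψ.transpose) ∧
        normD π ν x = 1} := by
      refine ⟨Submodule.smul_mem _ _ (mulVec_mem_span Ψ u), ?_⟩
      have h2 : normD π ν ((√n)⁻¹ • f) ^ 2 = 1 := by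
        rw [normD_sq hν]
        have e : ∀ x, weight π ν x * ((√n)⁻¹ • f) x ^ 2 =
            ((√n) ^ 2)⁻¹ * (weight π ν x * f x ^ 2) := fun x => by
          simp only [Pi.smul_apply, smul_eq_mul, mul_pow, inv_pow]; ring
        simp only [e]
        rw [← Finset.mul_sum, ← hndef, hs2, inv_mul_cancel₀ hpos.ne']
      have h3 : 0 ≤ normD π ν ((√n)⁻¹ • f) := Real.sqrt_nonneg _
      exact (pow_eq_one_iff_of_nonneg h3 two_ne_zero).mp h2
    have h : oneSubBeta m π ν Ψ ≤ ((√n)⁻¹ • f) ⬝ᵥ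
        (weightMatrix π ν * (1 - pairMatrix m π)).mulVec ((√n)⁻¹ • f) :=
      csInf_le hbdd ⟨_, hmem, rfl⟩
    rw [quadratic_eq] at h
    have e : ∀ x, weight π ν x * (((√n)⁻¹ • f) x *
        (((√n)⁻¹ • f) x - ∑ y, pairMatrix m π x y * ((√n)⁻¹ • f) y)) =
        ((√n) ^ 2)⁻¹ * (weight π ν x * (f x * (f x - ∑ y, pairMatrix m π x y * f y))) := by
      intro x
      have e2 : ∑ y, pairMatrix m π x y * ((√n)⁻¹ • f) y =
          (√n)⁻¹ * ∑ y, pairMatrix m π x y * f y := by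
        rw [Finset.mul_sum]
        exact Finset.sum_congr rfl fun y _ => by
          simp only [Pi.smul_apply, smul_eq_mul]; ring
      rw [e2]
      simp only [Pi.smul_apply, smul_eq_mul]
      rw [sq, mul_inv]; ring
    simp only [e] at h
    rw [← Finset.mul_sum, hs2, inv_mul_eq_div, le_div_iff₀ hpos] at h
    exact h

end Model

namespace TDModel

variable {X : Type*} [Fintype X] {d : ℕ} (M : TDModel X d)

/-- The stationary mean of the features. -/
def meanFeature : Fin d → ℝ := ∑ x, M.w x • M.Ψ x

lemma dot_meanFeature (v : Fin d → ℝ) : v ⬝ᵥ M.meanFeature = ∑ x, M.w x * (v ⬝ᵥ M.Ψ x) := by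
  simp only [meanFeature, dotProduct_sum, dotProduct_smul, smul_eq_mul]

/-- The covariance in W₁ is that of the noise without ρ*. The discrepancy is ρ* times the centred
feature, whose stationary second moment is at most 1. -/
lemma noiseVar_le : M.noiseVar ≤ 2 * M.st (fun x y =>
      M.nD (M.val (M.solve (M.noise x y - M.rho • (M.Ψ x - M.meanFeature))))) +
    2 * M.cbar ^ 2 / (M.mu * M.lam ^ 2) := by
  have hml : 0 < M.mu * M.lam ^ 2 := mul_pos M.mu_pos (pow_pos M.lam_pos 2)
  have h1 : ∀ x y, M.nD (M.val (M.solve (M.noise x y))) ≤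
      2 * M.nD (M.val (M.solve (M.noise x y - M.rho • (M.Ψ x - M.meanFeature)))) +
      2 * M.rho ^ 2 / (M.mu * M.lam ^ 2) *
        ((M.Ψ x - M.meanFeature) ⬝ᵥ (M.Ψ x - M.meanFeature)) := by
    intro x y
    have e : M.noise x y = (M.noise x y - M.rho • (M.Ψ x - M.meanFeature)) +
        M.rho • (M.Ψ x - M.meanFeature) := by abel
    conv_lhs => rw [e, solve_add, val_add, solve_smul, val_smul]
    refine (M.nD_add_le _ _).trans ?_
    rw [nD_smul]
    have h2 := mul_le_mul_of_nonneg_left (M.nD_solve_le (M.Ψ x - M.meanFeature))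
      (by positivity : 0 ≤ 2 * M.rho ^ 2)
    have e2 : 2 * M.rho ^ 2 / (M.mu * M.lam ^ 2) *
        ((M.Ψ x - M.meanFeature) ⬝ᵥ (M.Ψ x - M.meanFeature)) = 2 * M.rho ^ 2 *
        (((M.Ψ x - M.meanFeature) ⬝ᵥ (M.Ψ x - M.meanFeature)) / (M.mu * M.lam ^ 2)) := by ring
    rw [e2]; linarith
  refine (M.st_mono h1).trans ?_
  rw [M.st_add, M.st_mul, M.st_mul]
  refine add_le_add le_rfl ?_
  have h3 : M.st (fun x _ => (M.Ψ x - M.meanFeature) ⬝ᵥ (M.Ψ x - M.meanFeature)) ≤ 1 := by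
    rw [M.st_left fun x => (M.Ψ x - M.meanFeature) ⬝ᵥ (M.Ψ x - M.meanFeature)]
    have h4 : ∀ x, (M.Ψ x - M.meanFeature) ⬝ᵥ (M.Ψ x - M.meanFeature) ≤
        1 - 2 * (M.meanFeature ⬝ᵥ M.Ψ x) + M.meanFeature ⬝ᵥ M.meanFeature := by
      intro x
      have := M.Ψ_le x
      simp only [sub_dotProduct, dotProduct_sub, dotProduct_comm (M.Ψ x) M.meanFeature]
      linarith
    refine (Finset.sum_le_sum fun x _ => mul_le_mul_of_nonneg_left (h4 x) (M.w_nonneg x)).trans ?_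
    have e : ∑ x, M.w x * (1 - 2 * (M.meanFeature ⬝ᵥ M.Ψ x) + M.meanFeature ⬝ᵥ M.meanFeature) =
        (∑ x, M.w x) * (1 + M.meanFeature ⬝ᵥ M.meanFeature) -
          2 * ∑ x, M.w x * (M.meanFeature ⬝ᵥ M.Ψ x) := by
      rw [Finset.sum_mul, Finset.mul_sum, ← Finset.sum_sub_distrib]
      exact Finset.sum_congr rfl fun x _ => by ring
    rw [e, ← dot_meanFeature, M.w_sum]
    linarith [dot_self_nonneg M.meanFeature]
  have h5 : M.rho ^ 2 ≤ M.cbar ^ 2 := by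
    rw [← sq_abs]; exact pow_le_pow_left₀ (abs_nonneg _) M.abs_rho_le 2
  calc _ ≤ 2 * M.rho ^ 2 / (M.mu * M.lam ^ 2) * 1 :=
        mul_le_mul_of_nonneg_left h3 (by positivity)
    _ = 2 * M.rho ^ 2 / (M.mu * M.lam ^ 2) := mul_one _
    _ ≤ _ := by gcongr

end TDModel

section Model

variable {S A : Type*} [Fintype S] [Fintype A] [DecidableEq S] [DecidableEq A] {m : MDP S A}
  {π : Policy S A} {ν : S → ℝ} {d : ℕ} {Ψ : Matrix (S × A) (Fin d) ℝ}

/-- The abstract model of an average-reward MDP with linear features. -/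
def toModel (m : MDP S A) (π : Policy S A) (ν : S → ℝ) (Ψ : Matrix (S × A) (Fin d) ℝ)
    (θ : Fin d → ℝ) (b cbar CP ϱ : ℝ) (hν : IsStationary (stateMatrix m π) ν) (hCP : 0 < CP)
    (hϱ : 0 < ϱ) (hϱ1 : ϱ < 1) (hmix : MixingBound m π ν CP ϱ)
    (hc : ∀ s a, |m.cost s a| ≤ cbar) (hd : 0 < d) (hΨ : AdmissibleFeatures Ψ)
    (hθ : SolvesProjectedBellman m π ν Ψ θ) (hw : 0 < minWeight π ν) (hmu : 0 < minEig π ν Ψ)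
    (hlam : 0 < oneSubBeta m π ν Ψ) : TDModel (S × A) d where
  w := weight π ν
  P := pairMatrix m π
  c := costVec m
  Ψ := Ψ
  θs := θ
  Q := fun x => basicQ m π ν x + b
  cbar := cbar
  mu := minEig π ν Ψ
  lam := oneSubBeta m π ν Ψ
  wmin := minWeight π ν
  sI := specNorm (1 - pairMatrix m π)
  sΨ := specNorm Ψ
  CP := CP
  ϱ := ϱ
  d_pos := hd
  wmin_pos := hw
  wmin_le := fun x => ciInf_le (Set.finite_range _).bddBelow x
  w_sum := weight_sum hν
  P_nonneg := pairMatrix_nonneg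
  P_sum := pairMatrix_sum
  w_P := weight_pairMatrix hν
  Ψ_le := fun x => by
    have h := Real.sqrt_le_one.mp (hΨ.2.1 x)
    simpa only [dotProduct, sq] using h
  mu_pos := hmu
  mu_le := minEig_le
  lam_pos := hlam
  lam_le := oneSubBeta_le hν
  c_le := fun x => hc x.1 x.2
  bellman := fun v => by
    have h := congrArg (v ⬝ᵥ ·) hθ
    simp only [dotProduct_add, ← Matrix.mulVec_mulVec] at h
    simp only [Matrix.dotProduct_mulVec v Ψ.transpose, Matrix.vecMul_transpose,
      dot_weightMatrix] at h
    rw [← sub_eq_zero, ← Finset.sum_add_distrib, ← Finset.sum_sub_distrib] at h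
    rw [← h]
    refine Finset.sum_congr rfl fun x _ => ?_
    rw [← avgCost_eq]
    change weight π ν x * ((Ψ.mulVec v x) * (Ψ.mulVec θ x -
      (pairMatrix m π).mulVec (Ψ.mulVec θ) x - costVec m x + avgCost m π ν)) = _
    ring
  poisson := fun x => by
    rw [← avgCost_eq, ← basicQ_poisson hν hϱ hϱ1 hmix x]
    simp only [mul_add, Finset.sum_add_distrib, ← Finset.sum_mul, pairMatrix_sum]
    ring
  sI_nonneg := specNorm_nonneg _
  res_le := fun f x => by
    have h := sqrt_sum_sq_mulVec_le (1 - pairMatrix m π) f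
    rw [← mulVec_one_sub]
    exact (TDModel.abs_le_sqrt_sum_sq ((1 - pairMatrix m π).mulVec f) x).trans h
  sΨ_nonneg := specNorm_nonneg _
  val_le := fun u => by
    have h := sqrt_sum_sq_mulVec_le Ψ u
    simpa only [dotProduct, sq, Matrix.mulVec] using h
  CP_nonneg := hCP.le
  ϱ_pos := hϱ
  ϱ_lt := hϱ1

/-- The model agrees with the given data of the average-reward MDP. -/
structure IsModel (M : TDModel (S × A) d) (m : MDP S A) (π : Policy S A) (ν : S → ℝ)
    (Ψ : Matrix (S × A) (Fin d) ℝ) (θ : Fin d → ℝ) (Q : S × A → ℝ) : Prop where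
  w_eq : M.w = weight π ν
  P_eq : M.P = pairMatrix m π
  c_eq : M.c = costVec m
  Ψ_eq : M.Ψ = Ψ
  θ_eq : M.θs = θ
  Q_eq : M.Q = Q
  mu_eq : M.mu = minEig π ν Ψ
  lam_eq : M.lam = oneSubBeta m π ν Ψ
  stationary : IsStationary (stateMatrix m π) ν

variable {M : TDModel (S × A) d} {θ : Fin d → ℝ} {Q : S × A → ℝ}

lemma IsModel.nD_eq (h : IsModel M m π ν Ψ θ Q) (f : S × A → ℝ) : M.nD f = normD π ν f ^ 2 := by
  rw [normD_sq h.stationary, TDModel.nD, h.w_eq]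

lemma IsModel.val_eq (h : IsModel M m π ν Ψ θ Q) (u : Fin d → ℝ) : M.val u = Ψ.mulVec u := by
  ext x; rw [TDModel.val, h.Ψ_eq]; rfl

lemma IsModel.meanMat_eq (h : IsModel M m π ν Ψ θ Q) :
    M.meanMat = Ψ.transpose * weightMatrix π ν * (1 - pairMatrix m π) * Ψ := by
  ext i j
  have e := M.dot_meanMat (Pi.single i 1) (Pi.single j 1)
  rw [single_one_dotProduct, Matrix.mulVec_single_one] at e
  have e2 : (Ψ.transpose * weightMatrix π ν * (1 - pairMatrix m π) * Ψ :
      Matrix (Fin d) (Fin d) ℝ) i j =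
      (Ψ.mulVec (Pi.single i 1)) ⬝ᵥ (weightMatrix π ν).mulVec
        ((1 - pairMatrix m π).mulVec (Ψ.mulVec (Pi.single j 1))) := by
    rw [Matrix.mulVec_single_one, Matrix.mulVec_single_one]
    simp only [Matrix.mul_assoc]
    rfl
  rw [e2, dot_weightMatrix]
  change M.meanMat i j = _ at e
  rw [e, h.w_eq, h.val_eq, h.val_eq]
  refine Finset.sum_congr rfl fun x _ => ?_
  rw [mulVec_one_sub, TDModel.res, h.P_eq]

end Model

/-! ### The trace in W₁ as a second moment. -/

section Noise

variable {S A : Type*} [Fintype S] [Fintype A] [DecidableEq S] [DecidableEq A] {m : MDP S A}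
  {π : Policy S A} {ν : S → ℝ} {d : ℕ} {Ψ : Matrix (S × A) (Fin d) ℝ}
  {M : TDModel (S × A) d} {θ : Fin d → ℝ} {Q : S × A → ℝ}

lemma trace_conj_vecMulVec {d : ℕ} (R : Matrix (Fin d) (Fin d) ℝ) (a : Fin d → ℝ) :
    (R * Matrix.vecMulVec a a * R.transpose).trace = R.mulVec a ⬝ᵥ R.mulVec a := by
  rw [Matrix.mul_vecMulVec, Matrix.vecMulVec_mul, Matrix.trace_vecMulVec, Matrix.vecMul_transpose]

lemma IsModel.noiseVec_eq (h : IsModel M m π ν Ψ θ Q) (x y : S × A) :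
    noiseVec m π ν Ψ θ x y = (gramInvSqrt π ν Ψ).mulVec (M.noise x y - M.rho • M.Ψ x) := by
  rw [noiseVec, TDModel.noise, ← sub_smul, TDModel.val, TDModel.val, h.Ψ_eq, h.θ_eq, h.c_eq,
    sub_dotProduct]
  congr 2
  ring

/-- `noiseVec` omits +ρ*, and the noise with ρ* is centred by the Bellman equation, so the mean is
that of the omitted term. -/
lemma IsModel.noiseMean_eq (h : IsModel M m π ν Ψ θ Q) :
    noiseMean m π ν Ψ θ = (gramInvSqrt π ν Ψ).mulVec (-(M.rho • M.meanFeature)) := by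
  have e : ∑ x, ∑ y, (M.w x * M.P x y) • (M.noise x y - M.rho • M.Ψ x) =
      -(M.rho • M.meanFeature) := by
    ext k
    have e1 : (∑ x, ∑ y, (M.w x * M.P x y) • (M.noise x y - M.rho • M.Ψ x)) k =
        M.st (fun x y => Pi.single k 1 ⬝ᵥ M.noise x y - M.rho * (Pi.single k 1 ⬝ᵥ M.Ψ x)) := by
      simp only [Finset.sum_apply, Pi.smul_apply, Pi.sub_apply, smul_eq_mul,
        single_one_dotProduct, TDModel.st, Finset.mul_sum]
      exact Finset.sum_congr rfl fun x _ => Finset.sum_congr rfl fun y _ => by ring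
    rw [e1, M.st_sub, TDModel.st_dot_noise, M.st_mul,
      M.st_left (fun x => Pi.single k 1 ⬝ᵥ M.Ψ x), ← TDModel.dot_meanFeature,
      single_one_dotProduct]
    simp
  rw [← e, noiseMean]
  simp only [h.noiseVec_eq, Matrix.mulVec_sum, Matrix.mulVec_smul, h.w_eq, h.P_eq]

/-- With G = B^{-1/2} one has I - M = G A G, hence (I - M)⁻¹ G = G⁻¹A⁻¹, where G⁻¹ = B G. Since
|G⁻¹u|² = u·Bu = ‖Ψu‖_D², the trace is the mean of ‖ΨA⁻¹(·)‖_D² of the centred noise. -/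
lemma IsModel.trace_eq (h : IsModel M m π ν Ψ θ Q) :
    ((1 - projTransition m π ν Ψ)⁻¹ * noiseCov m π ν Ψ θ *
      ((1 - projTransition m π ν Ψ)⁻¹).transpose).trace =
    M.st (fun x y =>
      M.nD (M.val (M.solve (M.noise x y - M.rho • (M.Ψ x - M.meanFeature))))) := by
  set B := gram π ν Ψ with hB
  set G := gramInvSqrt π ν Ψ with hG
  obtain ⟨hGt, hGBG, hBGG, hcomm⟩ := cfc_inv_sqrt_relations (B := B) gram_isHermitian
    (by have := M.mu_pos; rwa [h.mu_eq] at this) (G := G) rfl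
  have hAinv : M.meanMat * M.meanMat⁻¹ = 1 :=
    Matrix.mul_nonsing_inv _ ((Matrix.isUnit_iff_isUnit_det _).mp M.isUnit_meanMat)
  have hone : 1 - projTransition m π ν Ψ = G * M.meanMat * G := by
    rw [h.meanMat_eq, projTransition, orthoFeatures, ← hG, Matrix.transpose_mul, hGt]
    have e : (1 : Matrix (Fin d) (Fin d) ℝ) = G * (Ψ.transpose * weightMatrix π ν * Ψ) * G :=
      hGBG.symm
    rw [e]
    simp only [Matrix.mul_sub, Matrix.sub_mul, Matrix.mul_one, Matrix.mul_assoc]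
  set R := (1 - projTransition m π ν Ψ)⁻¹ with hR
  have hR1 : R = B * G * M.meanMat⁻¹ * (B * G) := by
    refine Matrix.inv_eq_right_inv ?_
    rw [hone]
    calc G * M.meanMat * G * (B * G * M.meanMat⁻¹ * (B * G)) =
        G * M.meanMat * (G * B * G) * M.meanMat⁻¹ * (B * G) := by simp only [Matrix.mul_assoc]
      _ = G * (M.meanMat * M.meanMat⁻¹) * (B * G) := by
          rw [hGBG]; simp only [Matrix.mul_assoc, Matrix.one_mul]
      _ = 1 := by rw [hAinv, Matrix.mul_one, ← Matrix.mul_assoc, hGBG]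
  have hRG : R * G = B * G * M.meanMat⁻¹ := by
    rw [hR1, Matrix.mul_assoc, hBGG, Matrix.mul_one]
  have hBt : B.transpose = B := by
    have := gram_isHermitian (π := π) (ν := ν) (Ψ := Ψ)
    rwa [Matrix.IsHermitian, Matrix.conjTranspose_eq_transpose_of_trivial] at this
  have hsq : ∀ u : Fin d → ℝ, (B * G).mulVec u ⬝ᵥ (B * G).mulVec u = M.nD (M.val u) := by
    intro u
    have e : (B * G).transpose * (B * G) = B := by
      rw [Matrix.transpose_mul, hGt, hBt]
      calc G * B * (B * G) = G * B * (G * B) := by rw [hcomm]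
        _ = (G * B * G) * B := by simp only [Matrix.mul_assoc]
        _ = B := by rw [hGBG, Matrix.one_mul]
    rw [Matrix.dotProduct_mulVec, ← Matrix.mulVec_transpose, Matrix.mulVec_mulVec, e,
      dotProduct_comm, hB, dot_gram, TDModel.nD, h.w_eq, h.val_eq]
    simp only [sq]
    rfl
  have hdev : ∀ x y, R.mulVec (noiseVec m π ν Ψ θ x y - noiseMean m π ν Ψ θ) =
      (B * G).mulVec (M.solve (M.noise x y - M.rho • (M.Ψ x - M.meanFeature))) := by
    intro x y
    rw [h.noiseVec_eq, h.noiseMean_eq, ← hG, ← Matrix.mulVec_sub, Matrix.mulVec_mulVec, hRG,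
      TDModel.solve, Matrix.mulVec_mulVec, smul_sub]
    congr 1
    abel
  rw [noiseCov, Matrix.mul_sum, Matrix.sum_mul, Matrix.trace_sum, TDModel.st]
  refine Finset.sum_congr rfl fun x _ => ?_
  rw [Matrix.mul_sum, Matrix.sum_mul, Matrix.trace_sum, Finset.mul_sum]
  refine Finset.sum_congr rfl fun y _ => ?_
  rw [Matrix.mul_smul, Matrix.smul_mul, Matrix.trace_smul, trace_conj_vecMulVec, hdev, hsq,
    h.w_eq, h.P_eq, smul_eq_mul, mul_assoc]

lemma IsModel.noiseBound (h : IsModel M m π ν Ψ θ Q) : M.NoiseBound (wOne m π ν Ψ θ Q) := by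
  have hml : 0 < M.mu * M.lam ^ 2 := mul_pos M.mu_pos (pow_pos M.lam_pos 2)
  have hgap : M.gap = normD π ν (Q - Ψ.mulVec θ) ^ 2 := by
    rw [← h.nD_eq, ← TDModel.nD_neg, TDModel.gap, h.val_eq, h.θ_eq, h.Q_eq]
    congr 1
    ext x; simp
  have hst : 0 ≤ M.st (fun x y =>
      M.nD (M.val (M.solve (M.noise x y - M.rho • (M.Ψ x - M.meanFeature))))) :=
    M.st_nonneg fun _ _ => M.nD_nonneg _
  have hg : 0 ≤ 4 / (M.mu * M.lam ^ 2) * M.gap := mul_nonneg (by positivity) M.gap_nonneg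
  have e : wOne m π ν Ψ θ Q = 22 * M.st (fun x y =>
      M.nD (M.val (M.solve (M.noise x y - M.rho • (M.Ψ x - M.meanFeature))))) +
      4 / (M.mu * M.lam ^ 2) * M.gap := by
    rw [wOne, h.trace_eq, hgap, h.mu_eq, h.lam_eq]
  constructor
  · refine M.noiseVar_le.trans (add_le_add ?_ le_rfl)
    rw [e]; linarith
  · rw [e]; linarith

end Noise

/-! ### The algorithm as the error recursion of the abstract model. -/

section AlgorithmModel

variable {S A : Type*} [Fintype S] [Fintype A] [DecidableEq S] [DecidableEq A] {m : MDP S A}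
  {π : Policy S A} {ν : S → ℝ} {d : ℕ} {Ψ : Matrix (S × A) (Fin d) ℝ}
  {M : TDModel (S × A) d} {θ : Fin d → ℝ} {Q : S × A → ℝ} {q : Params}

lemma IsModel.rhoTilde_eq (h : IsModel M m π ν Ψ θ Q) (hN' : (0 : ℝ) < q.N') (k : ℕ)
    (z : ℕ → S × A) : rhoTilde m q (fun n => z (k + n)) = M.rho + M.rhoErr q k z := by
  rw [rhoTilde, TDModel.rhoErr, h.c_eq]
  simp only [← add_assoc, Finset.sum_sub_distrib, Finset.sum_const, Finset.card_range,
    nsmul_eq_mul]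
  field_simp
  ring

lemma IsModel.gHat_eq (h : IsModel M m π ν Ψ θ Q) (hN' : (0 : ℝ) < q.N') (k : ℕ)
    (u : (ℕ → S × A) → Fin d → ℝ) (z : ℕ → S × A) :
    gHat m Ψ q (fun n => z (k + n)) (u z + θ) = M.gradEst q k u z := by
  rw [gHat, TDModel.gradEst, h.rhoTilde_eq hN']
  congr 1
  refine Finset.sum_congr rfl fun i _ => ?_
  simp only [← add_assoc]
  rw [stochOp, TDModel.gradTerm, TDModel.noise, ← add_smul, ← add_smul, h.Ψ_eq, h.c_eq, h.θ_eq]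
  congr 1
  simp only [TDModel.val, h.Ψ_eq, sub_dotProduct, dotProduct_add]
  ring

/-- The cost and ρ̃ cancel in the difference of the two stochastic operators, so the errors obey a
recursion in which only ĝ carries them. -/
lemma IsModel.innerIter_eq (h : IsModel M m π ν Ψ θ Q) (hN' : (0 : ℝ) < q.N') (k : ℕ)
    (u : (ℕ → S × A) → Fin d → ℝ) (z : ℕ → S × A) (t : ℕ) :
    innerIter m Ψ q (fun n => z (k + n)) (u z + θ) t = M.innerErr q k u t z + θ := by
  induction t with
  | zero => rfl
  | succ t ih =>
    rw [TDModel.innerErr_succ]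
    simp only [innerIter]
    rw [ih, h.gHat_eq hN', add_sub_right_comm]
    congr 4
    rw [stochOp, stochOp, ← sub_smul, h.Ψ_eq]
    simp only [← add_assoc]
    congr 1
    simp only [sub_dotProduct, dotProduct_add, dotProduct_sub]
    ring

lemma IsModel.vrtd_eq (h : IsModel M m π ν Ψ θ Q) (hN' : (0 : ℝ) < q.N') (hT : (0 : ℝ) < q.T)
    (θ0 : Fin d → ℝ) (z : ℕ → S × A) (k : ℕ) :
    vrtd m Ψ q z θ0 k = M.iterErr q (θ0 - θ) k z + θ := by
  induction k with
  | zero => simp [vrtd, TDModel.iterErr]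
  | succ k ih =>
    simp only [vrtd, TDModel.iterErr, epoch]
    rw [ih]
    simp only [h.innerIter_eq hN', Finset.sum_add_distrib, Finset.sum_const, Finset.card_range,
      smul_add]
    rw [← Nat.cast_smul_eq_nsmul ℝ q.T θ, smul_smul, one_div, inv_mul_cancel₀ hT.ne', one_smul]

end AlgorithmModel

/-! ### Assembly. -/

section Main

variable {S A : Type*} [Fintype S] [Fintype A] [DecidableEq S] [DecidableEq A] {m : MDP S A}
  {π : Policy S A} {ν : S → ℝ} {d : ℕ} {Ψ : Matrix (S × A) (Fin d) ℝ}

lemma ParamConditions.pos {CP ϱ : ℝ} {q : Params} (hCP : 0 < CP) (hϱ : 0 < ϱ)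
    (h : ParamConditions m π ν Ψ CP ϱ q) :
    0 < oneSubBeta m π ν Ψ ∧ 0 < minEig π ν Ψ ∧ 0 < minWeight π ν ∧ 0 < constM m π ν Ψ CP := by
  obtain ⟨hη, hηl, -, -, -, hτ, hτ'⟩ := h
  have hC : 0 ≤ constM m π ν Ψ CP :=
    mul_nonneg (mul_nonneg (div_nonneg hCP.le (Real.sqrt_nonneg _)) (specNorm_nonneg _))
      (specNorm_nonneg _)
  have h1 : 0 < √(minEig π ν Ψ) * q.η / constM m π ν Ψ CP := (pow_pos hϱ _).trans_le hτ
  -- Division by zero is zero, so the positive lower bound ϱ^τ of the quotient forces C_M ≠ 0 and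
  -- then μ > 0. The bound on ϱ^τ' gives a positive least weight in the same way.
  have hC' : 0 < constM m π ν Ψ CP := hC.lt_of_ne fun e => by
    rw [← e, div_zero] at h1
    exact h1.false
  refine ⟨by linarith, ?_, ?_, hC'⟩
  · have h2 : 0 < √(minEig π ν Ψ) * q.η := by
      have := mul_pos h1 hC'
      rwa [div_mul_cancel₀ _ hC'.ne'] at this
    exact Real.sqrt_pos.mp (pos_of_mul_pos_left h2 hη.le)
  · have h2 := (pow_pos hϱ q.τ').trans_le (hτ'.trans (min_le_left _ _))
    have := mul_pos h2 hCP
    rwa [div_mul_cancel₀ _ hCP.ne'] at this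

/-- The mean of the output is an expectation over finite paths in the abstract model. -/
lemma IsModel.integral_vrtd {M : TDModel (S × A) d} {θ : Fin d → ℝ} {Q : S × A → ℝ} {q : Params}
    {Ω : Type*} [MeasurableSpace Ω] {ℙ : Measure Ω} [IsProbabilityMeasure ℙ]
    {Y : ℕ → Ω → S × A} (h : IsModel M m π ν Ψ θ Q) (hq : M.Tuned q)
    (hY : IsTrajectory m π ℙ Y) (x0 : S × A) {K L : ℕ} (hL : K * epochLength q ≤ L)
    (θ0 : Fin d → ℝ) :
    ∫ ω, vrtd m Ψ q (fun n => Y n ω) θ0 K ∂ℙ =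
      ExV (fun i : Fin L → S × A => ℙ.real (pathEvent Y i)) (extendPath x0)
        (M.iterErr q (θ0 - θ) K) + θ := by
  have hdep : DependsOn (M.iterErr q (θ0 - θ) K) (Set.Iio L) := fun z z' hz =>
    TDModel.dependsOn_iterErr (M := M) (θ0 - θ) K fun n hn => hz n (lt_of_lt_of_le hn hL)
  have hdep' : DependsOn (fun z => M.iterErr q (θ0 - θ) K z + θ) (Set.Iio L) := fun z z' hz =>
    congrArg (· + θ) (hdep hz)
  have hone : ∑ i : Fin L → S × A, ℙ.real (pathEvent Y i) = 1 := by
    have := integral_path (ℙ := ℙ) hY.1 x0 L (f := fun _ => (1 : ℝ)) fun _ _ _ => rfl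
    simpa using this.symm
  simp only [h.vrtd_eq hq.N'_pos hq.T_pos]
  rw [integral_path hY.1 x0 L hdep']
  simp only [smul_add, Finset.sum_add_distrib]
  rw [← Finset.sum_smul, hone, one_smul]
  congr 1
  ext j
  simp only [Finset.sum_apply, Pi.smul_apply, smul_eq_mul, ExV, Ex]

end Main

end AverageReward

end

open AverageReward

theorem theorem2 :
    ∃ b₁ b₂ : ℝ, 0 < b₁ ∧ 0 < b₂ ∧
      ∀ (S A : Type*) [Fintype S] [Fintype A] [DecidableEq S] [DecidableEq A]
        (m : MDP S A) (π : Policy S A) (ν : S → ℝ) (CP ϱ cbar : ℝ)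
        (d : ℕ) (Ψ : Matrix (S × A) (Fin d) ℝ) (θstar : Fin d → ℝ) (bhat : ℝ)
        (Ω : Type*) [MeasurableSpace Ω] (ℙ : Measure Ω) [IsProbabilityMeasure ℙ]
        (X : ℕ → Ω → S × A) (q : Params) (K : ℕ) (θ0 : Fin d → ℝ),
        IsErgodic m π →
        (∀ s a, 0 < π.prob s a) →
        IsStationary (stateMatrix m π) ν →
        0 < CP → 0 < ϱ → ϱ < 1 → MixingBound m π ν CP ϱ →
        (∀ s a, |m.cost s a| ≤ cbar) →
        0 < d → AdmissibleFeatures Ψ →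
        SolvesProjectedBellman m π ν Ψ θstar →
        (∀ b : ℝ, normD π ν (fun x => basicQ m π ν x + bhat - Ψ.mulVec θstar x) ≤
          normD π ν (fun x => basicQ m π ν x + b - Ψ.mulVec θstar x)) →
        IsTrajectory m π ℙ X →
        ParamConditions m π ν Ψ CP ϱ q →
        normD π ν (Ψ.mulVec (∫ ω, vrtd m Ψ q (fun n => X n ω) θ0 K ∂ℙ) - Ψ.mulVec θstar) ^ 2 ≤
          1 / 2 ^ K * normD π ν (Ψ.mulVec θ0 - Ψ.mulVec θstar) ^ 2 +
            (b₁ * constMax m π ν Ψ CP ^ 2 * ϱ ^ (2 * q.τ') +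
              b₂ * constMax m π ν Ψ CP * ϱ ^ q.τ /
                (oneSubBeta m π ν Ψ * Real.sqrt (minEig π ν Ψ))) *
            (normD π ν (Ψ.mulVec θ0 - Ψ.mulVec θstar) ^ 2 +
              wOne m π ν Ψ θstar (fun x => basicQ m π ν x + bhat) / (q.N : ℝ) + cbar ^ 2) := by
  -- Twice the constants 200 and 2 of `Mixes.convergence`.
  refine ⟨400, 4, by norm_num, by norm_num, ?_⟩
  intro S A _ _ _ _ m π ν CP ϱ cbar d Ψ θstar bhat Ω _ ℙ _ Y q K θ0 _ _ hν hCP hϱ hϱ1 hmix hc hd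
    hΨ hθ _ hY hpar
  obtain ⟨hlam, hmu, hw, hCM⟩ := hpar.pos hCP hϱ
  obtain ⟨hη, hηl, hT, hN, hN', hτ, hτ'⟩ := hpar
  have hC1 : CP ≤ constMax m π ν Ψ CP := le_max_left _ _
  have hC2 : constM m π ν Ψ CP ≤ constMax m π ν Ψ CP :=
    (le_max_left _ _).trans (le_max_right _ _)
  have hC0 : 0 < constMax m π ν Ψ CP := hCP.trans_le hC1
  -- The analysis runs with ϱ' ≤ ϱ, for which blocks decorrelate by 1/4; monotonicity of powers
  -- restores ϱ in the final bound.
  obtain ⟨ϱ', hϱ', hle, hmix', hrate⟩ := hmix.exists_rate (τ' := q.τ') hν hCP hϱ hϱ1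
    ((hτ'.trans (min_le_right _ _)).trans
      (one_div_le_one_div_of_le (by linarith) (by linarith)))
  have hpow : ∀ n : ℕ, ϱ' ^ n ≤ ϱ ^ n := fun n => pow_le_pow_left₀ hϱ'.le hle n
  let M : TDModel (S × A) d := toModel m π ν Ψ θstar bhat cbar CP ϱ' hν hCP hϱ'
    (hle.trans_lt hϱ1) hmix' hc hd hΨ hθ hw hmu hlam
  have hM : IsModel M m π ν Ψ θstar (fun x => basicQ m π ν x + bhat) :=
    ⟨rfl, rfl, rfl, rfl, rfl, rfl, rfl, rfl, hν⟩
  have hK0 : M.CP * M.K0 = constM m π ν Ψ CP := by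
    change CP * (specNorm (1 - pairMatrix m π) * specNorm Ψ / √(minWeight π ν)) =
      CP / √(minWeight π ν) * specNorm Ψ * specNorm (1 - pairMatrix m π)
    ring
  have hq : M.Tuned q := by
    refine ⟨hη, hηl, hT, hN, hN', ?_, ?_, hrate⟩
    · rw [hK0]
      have := (le_div_iff₀ hCM).mp ((hpow q.τ).trans hτ)
      rwa [mul_comm] at this
    · have := (le_div_iff₀ hCP).mp ((hpow q.τ').trans (hτ'.trans (min_le_left _ _)))
      rwa [mul_comm] at this
  have hW := hM.noiseBound
  obtain ⟨x0⟩ := M.nonempty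
  -- The slack τ' + 2 serves the index condition of `Mixes.sum_sq_le`, which counts one block more
  -- than is read.
  have hconv := (hY.mixes M hM.P_eq hM.w_eq hmix' x0
    (K * epochLength q + q.τ' + 2)).convergence hq hW hC1 (hK0.trans_le hC2) (θ0 - θstar) K
    (by omega)
  have hstart : M.nD (M.val (θ0 - θstar)) =
      normD π ν (Ψ.mulVec θ0 - Ψ.mulVec θstar) ^ 2 := by
    rw [hM.nD_eq, hM.val_eq, Matrix.mulVec_sub]
  rw [hM.integral_vrtd hq hY x0 (L := K * epochLength q + q.τ' + 2) (by omega) θ0,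
    Matrix.mulVec_add, add_sub_cancel_right, ← hM.val_eq, ← hM.nD_eq]
  rw [hstart] at hconv
  refine hconv.trans (add_le_add le_rfl ?_)
  have hWN : 0 ≤ wOne m π ν Ψ θstar (fun x => basicQ m π ν x + bhat) / (q.N : ℝ) :=
    div_nonneg hW.nonneg (Nat.cast_nonneg _)
  rw [← mul_assoc]
  refine mul_le_mul_of_nonneg_right ?_ (by positivity)
  change 2 * (200 * (constMax m π ν Ψ CP * ϱ' ^ q.τ') ^ 2 + 2 * (constMax m π ν Ψ CP *
    ϱ' ^ q.τ / (oneSubBeta m π ν Ψ * √(minEig π ν Ψ)))) ≤ _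
  calc _ ≤ 2 * (200 * (constMax m π ν Ψ CP * ϱ ^ q.τ') ^ 2 + 2 * (constMax m π ν Ψ CP *
        ϱ ^ q.τ / (oneSubBeta m π ν Ψ * √(minEig π ν Ψ)))) := by
        gcongr
    _ = _ := by rw [mul_comm 2 q.τ', pow_mul]; ring
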